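/- **Setting.** Let $n\ge 2$, $p=2n+1$, and let $\theta_1,\dots,\theta_p$ be angles whose directions $(\cos\theta_l,\sin\theta_l)$ are pairwise distinct (for instance $\theta_l=2\pi(l-1)/p$). Let $C_0,\rho,\mu,M>0$. An *element* of size $h>0$ is a compact set $K_0\subset\mathbb R^2$ of diameter at most $h$ that is star-shaped with respect to every point of some ball of radius $\rho h$ contained in it and that contains its barycenter $\mathbf r_0$ (e.g. a shape-regular convex polygon). Let $\xi\ge\mu$ be a real function on $K_0$, $\xi\in C^{q+1}(K_0)$, and $\mathcal L u=-(\Delta u+\omega^2\xi u)$. Norms: $\|v\|_{C^k(K_0)}=\max_{j\le k}\sup_{K_0}\|D^jv\|$. **GOPW functions.** Let $q\ge2$. A *phase of order $q$* with angle $\theta$ is a real polynomial $\tau$ in $\mathbf r-\mathbf r_0$ of degree at most $q+2$, with zero constant term and linear part $\sqrt{\xi(\mathbf r_0)}\,(\cos\theta,\sin\theta)\cdot(\mathbf r-\mathbf r_0)$, such that the terms of degree at most $q+1$ of $|\nabla\tau|^2$ form the Taylor polynomial of degree $q+1$ of $\xi$ at $\mathbf r_0$. An *amplitude of order $q$* for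 $\tau$ is $a=\sum_{s=0}^{q-2}(i\omega)^{-s}a_s$ with $a(\mathbf r_0)=1$, where $a_s$ is a complex polynomial in $\mathbf r-\mathbf r_0$ of degree at most $q+1-s$, such that (with $a_{-1}=0$) all terms of degree less than $q+1-s$ of $2\nabla a_s\cdot\nabla\tau+a_s\Delta\tau+\Delta a_{s-1}$ vanish for $0\le s\le q-2$, and $\Delta a_{q-2}=0$. Given phases $\tau_l$ with angles $\theta_l$ and amplitudes $a_l$ for them ($1\le l\le p$), set $V^{(1)}_{p,q}(K_0)=\operatorname{span}_{\mathbb C}\{a_l e^{i\omega\tau_l}:1\le l\le p\}$. We say that the coefficients are bounded by $B$ if all coefficients of degree $d$ of all $\tau_l$ and $a_{l,s}$ have modulus at most $B^{d+1}$. **Theorem 2.1.** (a) For every $q\ge 2$ there is $B>0$, depending only on $q,n,(\theta_l),\rho,\mu,M$, such that for every element $K_0$ (of any size $h>0$) and every $\xi\in C^{q+1}(K_0)$ with $\xi\ge\mu$ and $\|\xi\|_{C^{q+1}(K_0)}\le M$ there are phases $\tau_l$ with angles $\theta_l$ and amplitude components $a_{l,s}$ of order $q$, not depending on $\omega>0$,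 with coefficients bounded by $B$. (b) For all $A,B>0$ there are $\omega_0>1$ and $C>0$, depending only on $n,(\theta_l),C_0,\rho,\mu,M,A,B$ (hence independent of $h$ and $\omega$), such that the following holds whenever $\omega\ge\omega_0$, $h>0$, $\omega h\le C_0$ and $$q=\max\Big\{2,\Big[\frac{(n-4)\ln(\omega h)^{-1}}{\ln\omega}\Big]\Big\}.$$ Let $K_0$ be an element of size $h$, let $\xi\in C^{q+1}(K_0)$, $\xi\ge\mu$, $\|\xi\|_{C^{\min(q+1,n)}(K_0)}\le M$, and let $V^{(1)}_{p,q}(K_0)$ be spanned by the functions $a_le^{i\omega\tau_l}$ for any phases $\tau_l$ with angles $\theta_l$ and amplitudes $a_l$ of order $q$ whose coefficients are bounded by $B$. 1. If $u\in C^{n+1}(K_0)$ satisfies $\mathcal Lu=0$ on $K_0$ and $\|u\|_{C^j(K_0)}\le A\omega^j$ for $0\le j\le n+1$, then there is $u_p\in V^{(1)}_{p,q}(K_0)$ with $$\|u-u_p\|_{\infty,K_0}\le C\,h^{n+1}\omega^{n+1}\quad\text{and}\quad \|u-u_p\|_{C^l(K_0)}\le C\,h^{k-l}\omega^k\quad(3\le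 k\le n+1,\ l=0,1).$$ 2. If $3\le k\le n+1$ and $u\in C^k(K_0)$ satisfies $\mathcal Lu=0$ on $K_0$ and $\|u\|_{C^j(K_0)}\le A\omega^j$ for $0\le j\le k$, then there is $u_p\in V^{(1)}_{p,q}(K_0)$ with $\|u-u_p\|_{C^l(K_0)}\le C\,h^{k-l}\omega^k$ for $l=0,1$. -/

import Mathlib

open MeasureTheory MvPolynomial
open scoped ENNReal InnerProductSpace Nat

noncomputable section

namespace GOPW

/-- The Euclidean plane. -/
abbrev Plane := EuclideanSpace ℝ (Fin 2)

/-- The barycenter of a planar region. -/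
def barycenter (K : Set Plane) : Plane := ⨍ x in K, x

/-- The norm of `C^k(K)`, as an extended real number: the supremum over `K` of (the operator norms
of) all derivatives of order at most `k`. -/
def ckNorm {F : Type*} [NormedAddCommGroup F] [NormedSpace ℝ F]
    (K : Set Plane) (k : ℕ) (f : Plane → F) : ℝ≥0∞ :=
  ⨆ j ∈ Finset.range (k + 1), ⨆ x ∈ K, ‖iteratedFDerivWithin ℝ j f K x‖ₑ

/-- An element of size `h` of a quasi-uniform partition, with regularity parameter `ρ`: a compact
region of diameter at most `h`, star-shaped with respect to all points of a ball of radius `ρ h`,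
which contains its barycenter (every shape-regular convex polygon is one). -/
structure IsElement (K : Set Plane) (h ρ : ℝ) : Prop where
  isCompact : IsCompact K
  diam_le : Metric.diam K ≤ h
  star : ∃ c : Plane, Metric.ball c (ρ * h) ⊆ K ∧
    ∀ y ∈ Metric.ball c (ρ * h), StarConvex ℝ y K
  barycenter_mem : barycenter K ∈ K

/-- `∇f · ∇g` for polynomials in two variables. -/
def gradDot {R : Type*} [CommSemiring R] (f g : MvPolynomial (Fin 2) R) :
    MvPolynomial (Fin 2) R :=
  ∑ i, pderiv i f * pderiv i g

/-- `Δf` for polynomials in two variables. -/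
def polyLap {R : Type*} [CommSemiring R] (f : MvPolynomial (Fin 2) R) :
    MvPolynomial (Fin 2) R :=
  ∑ i, pderiv i (pderiv i f)

/-- A real polynomial with complex coefficients. -/
def toComplex (τ : MvPolynomial (Fin 2) ℝ) : MvPolynomial (Fin 2) ℂ :=
  MvPolynomial.map (algebraMap ℝ ℂ) τ

/-- `τ`, a polynomial in the local coordinates `r - r₀` (with `r₀` the barycenter of `K`), is a
phase polynomial of order `q` with direction angle `θ`: its degree is at most `q + 2`, it has no
constant term, its linear part is `√ξ(r₀) (cos θ, sin θ)`, and the terms of `|∇τ|²` of degree at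
most `q + 1` are those of the Taylor polynomial of `ξ` at `r₀`. -/
structure IsPhase (K : Set Plane) (ξ : Plane → ℝ) (q : ℕ) (θ : ℝ)
    (τ : MvPolynomial (Fin 2) ℝ) : Prop where
  degree_le : τ.totalDegree ≤ q + 2
  constant : constantCoeff τ = 0
  linear_x : coeff (Finsupp.single 0 1) τ = √(ξ (barycenter K)) * Real.cos θ
  linear_y : coeff (Finsupp.single 1 1) τ = √(ξ (barycenter K)) * Real.sin θ
  eikonal : ∀ j ≤ q + 1, ∀ v : Plane,
    eval (fun i => v i) (homogeneousComponent j (gradDot τ τ)) =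
      ((j ! : ℕ) : ℝ)⁻¹ * iteratedFDerivWithin ℝ j ξ K (barycenter K) (fun _ => v)

/-- `a 0, …, a (q - 2)`, polynomials in the local coordinates, are the components of an amplitude
`∑ s, a s / (iω)^s` of order `q` for the phase `τ`, with the terminating index `q - 2`: the degree
of `a s` is at most `q + 1 - s`, the recursive transport equations hold up to terms of order
`q + 1 - s`, the last component is harmonic, and the amplitude is `1` at the barycenter. -/
structure IsAmplitude (q : ℕ) (ω : ℝ) (τ : MvPolynomial (Fin 2) ℝ)
    (a : ℕ → MvPolynomial (Fin 2) ℂ) : Prop where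
  degree_le : ∀ s ≤ q - 2, (a s).totalDegree ≤ q + 1 - s
  transport_zero : ∀ m : Fin 2 →₀ ℕ, m.degree < q + 1 →
    coeff m (2 * gradDot (a 0) (toComplex τ) + a 0 * polyLap (toComplex τ)) = 0
  transport_succ : ∀ s, s + 1 ≤ q - 2 → ∀ m : Fin 2 →₀ ℕ, m.degree < q + 1 - (s + 1) →
    coeff m (2 * gradDot (a (s + 1)) (toComplex τ) + a (s + 1) * polyLap (toComplex τ)
      + polyLap (a s)) = 0
  harmonic_last : polyLap (a (q - 2)) = 0
  normalized : ∑ s ∈ Finset.range (q - 1),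
    (Complex.I * ω)⁻¹ ^ s * constantCoeff (a s) = 1

/-- The coefficients of degree `d` of the phase and of the amplitude components are bounded by
`B ^ (d + 1)`. -/
structure CoeffBound (q : ℕ) (B : ℝ) (τ : MvPolynomial (Fin 2) ℝ)
    (a : ℕ → MvPolynomial (Fin 2) ℂ) : Prop where
  phase : ∀ m, |coeff m τ| ≤ B ^ (m.degree + 1)
  amplitude : ∀ s ≤ q - 2, ∀ m, ‖coeff m (a s)‖ ≤ B ^ (m.degree + 1)

/-- The basis function `a e^{iωτ}` with `a = ∑_{s = 0}^{q - 2} a_s / (iω)^s`. -/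
def basisFun (K : Set Plane) (q : ℕ) (ω : ℝ) (τ : MvPolynomial (Fin 2) ℝ)
    (a : ℕ → MvPolynomial (Fin 2) ℂ) (r : Plane) : ℂ :=
  (∑ s ∈ Finset.range (q - 1), (Complex.I * ω)⁻¹ ^ s *
      eval (fun i => (((r - barycenter K) i : ℝ) : ℂ)) (a s)) *
    Complex.exp (Complex.I * ω * ((eval (fun i => (r - barycenter K) i) τ : ℝ) : ℂ))

/-- The space `V^{(1)}_{p,q}(K)` spanned by the `p` basis functions `a_l e^{iωτ_l}`. -/
def space {p : ℕ} (K : Set Plane) (q : ℕ) (ω : ℝ) (τ : Fin p → MvPolynomial (Fin 2) ℝ)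
    (a : Fin p → ℕ → MvPolynomial (Fin 2) ℂ) : Submodule ℂ (Plane → ℂ) :=
  Submodule.span ℂ (Set.range fun l => basisFun K q ω (τ l) (a l))

/-- The order `q = max {2, [(n - 4) ln (ωh)⁻¹ / ln ω]}`. -/
def order (n : ℕ) (ω h : ℝ) : ℕ :=
  max 2 ⌊((n : ℝ) - 4) * Real.log ((ω * h)⁻¹) / Real.log ω⌋₊

/-- `u ∈ C^k(K)` solves `Δu + ω² ξ u = 0` on `K` and satisfies the stability bounds
`‖u‖_{C^j(K)} ≤ A ω^j`, `0 ≤ j ≤ k`. -/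
structure IsStableSolution (K : Set Plane) (ξ : Plane → ℝ) (ω A : ℝ) (k : ℕ)
    (u : Plane → ℂ) : Prop where
  contDiffOn : ContDiffOn ℝ k u K
  helmholtz : ∀ x ∈ K, (Δ[K] u) x + ((ω ^ 2 * ξ x : ℝ) : ℂ) * u x = 0
  stability : ∀ j ≤ k, ckNorm K j u ≤ ENNReal.ofReal (A * ω ^ j)

end GOPW

end

/-! Part (b). The coefficients `x l` are chosen so that the error e = u - ∑ x_l w_l satisfies (∂₁ ±
i∂₂)^j e(r₀) = 0 for all j < k. For k = n + 1 these are 2n + 1 conditions, since the two signs agree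
at j = 0. As a_l(r₀) = 1 and τ_l has linear part κ(cos θ_l, sin θ_l) with κ = √ξ(r₀), the j-th
derivative of w_l is (iωκ)^j e^{±ijθ_l} + O(ω^{j-1}). After scaling of the rows the system is
therefore a perturbation, of size O(1/ω), of a Vandermonde-type matrix, and for large ω it has a
solution with bounded coefficients (`exists_coefficients`).

The conditions say that the Taylor polynomial P of degree less than k of e vanishes on both
isotropic lines t ↦ (t, ±it). A harmonic polynomial is a sum f(x + iy) + g(x - iy), so it is zero if
it vanishes on both lines (`eq_zero_of_harmonic_of_line`). By finite dimension and scaling, P is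
bounded by C h² sup |ΔP| (`exists_wnorm_le_of_polyLap`). Up to Taylor remainders ΔP is Δe = -ω²ξe -
∑ x_l (Δw_l + ω²ξw_l). The first term contributes C(ωh)² sup |e|, which is absorbed when ωh is small
(`exists_error_bound`). The residuals of the w_l are bounded through the eikonal and transport
equations (`exists_residual_bound`), and the choice of q makes h² times them at most a constant
times (ωh)^{n+1} (`order_estimate`). When ωh is bounded below, the stability bounds alone suffice.

Since q grows with the parameters, every estimate of phases and amplitudes must be free of q. This
is the role of the weighted norm `wnorm` at radius R = 1/(4B): the coefficient bounds give norm at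
most 2B there whatever the degree, a derivative costs half the radius but no factor of the degree,
and vanishing to order j gains (h/R)^j.

Part (a). Eikonal and transport equations are solved one degree at a time: to leading order each
correction g has to satisfy (c, s) · ∇g = f, which is solvable on homogeneous polynomials
(`exists_gradDot_lin_eq_pow_mul`). The last amplitude must moreover be harmonic. Harmonic primitives
exist for f of degree 0 and 1, but in degree 2 there remains a multiple of Y², where Y = -s x + c y
(`exists_harmonic_primitive_two`). Since (c, s) · ∇Y = 0 and ΔY⁴ = 12 Y², a multiple of Y⁴ removes
it: it is added to the preceding amplitude if q > 2, and to the phase if q = 2. -/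

noncomputable section

namespace GOPW

/-! ### Weighted coefficient norms and orders of vanishing -/

section Norms

variable {𝕜 : Type*} [RCLike 𝕜]

/-- The weighted `ℓ¹` norm `∑ |p_m| R^{|m|}` of a polynomial. -/
def wnorm (R : ℝ) (p : MvPolynomial (Fin 2) 𝕜) : ℝ :=
  ∑ m ∈ p.support, ‖coeff m p‖ * R ^ m.degree

lemma wnorm_eq_sum {R : ℝ} {p : MvPolynomial (Fin 2) 𝕜} {s : Finset (Fin 2 →₀ ℕ)}
    (h : p.support ⊆ s) : wnorm R p = ∑ m ∈ s, ‖coeff m p‖ * R ^ m.degree := by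
  refine Finset.sum_subset h fun m _ hm => ?_
  simp [notMem_support_iff.mp hm]

lemma wnorm_nonneg {R : ℝ} (hR : 0 ≤ R) (p : MvPolynomial (Fin 2) 𝕜) : 0 ≤ wnorm R p :=
  Finset.sum_nonneg fun _ _ => by positivity

@[simp] lemma wnorm_zero (R : ℝ) : wnorm R (0 : MvPolynomial (Fin 2) 𝕜) = 0 := by
  simp [wnorm]

lemma wnorm_add_le {R : ℝ} (hR : 0 ≤ R) (p q : MvPolynomial (Fin 2) 𝕜) :
    wnorm R (p + q) ≤ wnorm R p + wnorm R q := by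
  classical
  rw [wnorm_eq_sum (p := p + q) support_add, wnorm_eq_sum (Finset.subset_union_left (s₂ := q.support)),
    wnorm_eq_sum (Finset.subset_union_right (s₁ := p.support)), ← Finset.sum_add_distrib]
  refine Finset.sum_le_sum fun m _ => ?_
  rw [coeff_add, ← add_mul]
  gcongr
  exact norm_add_le _ _

lemma wnorm_sum_le {ι : Type*} {R : ℝ} (hR : 0 ≤ R) (s : Finset ι)
    (f : ι → MvPolynomial (Fin 2) 𝕜) :
    wnorm R (∑ i ∈ s, f i) ≤ ∑ i ∈ s, wnorm R (f i) := by
  classical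
  induction s using Finset.induction_on with
  | empty => simp
  | insert a s ha ih =>
    rw [Finset.sum_insert ha, Finset.sum_insert ha]
    exact (wnorm_add_le hR _ _).trans (by gcongr)

lemma wnorm_monomial (R : ℝ) (m : Fin 2 →₀ ℕ) (a : 𝕜) :
    wnorm R (monomial m a) = ‖a‖ * R ^ m.degree := by
  classical
  rw [wnorm_eq_sum (s := {m}) support_monomial_subset]
  simp

lemma wnorm_C (R : ℝ) (a : 𝕜) : wnorm R (C a : MvPolynomial (Fin 2) 𝕜) = ‖a‖ := by
  simpa using wnorm_monomial R 0 a

lemma wnorm_one (R : ℝ) : wnorm R (1 : MvPolynomial (Fin 2) 𝕜) = 1 := by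
  simpa using wnorm_C R (1 : 𝕜)

lemma wnorm_X (R : ℝ) (i : Fin 2) : wnorm R (X i : MvPolynomial (Fin 2) 𝕜) = R := by
  simpa [X] using wnorm_monomial R (Finsupp.single i 1) (1 : 𝕜)

lemma wnorm_C_mul (R : ℝ) (a : 𝕜) (p : MvPolynomial (Fin 2) 𝕜) :
    wnorm R (C a * p) = ‖a‖ * wnorm R p := by
  have : (C a * p).support ⊆ p.support := fun m hm => by
    rw [mem_support_iff, coeff_C_mul] at hm
    exact mem_support_iff.mpr (right_ne_zero_of_mul hm)
  rw [wnorm_eq_sum this, wnorm, Finset.mul_sum]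
  simp [mul_assoc]

lemma wnorm_neg (R : ℝ) (p : MvPolynomial (Fin 2) 𝕜) : wnorm R (-p) = wnorm R p := by
  simpa using wnorm_C_mul R (-1 : 𝕜) p

lemma wnorm_sub_le {R : ℝ} (hR : 0 ≤ R) (p q : MvPolynomial (Fin 2) 𝕜) :
    wnorm R (p - q) ≤ wnorm R p + wnorm R q := by
  simpa [sub_eq_add_neg, wnorm_neg] using wnorm_add_le hR p (-q)

lemma wnorm_mul_le {R : ℝ} (hR : 0 ≤ R) (p q : MvPolynomial (Fin 2) 𝕜) :
    wnorm R (p * q) ≤ wnorm R p * wnorm R q := by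
  have key : p * q = ∑ m ∈ p.support, ∑ n ∈ q.support,
      monomial (m + n) (coeff m p * coeff n q) := by
    conv_lhs => rw [← support_sum_monomial_coeff p, ← support_sum_monomial_coeff q]
    rw [Finset.sum_mul_sum]
    simp [monomial_mul]
  rw [key]
  refine (wnorm_sum_le hR _ _).trans ?_
  rw [wnorm, wnorm, Finset.sum_mul_sum]
  refine Finset.sum_le_sum fun m _ => (wnorm_sum_le hR _ _).trans_eq
    (Finset.sum_congr rfl fun n _ => ?_)
  rw [wnorm_monomial, norm_mul, map_add, pow_add]
  ring

lemma wnorm_pow_le {R : ℝ} (hR : 0 ≤ R) (p : MvPolynomial (Fin 2) 𝕜) (k : ℕ) :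
    wnorm R (p ^ k) ≤ wnorm R p ^ k := by
  induction k with
  | zero => simp [wnorm_one]
  | succ k ih =>
    rw [pow_succ, pow_succ]
    exact (wnorm_mul_le hR _ _).trans
      (mul_le_mul_of_nonneg_right ih (wnorm_nonneg hR _))

lemma wnorm_mono {R R' : ℝ} (hR : 0 ≤ R) (h : R ≤ R') (p : MvPolynomial (Fin 2) 𝕜) :
    wnorm R p ≤ wnorm R' p :=
  Finset.sum_le_sum fun _ _ => by gcongr

/-- A derivative estimate reduces to one scalar inequality per degree. It is used with half the
radius, where no factor of the degree appears, and with the same radius, where the degree enters. -/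
lemma wnorm_le_sum_of_pderiv {R R' c : ℝ} (hR : 0 ≤ R)
    (i : Fin 2) (p : MvPolynomial (Fin 2) 𝕜)
    (h : ∀ m ∈ p.support, 1 ≤ m.degree → (m.degree : ℝ) * R ^ (m.degree - 1) ≤ c * R' ^ m.degree)
    (hc : 0 ≤ c) (hR' : 0 ≤ R') :
    wnorm R (pderiv i p) ≤ c * wnorm R' p := by
  conv_lhs => rw [← support_sum_monomial_coeff p, map_sum]
  refine (wnorm_sum_le hR _ _).trans ?_
  rw [wnorm, Finset.mul_sum]
  refine Finset.sum_le_sum fun m hm => ?_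
  rw [pderiv_monomial, wnorm_monomial]
  rcases Nat.eq_zero_or_pos (m i) with h0 | h0
  · simp only [h0, Nat.cast_zero, mul_zero, norm_zero, zero_mul]
    positivity
  have hle : m i ≤ m.degree := Finsupp.le_degree i m
  have hdeg : (m - Finsupp.single i 1).degree = m.degree - 1 := by
    have h1 : (m - Finsupp.single i 1) + Finsupp.single i 1 = m :=
      tsub_add_cancel_of_le (by simpa [Nat.one_le_iff_ne_zero] using h0.ne')
    have h2 := congrArg Finsupp.degree h1
    rw [map_add, Finsupp.degree_single] at h2
    omega
  rw [hdeg, norm_mul]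
  have h3 : ‖((m i : ℕ) : 𝕜)‖ ≤ m.degree := by
    rw [RCLike.norm_natCast]; exact_mod_cast hle
  calc ‖coeff m p‖ * ‖((m i : ℕ) : 𝕜)‖ * R ^ (m.degree - 1)
      ≤ ‖coeff m p‖ * m.degree * R ^ (m.degree - 1) := by gcongr
    _ = ‖coeff m p‖ * (m.degree * R ^ (m.degree - 1)) := by ring
    _ ≤ ‖coeff m p‖ * (c * R' ^ m.degree) := by
        exact mul_le_mul_of_nonneg_left (h m hm (by omega)) (norm_nonneg _)
    _ = _ := by ring

/-- The factor d + 1 from differentiating a term of degree d + 1 is at most 2^d, which the smaller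
radius compensates. The constant does not see the degree of `p`. -/
lemma wnorm_pderiv_le {R : ℝ} (hR : 0 < R) (i : Fin 2) (p : MvPolynomial (Fin 2) 𝕜) :
    wnorm (R / 2) (pderiv i p) ≤ R⁻¹ * wnorm R p := by
  refine wnorm_le_sum_of_pderiv (by positivity) i p (fun m _ hm => ?_) (by positivity) hR.le
  obtain ⟨d, hd⟩ : ∃ d, m.degree = d + 1 := ⟨m.degree - 1, by omega⟩
  have h1 : ((d + 1 : ℕ) : ℝ) ≤ 2 ^ d := by exact_mod_cast Nat.lt_two_pow_self (n := d)
  rw [hd, Nat.add_sub_cancel, div_pow, pow_succ R d, mul_comm (R ^ d), inv_mul_cancel_left₀ hR.ne',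
    mul_div_assoc', div_le_iff₀ (by positivity)]
  nlinarith [pow_pos hR d]

lemma wnorm_one_pderiv_le {N : ℕ} (i : Fin 2) {p : MvPolynomial (Fin 2) 𝕜}
    (hp : p.totalDegree ≤ N) : wnorm 1 (pderiv i p) ≤ N * wnorm 1 p := by
  refine wnorm_le_sum_of_pderiv zero_le_one i p (fun m hm _ => ?_) (by positivity) zero_le_one
  simp only [one_pow, mul_one]
  have := le_totalDegree hm
  exact_mod_cast (by simpa [Finsupp.degree_apply, Finsupp.sum] using this.trans hp)

lemma norm_coeff_le_wnorm (p : MvPolynomial (Fin 2) 𝕜) (m : Fin 2 →₀ ℕ) :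
    ‖coeff m p‖ ≤ wnorm 1 p := by
  by_cases hm : m ∈ p.support
  · have := Finset.single_le_sum (f := fun m => ‖coeff m p‖ * (1 : ℝ) ^ m.degree)
      (fun _ _ => by positivity) hm
    simpa [wnorm] using this
  · simpa [notMem_support_iff.mp hm] using wnorm_nonneg zero_le_one p

lemma wnorm_map (R : ℝ) (p : MvPolynomial (Fin 2) ℝ) : wnorm R (toComplex p) = wnorm R p := by
  have hs : (toComplex p).support ⊆ p.support := support_map_subset _ _
  rw [wnorm_eq_sum hs, wnorm]
  simp [toComplex, coeff_map]

lemma norm_eval_monomial_le {h : ℝ} {v : Fin 2 → 𝕜} (hv : ∀ i, ‖v i‖ ≤ h)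
    (m : Fin 2 →₀ ℕ) : ‖m.prod fun i k => v i ^ k‖ ≤ h ^ m.degree := by
  have : 0 ≤ h := (norm_nonneg _).trans (hv 0)
  rw [Finsupp.prod_fintype _ _ (by simp), Finsupp.degree_eq_sum, ← Finset.prod_pow_eq_pow_sum,
    norm_prod]
  refine Finset.prod_le_prod (fun _ _ => by positivity) fun i _ => ?_
  rw [norm_pow]
  exact pow_le_pow_left₀ (norm_nonneg _) (hv i) _

lemma norm_eval_le {h : ℝ} {v : Fin 2 → 𝕜} (hv : ∀ i, ‖v i‖ ≤ h)
    (p : MvPolynomial (Fin 2) 𝕜) : ‖eval v p‖ ≤ wnorm h p := by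
  rw [eval_eq]
  refine (norm_sum_le _ _).trans (Finset.sum_le_sum fun m _ => ?_)
  rw [norm_mul]
  gcongr
  simpa [Finsupp.prod] using norm_eval_monomial_le hv m

/-- All terms of degree less than `j` of `p` vanish. -/
def Vanish (j : ℕ) (p : MvPolynomial (Fin 2) 𝕜) : Prop :=
  ∀ m : Fin 2 →₀ ℕ, m.degree < j → coeff m p = 0

/-- Every surviving monomial has degree at least `j`, and passing from radius `R` to `h` gains h/R
per degree. This turns the truncated eikonal and transport equations into powers of `h`. -/
lemma Vanish.wnorm_le {j : ℕ} {p : MvPolynomial (Fin 2) 𝕜} (hp : Vanish j p) {h R : ℝ}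
    (hh : 0 ≤ h) (hR : 0 < R) (hhR : h ≤ R) : wnorm h p ≤ (h / R) ^ j * wnorm R p := by
  rw [wnorm, wnorm, Finset.mul_sum]
  refine Finset.sum_le_sum fun m hm => ?_
  have hj : j ≤ m.degree := by
    by_contra hlt
    exact mem_support_iff.mp hm (hp m (by omega))
  obtain ⟨d, hd⟩ := Nat.exists_eq_add_of_le hj
  rw [hd, pow_add, pow_add, div_pow]
  have h1 : h ^ d ≤ R ^ d := pow_le_pow_left₀ hh hhR d
  have : h ^ j / R ^ j * (‖coeff m p‖ * (R ^ j * R ^ d)) = ‖coeff m p‖ * (h ^ j * R ^ d) := by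
    field_simp
  rw [this]
  gcongr

lemma Vanish.zero (j : ℕ) : Vanish j (0 : MvPolynomial (Fin 2) 𝕜) := fun _ _ => by simp

lemma Vanish.of_zero (p : MvPolynomial (Fin 2) 𝕜) : Vanish 0 p := fun _ h => by simp at h

lemma Vanish.mono {i j : ℕ} (h : i ≤ j) {p : MvPolynomial (Fin 2) 𝕜} (hp : Vanish j p) :
    Vanish i p := fun m hm => hp m (hm.trans_le h)

lemma Vanish.add {j : ℕ} {p q : MvPolynomial (Fin 2) 𝕜} (hp : Vanish j p) (hq : Vanish j q) :
    Vanish j (p + q) := fun m hm => by rw [coeff_add, hp m hm, hq m hm, add_zero]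

lemma Vanish.sub {j : ℕ} {p q : MvPolynomial (Fin 2) 𝕜} (hp : Vanish j p) (hq : Vanish j q) :
    Vanish j (p - q) := fun m hm => by rw [coeff_sub, hp m hm, hq m hm, sub_zero]

lemma Vanish.neg {j : ℕ} {p : MvPolynomial (Fin 2) 𝕜} (hp : Vanish j p) :
    Vanish j (-p) := fun m hm => by rw [coeff_neg, hp m hm, neg_zero]

lemma Vanish.sum {ι : Type*} {j : ℕ} {s : Finset ι} {f : ι → MvPolynomial (Fin 2) 𝕜}
    (h : ∀ i ∈ s, Vanish j (f i)) : Vanish j (∑ i ∈ s, f i) := fun m hm => by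
  rw [coeff_sum]
  exact Finset.sum_eq_zero fun i hi => h i hi m hm

lemma Vanish.mul {i j : ℕ} {p q : MvPolynomial (Fin 2) 𝕜} (hp : Vanish i p) (hq : Vanish j q) :
    Vanish (i + j) (p * q) := fun m hm => by
  classical
  rw [coeff_mul]
  refine Finset.sum_eq_zero fun x hx => ?_
  have hdeg : x.1.degree + x.2.degree = m.degree := by
    rw [← map_add, Finset.HasAntidiagonal.mem_antidiagonal.mp hx]
  rcases lt_or_ge x.1.degree i with h | h
  · rw [hp _ h, zero_mul]
  · rw [hq _ (by omega), mul_zero]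

lemma Vanish.mul_left {j : ℕ} (p : MvPolynomial (Fin 2) 𝕜) {q : MvPolynomial (Fin 2) 𝕜}
    (hq : Vanish j q) : Vanish j (p * q) := by
  simpa using (Vanish.of_zero p).mul hq

lemma Vanish.mul_right {j : ℕ} {p : MvPolynomial (Fin 2) 𝕜} (hp : Vanish j p)
    (q : MvPolynomial (Fin 2) 𝕜) : Vanish j (p * q) := by
  simpa using hp.mul (Vanish.of_zero q)

lemma coeff_pderiv_eq (i : Fin 2) (p : MvPolynomial (Fin 2) 𝕜) (m : Fin 2 →₀ ℕ) :
    coeff m (pderiv i p) = coeff (m + Finsupp.single i 1) p * (m i + 1) := by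
  classical
  induction p using MvPolynomial.induction_on' with
  | add p q hp hq => simp [hp, hq, add_mul]
  | monomial n a =>
    rw [pderiv_monomial, coeff_monomial, coeff_monomial]
    by_cases h : n = m + Finsupp.single i 1
    · subst h; simp
    · rw [if_neg h, zero_mul]
      split_ifs with h2
      · rcases Nat.eq_zero_or_pos (n i) with h0 | h0
        · simp [h0]
        · exfalso
          apply h
          rw [← h2]
          exact (tsub_add_cancel_of_le (by simpa [Nat.one_le_iff_ne_zero] using h0.ne')).symm
      · rfl

lemma Vanish.pderiv {j : ℕ} {p : MvPolynomial (Fin 2) 𝕜} (hp : Vanish (j + 1) p) (i : Fin 2) :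
    Vanish j (pderiv i p) := fun m hm => by
  rw [coeff_pderiv_eq, hp _ (by rw [map_add, Finsupp.degree_single]; omega), zero_mul]

lemma Vanish.gradDot {i j : ℕ} {p q : MvPolynomial (Fin 2) 𝕜} (hp : Vanish (i + 1) p)
    (hq : Vanish (j + 1) q) : Vanish (i + j) (gradDot p q) :=
  Vanish.sum fun k _ => (hp.pderiv k).mul (hq.pderiv k)

lemma Vanish.polyLap {j : ℕ} {p : MvPolynomial (Fin 2) 𝕜} (hp : Vanish (j + 2) p) :
    Vanish j (polyLap p) :=
  Vanish.sum fun k _ => (hp.pderiv k).pderiv k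

/-- At radius 1/(4B) the term of index m is at most B (1/4)^{|m|}, and the double geometric series
sums to at most (4/3)² < 2. Hence the bound holds uniformly in the degree of `p`, and so in q. -/
lemma wnorm_le_of_coeff_le {B : ℝ} (hB : 0 < B) {p : MvPolynomial (Fin 2) 𝕜}
    (h : ∀ m, ‖coeff m p‖ ≤ B ^ (m.degree + 1)) : wnorm (4 * B)⁻¹ p ≤ 2 * B := by
  classical
  obtain ⟨N, hN⟩ : ∃ N, ∀ m ∈ p.support, m 0 < N ∧ m 1 < N := by
    refine ⟨p.totalDegree + 1, fun m hm => ?_⟩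
    have h1 := le_totalDegree hm
    have h2 : ∀ i, m i ≤ m.degree := fun i => Finsupp.le_degree i m
    have h3 : m.degree ≤ p.totalDegree := by
      simpa [Finsupp.degree_apply, Finsupp.sum] using h1
    exact ⟨by have := h2 0; omega, by have := h2 1; omega⟩
  have geom : ∑ a ∈ Finset.range N, (1 / 4 : ℝ) ^ a ≤ 4 / 3 := by
    rw [geom_sum_eq (by norm_num)]
    have : (0 : ℝ) ≤ (1 / 4) ^ N := by positivity
    rw [div_le_iff_of_neg (by norm_num)]
    linarith
  have geom0 : 0 ≤ ∑ a ∈ Finset.range N, (1 / 4 : ℝ) ^ a :=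
    Finset.sum_nonneg fun _ _ => by positivity
  calc wnorm (4 * B)⁻¹ p ≤ ∑ m ∈ p.support, B * ((1 / 4 : ℝ) ^ m 0 * (1 / 4 : ℝ) ^ m 1) := by
        refine Finset.sum_le_sum fun m _ => ?_
        have hd : m.degree = m 0 + m 1 := by simp [Finsupp.degree_eq_sum]
        calc ‖coeff m p‖ * (4 * B)⁻¹ ^ m.degree ≤ B ^ (m.degree + 1) * (4 * B)⁻¹ ^ m.degree := by
              gcongr; exact h m
          _ = B * (1 / 4 : ℝ) ^ m.degree := by
              rw [mul_inv, mul_pow, pow_succ, one_div]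
              have : B ^ m.degree * B⁻¹ ^ m.degree = 1 := by
                rw [← mul_pow, mul_inv_cancel₀ hB.ne', one_pow]
              linear_combination B * (4 : ℝ)⁻¹ ^ m.degree * this
          _ = _ := by rw [hd, pow_add]
    _ ≤ ∑ x ∈ Finset.range N ×ˢ Finset.range N,
          B * ((1 / 4 : ℝ) ^ x.1 * (1 / 4 : ℝ) ^ x.2) := by
        have hinj : Set.InjOn (fun m : Fin 2 →₀ ℕ => (m 0, m 1)) p.support := fun m _ m' _ hmm => by
          simp only [Prod.mk.injEq] at hmm
          ext i
          fin_cases i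
          exacts [hmm.1, hmm.2]
        rw [← Finset.sum_image (f := fun x : ℕ × ℕ => B * ((1 / 4 : ℝ) ^ x.1 * (1 / 4 : ℝ) ^ x.2))
          hinj]
        refine Finset.sum_le_sum_of_subset_of_nonneg (fun x hx => ?_) fun _ _ _ => by positivity
        obtain ⟨m, hm, rfl⟩ := Finset.mem_image.mp hx
        simpa using hN m hm
    _ = B * ((∑ a ∈ Finset.range N, (1 / 4 : ℝ) ^ a) * ∑ a ∈ Finset.range N, (1 / 4 : ℝ) ^ a) := by
        rw [Finset.sum_product, Finset.sum_mul_sum, Finset.mul_sum]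
        simp only [Finset.mul_sum]
    _ ≤ B * (4 / 3 * (4 / 3)) := by gcongr
    _ ≤ 2 * B := by linarith

end Norms

/-! ### Partial derivatives on star-shaped elements -/

section Calculus

variable {F : Type*} [NormedAddCommGroup F] [NormedSpace ℝ F]

/-- The geometric properties of an element which the Taylor estimates use. -/
structure IsTame (K : Set Plane) (h : ℝ) (r₀ c : Plane) : Prop where
  unique : UniqueDiffOn ℝ K
  subset_closure : K ⊆ closure (interior K)
  base_mem : r₀ ∈ K
  center_mem : c ∈ K
  star : StarConvex ℝ c K
  dist_le : ∀ x ∈ K, ∀ y ∈ K, dist x y ≤ h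

/-- Through each point x of `K` passes the cone with apex x over the ball. It lies in `K` by
star-shapedness and is convex with interior points, which gives unique derivatives at x and puts x
in the closure of the interior. -/
lemma IsElement.exists_isTame {K : Set Plane} {h ρ : ℝ} (hK : IsElement K h ρ) (hh : 0 < h)
    (hρ : 0 < ρ) : ∃ c, Metric.ball c (ρ * h) ⊆ K ∧ IsTame K h (barycenter K) c := by
  obtain ⟨c, hcK, hstar⟩ := hK.star
  have hpos : 0 < ρ * h := mul_pos hρ hh
  have hcb : c ∈ Metric.ball c (ρ * h) := Metric.mem_ball_self hpos
  have cone : ∀ x ∈ K, ∃ s ⊆ K, x ∈ s ∧ Convex ℝ s ∧ (interior s).Nonempty := by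
    intro x hx
    refine ⟨convexJoin ℝ {x} (Metric.ball c (ρ * h)), ?_, ?_,
      (convex_singleton x).convexJoin (convex_ball _ _), ?_⟩
    · intro z hz
      rw [mem_convexJoin] at hz
      obtain ⟨a, rfl, b, hb, hz⟩ := hz
      rw [segment_symm] at hz
      exact starConvex_iff_segment_subset.mp (hstar b hb) hx hz
    · exact subset_convexJoin_left ⟨c, hcb⟩ rfl
    · exact ⟨c, interior_maximal (subset_convexJoin_right (Set.singleton_nonempty x))
        Metric.isOpen_ball hcb⟩
  refine ⟨c, hcK, fun x hx => ?_, fun x hx => ?_, hK.barycenter_mem, hcK hcb, hstar c hcb,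
    fun x hx y hy => (Metric.dist_le_diam_of_mem hK.isCompact.isBounded hx hy).trans hK.diam_le⟩
  · obtain ⟨s, hsK, hxs, hconv, hint⟩ := cone x hx
    exact (uniqueDiffOn_convex hconv hint x hxs).mono hsK
  · obtain ⟨s, hsK, hxs, hconv, hint⟩ := cone x hx
    have := hconv.closure_interior_eq_closure_of_nonempty_interior hint
    exact closure_mono (interior_mono hsK) (this ▸ subset_closure hxs)

/-- The partial derivative in the `i`-th coordinate, within `K`. -/
def pd (K : Set Plane) (i : Fin 2) (f : Plane → F) (x : Plane) : F :=
  fderivWithin ℝ f K x (EuclideanSpace.single i 1)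

variable {K : Set Plane} {h : ℝ} {r₀ c : Plane}

lemma contDiffOn_pd (hu : UniqueDiffOn ℝ K) {k : ℕ} {f : Plane → F}
    (hf : ContDiffOn ℝ ((k + 1 : ℕ) : WithTop ℕ∞) f K) (i : Fin 2) :
    ContDiffOn ℝ (k : WithTop ℕ∞) (pd K i f) K :=
  (hf.fderivWithin hu (by norm_cast)).clm_apply contDiffOn_const

lemma pd_congr {f g : Plane → F} (hfg : Set.EqOn f g K) (i : Fin 2) :
    Set.EqOn (pd K i f) (pd K i g) K := fun x hx => by
  rw [pd, pd, fderivWithin_congr' hfg hx]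

/-- Symmetry of the second derivative holds in the interior and extends to boundary points by
continuity; this is why `K` has to lie in the closure of its interior. -/
lemma pd_comm (hu : UniqueDiffOn ℝ K) (hcl : K ⊆ closure (interior K)) {f : Plane → F}
    (hf : ContDiffOn ℝ 2 f K) (i j : Fin 2) :
    Set.EqOn (pd K i (pd K j f)) (pd K j (pd K i f)) K := fun x hx => by
  have hd : DifferentiableWithinAt ℝ (fderivWithin ℝ f K) K x :=
    (hf.fderivWithin hu (m := 1) (by norm_num)).differentiableOn one_ne_zero x hx
  have key : ∀ v w : Plane, fderivWithin ℝ (fun y => fderivWithin ℝ f K y v) K x w =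
      fderivWithin ℝ (fderivWithin ℝ f K) K x w v := fun v w => by
    rw [fderivWithin_clm_apply (hu x hx) hd (differentiableWithinAt_const v)]
    simp
  have hsymm := (hf x hx).isSymmSndFDerivWithinAt (by simp) hu (hcl hx) hx
  change fderivWithin ℝ (fun y => fderivWithin ℝ f K y _) K x _ =
    fderivWithin ℝ (fun y => fderivWithin ℝ f K y _) K x _
  rw [key, key]
  exact hsymm _ _

lemma plane_eq_sum (v : Plane) : v = ∑ i, v i • EuclideanSpace.single i (1 : ℝ) := by
  ext j
  fin_cases j <;> simp

lemma fderivWithin_apply_eq_sum (f : Plane → F) (x v : Plane) :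
    fderivWithin ℝ f K x v = ∑ i, v i • pd K i f x := by
  conv_lhs => rw [plane_eq_sum v]
  simp [pd]

lemma norm_fderivWithin_le_of_pd {f : Plane → F} {x : Plane} {N : ℝ}
    (hN : ∀ i, ‖pd K i f x‖ ≤ N) : ‖fderivWithin ℝ f K x‖ ≤ 2 * N := by
  have hN0 : 0 ≤ N := (norm_nonneg _).trans (hN 0)
  refine ContinuousLinearMap.opNorm_le_bound _ (by positivity) fun v => ?_
  rw [fderivWithin_apply_eq_sum, Fin.sum_univ_two]
  have h1 : ∀ i, ‖v i • pd K i f x‖ ≤ ‖v‖ * N := fun i => by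
    rw [norm_smul]
    exact mul_le_mul (PiLp.norm_apply_le v i) (hN i) (norm_nonneg _) (norm_nonneg _)
  exact (norm_add_le _ _).trans (by linarith [h1 0, h1 1])

/-- All iterated partial derivatives of order `k` are bounded by `N` on `K`. -/
def PartialsLE (K : Set Plane) : ℕ → ℝ → (Plane → F) → Prop
  | 0, N, f => ∀ x ∈ K, ‖f x‖ ≤ N
  | k + 1, N, f => ∀ i, PartialsLE K k N (pd K i f)

lemma PartialsLE.congr {k : ℕ} {N : ℝ} {f g : Plane → F} (hf : PartialsLE K k N f)
    (hfg : Set.EqOn f g K) : PartialsLE K k N g := by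
  induction k generalizing f g with
  | zero => exact fun x hx => hfg hx ▸ hf x hx
  | succ k ih => exact fun i => ih (hf i) (pd_congr hfg i)

lemma PartialsLE.mono {k : ℕ} {N N' : ℝ} (hN : N ≤ N') {f : Plane → F}
    (hf : PartialsLE K k N f) : PartialsLE K k N' f := by
  induction k generalizing f with
  | zero => exact fun x hx => (hf x hx).trans hN
  | succ k ih => exact fun i => ih (hf i)

lemma iteratedFDerivWithin_pd (hu : UniqueDiffOn ℝ K) {k : ℕ} {f : Plane → F}
    (hf : ContDiffOn ℝ ((k + 1 : ℕ) : WithTop ℕ∞) f K) (i : Fin 2) {x : Plane} (hx : x ∈ K) :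
    iteratedFDerivWithin ℝ k (pd K i f) K x =
      (ContinuousLinearMap.apply ℝ F (EuclideanSpace.single i (1 : ℝ) : Plane)).compContinuousMultilinearMap
        (iteratedFDerivWithin ℝ k (fderivWithin ℝ f K) K x) :=
  (ContinuousLinearMap.apply ℝ F (EuclideanSpace.single i (1 : ℝ) : Plane)).iteratedFDerivWithin_comp_left
    (n := k) ((hf.fderivWithin hu (by norm_cast)) x hx) hu hx le_rfl

lemma norm_iteratedFDerivWithin_pd_le (hu : UniqueDiffOn ℝ K) {k : ℕ} {f : Plane → F}
    (hf : ContDiffOn ℝ ((k + 1 : ℕ) : WithTop ℕ∞) f K) (i : Fin 2) {x : Plane} (hx : x ∈ K) :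
    ‖iteratedFDerivWithin ℝ k (pd K i f) K x‖ ≤ ‖iteratedFDerivWithin ℝ (k + 1) f K x‖ := by
  rw [iteratedFDerivWithin_pd hu hf i hx, ← norm_iteratedFDerivWithin_fderivWithin hu hx]
  refine (ContinuousLinearMap.norm_compContinuousMultilinearMap_le _ _).trans ?_
  refine mul_le_of_le_one_left (norm_nonneg _) ?_
  refine ContinuousLinearMap.opNorm_le_bound _ zero_le_one fun g => ?_
  simpa using g.le_opNorm (EuclideanSpace.single i (1 : ℝ) : Plane)

lemma partialsLE_of_iteratedFDerivWithin (hu : UniqueDiffOn ℝ K) {k : ℕ} {N : ℝ} {f : Plane → F}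
    (hf : ContDiffOn ℝ (k : WithTop ℕ∞) f K)
    (hN : ∀ x ∈ K, ‖iteratedFDerivWithin ℝ k f K x‖ ≤ N) : PartialsLE K k N f := by
  induction k generalizing f with
  | zero => exact fun x hx => by simpa using hN x hx
  | succ k ih =>
    exact fun i => ih (contDiffOn_pd hu hf i) fun x hx =>
      (norm_iteratedFDerivWithin_pd_le hu hf i hx).trans (hN x hx)

lemma norm_iteratedFDerivWithin_le_of_ckNorm {k j : ℕ} (hj : j ≤ k) {f : Plane → F} {N : ℝ}
    (hN : 0 ≤ N) (hf : ckNorm K k f ≤ ENNReal.ofReal N) {x : Plane} (hx : x ∈ K) :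
    ‖iteratedFDerivWithin ℝ j f K x‖ ≤ N := by
  have h1 : ‖iteratedFDerivWithin ℝ j f K x‖ₑ ≤ ckNorm K k f :=
    le_iSup₂_of_le j (Finset.mem_range.mpr (by omega)) (le_iSup₂_of_le x hx le_rfl)
  have h2 := h1.trans hf
  rwa [← ofReal_norm, ENNReal.ofReal_le_ofReal_iff hN] at h2

lemma partialsLE_of_ckNorm (hu : UniqueDiffOn ℝ K) {k j : ℕ} (hj : j ≤ k) {f : Plane → F} {N : ℝ}
    (hN : 0 ≤ N) (hc : ContDiffOn ℝ (k : WithTop ℕ∞) f K) (hf : ckNorm K k f ≤ ENNReal.ofReal N) :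
    PartialsLE K j N f :=
  partialsLE_of_iteratedFDerivWithin hu (hc.of_le (by exact_mod_cast hj)) fun _ hx =>
    norm_iteratedFDerivWithin_le_of_ckNorm hj hN hf hx

lemma laplacianWithin_eq_pd (hu : UniqueDiffOn ℝ K) {f : Plane → F} (hf : ContDiffOn ℝ 2 f K)
    {x : Plane} (hx : x ∈ K) : (Δ[K] f) x = pd K 0 (pd K 0 f) x + pd K 1 (pd K 1 f) x := by
  rw [InnerProductSpace.laplacianWithin_eq_iteratedFDerivWithin_orthonormalBasis f hu hx
    (EuclideanSpace.basisFun (Fin 2) ℝ), Fin.sum_univ_two]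
  have hd : DifferentiableWithinAt ℝ (fderivWithin ℝ f K) K x :=
    (hf.fderivWithin hu (m := 1) (by norm_num)).differentiableOn one_ne_zero x hx
  have key : ∀ i : Fin 2, pd K i (pd K i f) x = iteratedFDerivWithin ℝ 2 f K x
      ![EuclideanSpace.basisFun (Fin 2) ℝ i, EuclideanSpace.basisFun (Fin 2) ℝ i] := fun i => by
    rw [iteratedFDerivWithin_two_apply _ hu hx]
    change fderivWithin ℝ (fun y => fderivWithin ℝ f K y _) K x _ = _
    rw [fderivWithin_clm_apply (hu x hx) hd (differentiableWithinAt_const _)]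
    simp
  rw [key, key]

/-- The segment from `r₀` to `x` may leave `K`, so the path goes through the star centre `c`. The 4
consists of two legs of length at most `h` and of the factor 2 between partials and operator norm.
-/
lemma norm_sub_le_of_pd (hK : IsTame K h r₀ c) {f : Plane → F} (hf : DifferentiableOn ℝ f K)
    {N : ℝ} (hN : ∀ i, ∀ x ∈ K, ‖pd K i f x‖ ≤ N) {x : Plane} (hx : x ∈ K) :
    ‖f x - f r₀‖ ≤ N * (4 * h) := by
  have hN0 : 0 ≤ N := (norm_nonneg _).trans (hN 0 x hx)
  have seg : ∀ y ∈ K, ‖f y - f c‖ ≤ 2 * N * h := fun y hy => by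
    have hsub : segment ℝ c y ⊆ K := starConvex_iff_segment_subset.mp hK.star hy
    have := (convex_segment c y).norm_image_sub_le_of_norm_hasFDerivWithin_le
      (f := f) (f' := fderivWithin ℝ f K) (C := 2 * N)
      (fun z hz => (hf z (hsub hz)).hasFDerivWithinAt.mono hsub)
      (fun z hz => norm_fderivWithin_le_of_pd fun i => hN i z (hsub hz))
      (left_mem_segment ℝ c y) (right_mem_segment ℝ c y)
    refine this.trans ?_
    rw [← dist_eq_norm]
    gcongr
    exact hK.dist_le y hy c hK.center_mem
  calc ‖f x - f r₀‖ = ‖(f x - f c) - (f r₀ - f c)‖ := by congr 1; abel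
    _ ≤ ‖f x - f c‖ + ‖f r₀ - f c‖ := norm_sub_le _ _
    _ ≤ N * (4 * h) := by linarith [seg x hx, seg r₀ hK.base_mem]

end Calculus

/-! ### Taylor polynomials on an element -/

section Taylor

variable {𝕜 : Type*} [RCLike 𝕜] {K : Set Plane} {h : ℝ} {r₀ c : Plane}

/-- The function defined by a polynomial in the local coordinates `x - r₀`. -/
def peval (r₀ : Plane) (p : MvPolynomial (Fin 2) 𝕜) (x : Plane) : 𝕜 :=
  eval (fun i => algebraMap ℝ 𝕜 ((x - r₀) i)) p

lemma hasFDerivAt_peval (r₀ : Plane) (p : MvPolynomial (Fin 2) 𝕜) (x : Plane) :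
    HasFDerivAt (peval r₀ p) (∑ i, peval r₀ (pderiv i p) x •
      (RCLike.ofRealCLM (K := 𝕜)).comp (EuclideanSpace.proj i : Plane →L[ℝ] ℝ)) x := by
  induction p using MvPolynomial.induction_on with
  | C a =>
    have h3 : peval r₀ (C a : MvPolynomial (Fin 2) 𝕜) = fun _ => a := by funext x; simp [peval]
    rw [h3]
    refine (hasFDerivAt_const (𝕜 := ℝ) a x).congr_fderiv ?_
    ext v
    simp [peval]
  | add p q hp hq =>
    have h3 : ∀ p q : MvPolynomial (Fin 2) 𝕜,
        peval r₀ (p + q) = fun x => peval r₀ p x + peval r₀ q x := by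
      intro p q; funext x; simp [peval]
    rw [h3]
    refine (hp.add hq).congr_fderiv ?_
    ext v
    simp [h3]
    ring
  | mul_X p n hp =>
    have hX : HasFDerivAt (fun x : Plane => algebraMap ℝ 𝕜 ((x - r₀) n))
        ((RCLike.ofRealCLM (K := 𝕜)).comp (EuclideanSpace.proj n : Plane →L[ℝ] ℝ)) x := by
      have h1 := ((RCLike.ofRealCLM (K := 𝕜)).comp
        (EuclideanSpace.proj n : Plane →L[ℝ] ℝ)).hasFDerivAt (x := x - r₀)
      have h2 := h1.comp x ((hasFDerivAt_id x).sub_const r₀)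
      simpa [Function.comp_def] using h2
    have := hp.mul hX
    have h3 : peval r₀ (p * X n) = fun x => peval r₀ p x * algebraMap ℝ 𝕜 ((x - r₀) n) := by
      funext x; simp [peval]
    rw [h3]
    refine this.congr_fderiv ?_
    ext v
    fin_cases n <;> simp [peval, Fin.sum_univ_two] <;> ring

lemma contDiff_peval (r₀ : Plane) (p : MvPolynomial (Fin 2) 𝕜) {k : WithTop ℕ∞} :
    ContDiff ℝ k (peval r₀ p) := by
  induction p using MvPolynomial.induction_on with
  | C a =>
    have h3 : peval r₀ (C a : MvPolynomial (Fin 2) 𝕜) = fun _ => a := by funext x; simp [peval]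
    rw [h3]
    exact contDiff_const
  | add p q hp hq =>
    have h3 : peval r₀ (p + q) = fun x => peval r₀ p x + peval r₀ q x := by
      funext x; simp [peval]
    rw [h3]
    exact hp.add hq
  | mul_X p n hp =>
    have h3 : peval r₀ (p * X n) = fun x => peval r₀ p x * RCLike.ofRealCLM (K := 𝕜) ((x - r₀) n) := by
      funext x; simp [peval]
    rw [h3]
    exact hp.mul ((RCLike.ofRealCLM (K := 𝕜)).contDiff.comp
      ((EuclideanSpace.proj n : Plane →L[ℝ] ℝ).contDiff.comp
        (contDiff_id.sub contDiff_const)))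

lemma pd_peval (hu : UniqueDiffOn ℝ K) (p : MvPolynomial (Fin 2) 𝕜) (i : Fin 2) :
    Set.EqOn (pd K i (peval r₀ p)) (peval r₀ (pderiv i p)) K := fun x hx => by
  rw [pd, (hasFDerivAt_peval r₀ p x).hasFDerivWithinAt.fderivWithin (hu x hx)]
  fin_cases i <;> simp [Fin.sum_univ_two]

/-- The homogeneous Taylor polynomials of a function on `K` at `r₀`. -/
def tayH (K : Set Plane) (r₀ : Plane) : ℕ → (Plane → 𝕜) → MvPolynomial (Fin 2) 𝕜
  | 0, f => C (f r₀)
  | j + 1, f => C ((j + 1 : 𝕜)⁻¹) * ∑ i, X i * tayH K r₀ j (pd K i f)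

/-- The Taylor polynomial of degree less than `k` of a function on `K` at `r₀`. -/
def tayP (K : Set Plane) (r₀ : Plane) (k : ℕ) (f : Plane → 𝕜) : MvPolynomial (Fin 2) 𝕜 :=
  ∑ j ∈ Finset.range k, tayH K r₀ j f

lemma tayH_congr (hr : r₀ ∈ K) (j : ℕ) {f g : Plane → 𝕜} (hfg : Set.EqOn f g K) :
    tayH K r₀ j f = tayH K r₀ j g := by
  induction j generalizing f g with
  | zero => simp [tayH, hfg hr]
  | succ j ih => simp only [tayH, ih (pd_congr hfg _)]

lemma tayH_isHomogeneous (j : ℕ) (f : Plane → 𝕜) : (tayH K r₀ j f).IsHomogeneous j := by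
  induction j generalizing f with
  | zero => exact isHomogeneous_C _ _
  | succ j ih =>
    rw [tayH, ← zero_add (j + 1)]
    refine (isHomogeneous_C _ _).mul (IsHomogeneous.sum _ _ _ fun i _ => ?_)
    rw [add_comm j 1]
    exact (isHomogeneous_X _ i).mul (ih _)

/-- Differentiation commutes with Taylor expansion. This lets all remainder estimates be proved by
induction on the order, without multi-index formulas. -/
lemma pderiv_tayH (hu : UniqueDiffOn ℝ K) (hcl : K ⊆ closure (interior K)) (hr : r₀ ∈ K) (j : ℕ)
    {f : Plane → 𝕜} (hf : ContDiffOn ℝ ((j + 1 : ℕ) : WithTop ℕ∞) f K) (i : Fin 2) :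
    pderiv i (tayH K r₀ (j + 1) f) = tayH K r₀ j (pd K i f) := by
  induction j generalizing f with
  | zero => fin_cases i <;> simp [tayH, Fin.sum_univ_two]
  | succ j ih =>
    have hpd : ∀ k, ContDiffOn ℝ ((j + 1 : ℕ) : WithTop ℕ∞) (pd K k f) K :=
      contDiffOn_pd hu hf
    have h2 : ContDiffOn ℝ 2 f K := hf.of_le (by exact_mod_cast (by omega : 2 ≤ j + 1 + 1))
    have hcomm : ∀ k, tayH K r₀ j (pd K i (pd K k f)) = tayH K r₀ j (pd K k (pd K i f)) :=
      fun k => tayH_congr hr j (pd_comm hu hcl h2 i k)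
    have hstep : pderiv i (tayH K r₀ (j + 1 + 1) f) = C (((j + 1 : ℕ) + 1 : 𝕜)⁻¹) *
        (tayH K r₀ (j + 1) (pd K i f) + ∑ k, X k * tayH K r₀ j (pd K k (pd K i f))) := by
      rw [tayH, pderiv_C_mul, map_sum]
      simp only [pderiv_mul, ih (hpd _), hcomm, Finset.sum_add_distrib]
      congr 2
      fin_cases i <;> simp [Fin.sum_univ_two]
    -- By the recursive definition the second sum is j + 1 times the wanted polynomial, so that the
    -- total factor is (1 + (j + 1))/(j + 2) = 1.
    have hH : ∑ k, X k * tayH K r₀ j (pd K k (pd K i f)) =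
        C ((j : 𝕜) + 1) * tayH K r₀ (j + 1) (pd K i f) := by
      rw [tayH, ← mul_assoc, ← C_mul, mul_inv_cancel₀ (by exact_mod_cast Nat.succ_ne_zero j), C_1,
        one_mul]
    have hne : ((j + 1 : ℕ) + 1 : 𝕜) ≠ 0 := by exact_mod_cast Nat.succ_ne_zero (j + 1)
    rw [hstep, hH, ← one_add_mul, ← C_1, ← C_add, ← mul_assoc, ← C_mul]
    have : ((j + 1 : ℕ) + 1 : 𝕜)⁻¹ * (1 + ((j : 𝕜) + 1)) = 1 := by
      rw [show 1 + ((j : 𝕜) + 1) = ((j + 1 : ℕ) + 1 : 𝕜) by push_cast; ring, inv_mul_cancel₀ hne]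
    rw [this, C_1, one_mul]

lemma pderiv_tayP (hu : UniqueDiffOn ℝ K) (hcl : K ⊆ closure (interior K)) (hr : r₀ ∈ K) (k : ℕ)
    {f : Plane → 𝕜} (hf : ContDiffOn ℝ ((k + 1 : ℕ) : WithTop ℕ∞) f K) (i : Fin 2) :
    pderiv i (tayP K r₀ (k + 1) f) = tayP K r₀ k (pd K i f) := by
  rw [tayP, tayP, Finset.sum_range_succ', map_add, map_sum]
  have h0 : pderiv i (tayH K r₀ 0 f) = 0 := by simp [tayH]
  rw [h0, add_zero]
  refine Finset.sum_congr rfl fun j hj => ?_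
  have := Finset.mem_range.mp hj
  exact pderiv_tayH hu hcl hr j (hf.of_le (by exact_mod_cast (by omega))) i

/-- The partials of the remainder of `f` are the remainders, one order lower, of the partials of
`f`. The remainder vanishes at `r₀`, so each integration costs a factor `4 * h`. -/
lemma norm_sub_tayP_le (hK : IsTame K h r₀ c) (k : ℕ) {N : ℝ} {f : Plane → 𝕜}
    (hf : ContDiffOn ℝ (k : WithTop ℕ∞) f K) (hN : PartialsLE K k N f) {x : Plane} (hx : x ∈ K) :
    ‖f x - peval r₀ (tayP K r₀ k f) x‖ ≤ N * (4 * h) ^ k := by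
  induction k generalizing f x with
  | zero => simpa [tayP, peval] using hN x hx
  | succ k ih =>
    set P := tayP K r₀ (k + 1) f with hP
    have hPd : Differentiable ℝ (peval r₀ P) := (contDiff_peval r₀ P (k := 1)).differentiable one_ne_zero
    have hfd : DifferentiableOn ℝ f K := hf.differentiableOn (by simp)
    have hbase : f r₀ - peval r₀ P r₀ = 0 := by
      have : ∀ j (g : Plane → 𝕜), peval r₀ (tayH K r₀ (j + 1) g) r₀ = 0 := fun j g => by
        simp [peval, tayH]
      have h2 : peval r₀ P r₀ = ∑ j ∈ Finset.range (k + 1), peval r₀ (tayH K r₀ j f) r₀ := by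
        simp [hP, tayP, peval]
      rw [h2, Finset.sum_range_succ']
      simp [tayH]
      simp [peval]
    have := norm_sub_le_of_pd hK (f := fun y => f y - peval r₀ P y) (hfd.sub hPd.differentiableOn)
      (N := N * (4 * h) ^ k) (fun i y hy => ?_) hx
    · rw [hbase, sub_zero] at this
      rw [pow_succ, ← mul_assoc]
      exact this
    · have hpd : pd K i (fun y => f y - peval r₀ P y) y =
          pd K i f y - peval r₀ (tayP K r₀ k (pd K i f)) y := by
        rw [← pderiv_tayP hK.unique hK.subset_closure hK.base_mem k hf i,
          ← pd_peval hK.unique (tayP K r₀ (k + 1) f) i hy]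
        simp only [pd]
        rw [fderivWithin_fun_sub (hK.unique y hy) (hfd y hy) (hPd y).differentiableWithinAt]
        rfl
      rw [hpd]
      exact ih (contDiffOn_pd hK.unique hf i) (hN i) hy

/-- Each step of the recursion has two summands, hence 2^j; the favourable factor 1/j! is discarded.
-/
lemma wnorm_tayH_le (hr : r₀ ∈ K) (j : ℕ) {N : ℝ} {f : Plane → 𝕜} (hN : PartialsLE K j N f) :
    wnorm 1 (tayH K r₀ j f) ≤ 2 ^ j * N := by
  induction j generalizing f with
  | zero => simpa [tayH, wnorm_C] using hN r₀ hr
  | succ j ih =>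
    rw [tayH, wnorm_C_mul, Fin.sum_univ_two]
    have h1 : ∀ i, wnorm 1 (X i * tayH K r₀ j (pd K i f)) ≤ 2 ^ j * N := fun i => by
      refine (wnorm_mul_le zero_le_one _ _).trans ?_
      rw [wnorm_X, one_mul]
      exact ih (hN i)
    have h2 : ‖((j : 𝕜) + 1)⁻¹‖ ≤ 1 := by
      rw [norm_inv]
      refine inv_le_one_of_one_le₀ ?_
      have : ‖((j + 1 : ℕ) : 𝕜)‖ = ((j + 1 : ℕ) : ℝ) := RCLike.norm_natCast _
      push_cast at this
      rw [this]
      linarith [Nat.cast_nonneg (α := ℝ) j]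
    refine (mul_le_of_le_one_left (wnorm_nonneg zero_le_one _) h2).trans ?_
    refine (wnorm_add_le zero_le_one _ _).trans ?_
    rw [pow_succ]
    linarith [h1 0, h1 1]

lemma eval_tayH (hu : UniqueDiffOn ℝ K) (hr : r₀ ∈ K) (j : ℕ) {f : Plane → 𝕜}
    (hf : ContDiffOn ℝ (j : WithTop ℕ∞) f K) (v : Plane) :
    eval (fun i => algebraMap ℝ 𝕜 (v i)) (tayH K r₀ j f) =
      ((j ! : ℕ) : 𝕜)⁻¹ * iteratedFDerivWithin ℝ j f K r₀ (fun _ => v) := by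
  induction j generalizing f with
  | zero => simp [tayH]
  | succ j ih =>
    have h1 : iteratedFDerivWithin ℝ (j + 1) f K r₀ (fun _ => v) =
        ∑ i, algebraMap ℝ 𝕜 (v i) * iteratedFDerivWithin ℝ j (pd K i f) K r₀ (fun _ => v) := by
      rw [iteratedFDerivWithin_succ_apply_right hu hr]
      simp only [iteratedFDerivWithin_pd hu hf _ hr]
      conv_lhs => rw [plane_eq_sum v]
      rw [map_sum]
      refine Finset.sum_congr rfl fun i _ => ?_
      rw [map_smul, RCLike.real_smul_eq_coe_mul]
      rw [← plane_eq_sum v]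
      rfl
    rw [h1, tayH, map_mul, map_sum, eval_C, Nat.factorial_succ, Finset.mul_sum, Finset.mul_sum]
    refine Finset.sum_congr rfl fun i _ => ?_
    rw [map_mul, eval_X, ih (contDiffOn_pd hu hf i)]
    push_cast
    rw [mul_inv]
    ring

lemma pd_sub_sum (hu : UniqueDiffOn ℝ K) {ι : Type*} [Fintype ι] {u : Plane → 𝕜}
    {w : ι → Plane → 𝕜} (x : ι → 𝕜) (hu' : DifferentiableOn ℝ u K)
    (hw : ∀ l, DifferentiableOn ℝ (w l) K) (i : Fin 2) :
    Set.EqOn (pd K i (fun y => u y - ∑ l, x l * w l y))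
      (fun y => pd K i u y - ∑ l, x l * pd K i (w l) y) K := fun y hy => by
  have h1 : ∀ l, DifferentiableWithinAt ℝ (fun y => x l * w l y) K y :=
    fun l => (hw l y hy).const_mul (x l)
  simp only [pd]
  rw [fderivWithin_fun_sub (hu y hy) (hu' y hy) (DifferentiableWithinAt.fun_sum fun l _ => h1 l),
    fderivWithin_fun_sum (hu y hy) fun l _ => h1 l]
  simp only [sub_apply, sum_apply]
  congr 1
  refine Finset.sum_congr rfl fun l _ => ?_
  rw [fderivWithin_const_mul (hu y hy) (hw l y hy)]
  rfl

lemma PartialsLE.sub_sum (hu : UniqueDiffOn ℝ K) {ι : Type*} [Fintype ι] {u : Plane → 𝕜}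
    {w : ι → Plane → 𝕜} (x : ι → 𝕜) (k : ℕ) (hu' : ContDiffOn ℝ (k : WithTop ℕ∞) u K)
    (hw : ∀ l, ContDiffOn ℝ (k : WithTop ℕ∞) (w l) K) {N N' : ℝ} (hN : PartialsLE K k N u)
    (hN' : ∀ l, PartialsLE K k N' (w l)) :
    PartialsLE K k (N + (∑ l, ‖x l‖) * N') (fun y => u y - ∑ l, x l * w l y) := by
  induction k generalizing u w with
  | zero =>
    intro y hy
    refine (norm_sub_le _ _).trans (add_le_add (hN y hy) ?_)
    rw [Finset.sum_mul]
    refine (norm_sum_le _ _).trans (Finset.sum_le_sum fun l _ => ?_)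
    rw [norm_mul]
    gcongr
    exact hN' l y hy
  | succ k ih =>
    intro i
    refine (ih (contDiffOn_pd hu hu' i) (fun l => contDiffOn_pd hu (hw l) i) (hN i)
      fun l => hN' l i).congr ?_
    exact (pd_sub_sum hu x (hu'.differentiableOn (by simp))
      (fun l => (hw l).differentiableOn (by simp)) i).symm

lemma tayH_sub_sum (hu : UniqueDiffOn ℝ K) (hr : r₀ ∈ K) {ι : Type*} [Fintype ι] {u : Plane → 𝕜}
    {w : ι → Plane → 𝕜} (x : ι → 𝕜) (j : ℕ) (hu' : ContDiffOn ℝ (j : WithTop ℕ∞) u K)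
    (hw : ∀ l, ContDiffOn ℝ (j : WithTop ℕ∞) (w l) K) :
    tayH K r₀ j (fun y => u y - ∑ l, x l * w l y) =
      tayH K r₀ j u - ∑ l, C (x l) * tayH K r₀ j (w l) := by
  induction j generalizing u w with
  | zero => simp [tayH]
  | succ j ih =>
    have hstep : ∀ i, tayH K r₀ j (pd K i (fun y => u y - ∑ l, x l * w l y)) =
        tayH K r₀ j (pd K i u) - ∑ l, C (x l) * tayH K r₀ j (pd K i (w l)) := fun i => by
      rw [tayH_congr hr j (pd_sub_sum hu x (hu'.differentiableOn (by simp))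
        (fun l => (hw l).differentiableOn (by simp)) i)]
      exact ih (contDiffOn_pd hu hu' i) fun l => contDiffOn_pd hu (hw l) i
    simp only [tayH, hstep, mul_sub, Finset.sum_sub_distrib, Finset.mul_sum]
    congr 1
    rw [Finset.sum_comm]
    refine Finset.sum_congr rfl fun l _ => Finset.sum_congr rfl fun i _ => by ring

end Taylor

/-! ### Total degree and differentiation -/

section Degree

variable {𝕜 : Type*} [RCLike 𝕜]

lemma totalDegree_le_iff_coeff {N : ℕ} {p : MvPolynomial (Fin 2) 𝕜} :
    p.totalDegree ≤ N ↔ ∀ m : Fin 2 →₀ ℕ, N < m.degree → coeff m p = 0 := by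
  constructor
  · intro h m hm
    by_contra hne
    have := le_totalDegree (mem_support_iff.mpr hne)
    have h3 : m.degree ≤ p.totalDegree := by
      simpa [Finsupp.degree_apply, Finsupp.sum] using this
    omega
  · intro h
    refine Finset.sup_le fun m hm => ?_
    by_contra hlt
    refine mem_support_iff.mp hm (h m ?_)
    simpa [Finsupp.degree_apply, Finsupp.sum] using hlt

lemma totalDegree_pderiv_le {N : ℕ} {p : MvPolynomial (Fin 2) 𝕜} (hp : p.totalDegree ≤ N + 1)
    (i : Fin 2) : (pderiv i p).totalDegree ≤ N := by
  rw [totalDegree_le_iff_coeff] at hp ⊢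
  intro m hm
  rw [coeff_pderiv_eq, hp _ (by rw [map_add, Finsupp.degree_single]; omega), zero_mul]

lemma totalDegree_pderiv_le' {N : ℕ} {p : MvPolynomial (Fin 2) 𝕜} (hp : p.totalDegree ≤ N)
    (i : Fin 2) : (pderiv i p).totalDegree ≤ N :=
  totalDegree_pderiv_le (hp.trans (Nat.le_succ N)) i

lemma pderiv_comm' (i j : Fin 2) (p : MvPolynomial (Fin 2) 𝕜) :
    pderiv i (pderiv j p) = pderiv j (pderiv i p) := by
  ext m
  rw [coeff_pderiv_eq, coeff_pderiv_eq, coeff_pderiv_eq, coeff_pderiv_eq, add_right_comm m]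
  rcases eq_or_ne i j with rfl | hij
  · rfl
  · simp [hij, hij.symm]
    ring

lemma wnorm_pderiv_le_of_totalDegree {N : ℕ} {h : ℝ} (hh : 0 < h) {p : MvPolynomial (Fin 2) 𝕜}
    (hp : p.totalDegree ≤ N) (i : Fin 2) : wnorm h (pderiv i p) ≤ N / h * wnorm h p := by
  refine wnorm_le_sum_of_pderiv hh.le i p (fun m hm hm1 => ?_) (by positivity) hh.le
  obtain ⟨d, hd⟩ : ∃ d, m.degree = d + 1 := ⟨m.degree - 1, by omega⟩
  have hle : m.degree ≤ N := by
    by_contra hlt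
    exact mem_support_iff.mp hm (totalDegree_le_iff_coeff.mp hp m (by omega))
  rw [hd] at hle ⊢
  rw [Nat.add_sub_cancel, pow_succ, div_mul_eq_mul_div, le_div_iff₀ hh, mul_assoc]
  gcongr

end Degree

/-! ### Norm equivalence by separating functionals, and extrapolation -/

section Separation

/-- In finite dimension a separating family of functionals spans the dual space. So `g` is a finite
combination of members of `S`, and the sum of the moduli of its coefficients serves as constant. -/
lemma exists_bound_of_separating {V : Type*} [AddCommGroup V] [Module ℂ V] [FiniteDimensional ℂ V]
    (S : Set (V →ₗ[ℂ] ℂ)) (hS : ∀ v, (∀ f ∈ S, f v = 0) → v = 0) (g : V →ₗ[ℂ] ℂ) :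
    ∃ C : ℝ, 0 ≤ C ∧ ∀ v δ, (∀ f ∈ S, ‖f v‖ ≤ δ) → 0 ≤ δ → ‖g v‖ ≤ C * δ := by
  have htop : Submodule.span ℂ S = ⊤ := by
    refine Submodule.span_eq_top_of_ne_zero fun z hz => ?_
    by_contra! hcon
    exact hz (hS z hcon)
  have hg : g ∈ Submodule.span ℂ S := htop ▸ Submodule.mem_top
  induction hg using Submodule.span_induction with
  | mem f hf => exact ⟨1, zero_le_one, fun v δ h _ => by simpa using h f hf⟩
  | zero => exact ⟨0, le_rfl, fun v δ _ _ => by simp⟩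
  | add f g _ _ hf hg =>
    obtain ⟨C, hC, hCf⟩ := hf
    obtain ⟨D, hD, hDg⟩ := hg
    refine ⟨C + D, by positivity, fun v δ h hδ => ?_⟩
    rw [add_mul]
    exact (norm_add_le _ _).trans (add_le_add (hCf v δ h hδ) (hDg v δ h hδ))
  | smul a f _ hf =>
    obtain ⟨C, hC, hCf⟩ := hf
    refine ⟨‖a‖ * C, by positivity, fun v δ h hδ => ?_⟩
    rw [LinearMap.smul_apply, smul_eq_mul, norm_mul, mul_assoc]
    exact mul_le_mul_of_nonneg_left (hCf v δ h hδ) (norm_nonneg _)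

lemma exists_polynomial_eval_one_le (N : ℕ) {r : ℝ} (hr : 0 < r) :
    ∃ C : ℝ, 0 ≤ C ∧ ∀ (g : Polynomial ℂ) (δ : ℝ), g.natDegree ≤ N → 0 ≤ δ →
      (∀ t : ℝ, |t| < r → ‖g.eval (t : ℂ)‖ ≤ δ) → ‖g.eval 1‖ ≤ C * δ := by
  let V := Polynomial.degreeLT ℂ (N + 1)
  let ev : ℂ → V →ₗ[ℂ] ℂ := fun t => (Polynomial.leval t).comp V.subtype
  have hsep : ∀ v : V, (∀ f ∈ ev '' ((fun t : ℝ => (t : ℂ)) '' {t | |t| < r}), f v = 0) →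
      v = 0 := by
    intro v hv
    refine Subtype.ext (Polynomial.eq_zero_of_infinite_isRoot _ ?_)
    refine Set.Infinite.mono (s := (fun t : ℝ => (t : ℂ)) '' {t | |t| < r}) ?_ ?_
    · intro z hz
      exact hv (ev z) ⟨z, hz, rfl⟩
    · refine Set.Infinite.image Complex.ofReal_injective.injOn ?_
      refine Set.Infinite.mono (s := Set.Ioo 0 r) (fun t ht => ?_) (Set.Ioo_infinite hr)
      exact abs_lt.mpr ⟨by linarith [ht.1], ht.2⟩
  obtain ⟨C, hC, hb⟩ := exists_bound_of_separating _ hsep (ev 1)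
  refine ⟨C, hC, fun g δ hg hδ h => ?_⟩
  have hgV : g ∈ V := Polynomial.mem_degreeLT.mpr
    ((Polynomial.degree_le_natDegree).trans_lt (by exact_mod_cast Nat.lt_succ_of_le hg))
  refine hb ⟨g, hgV⟩ δ ?_ hδ
  rintro _ ⟨_, ⟨t, ht, rfl⟩, rfl⟩
  exact h t ht

lemma eval_aeval_polynomial (f : Fin 2 → Polynomial ℂ) (z : ℂ) (p : MvPolynomial (Fin 2) ℂ) :
    (aeval f p).eval z = eval (fun i => (f i).eval z) p := by
  induction p using MvPolynomial.induction_on with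
  | C b => simp
  | add p q hp hq => simp only [map_add, Polynomial.eval_add, hp, hq]
  | mul_X p i hp => simp only [map_mul, Polynomial.eval_mul, hp, aeval_X, eval_X]

/-- Values on the small ball extrapolate to the disc of radius `h` about `r₀`: the polynomial is
restricted to the line from `c` through `x`, and the one-variable estimate is uniform in all data
except the degree and `ρ`. -/
lemma exists_peval_le_of_ball (N : ℕ) {ρ : ℝ} (hρ : 0 < ρ) :
    ∃ C : ℝ, 0 ≤ C ∧ ∀ (P : MvPolynomial (Fin 2) ℂ) (h δ : ℝ) (r₀ c : Plane), 0 < h →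
      P.totalDegree ≤ N → dist c r₀ ≤ h → 0 ≤ δ →
      (∀ x ∈ Metric.ball c (ρ * h), ‖peval r₀ P x‖ ≤ δ) →
      ∀ x, dist x r₀ ≤ h → ‖peval r₀ P x‖ ≤ C * δ := by
  obtain ⟨C, hC, hb⟩ := exists_polynomial_eval_one_le N (r := ρ / 2) (by positivity)
  refine ⟨C, hC, fun P h δ r₀ c hh hP hc hδ hball x hx => ?_⟩
  let g : Polynomial ℂ := aeval (fun i => Polynomial.C (((x - c) i : ℝ) : ℂ) * Polynomial.X +
    Polynomial.C (((c - r₀) i : ℝ) : ℂ)) P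
  have hg : ∀ t : ℝ, g.eval (t : ℂ) = peval r₀ P (c + t • (x - c)) := fun t => by
    rw [peval]
    refine (eval_aeval_polynomial _ _ P).trans (congrArg (fun v => eval v P) (funext fun i => ?_))
    simp
    ring
  have hdeg : g.natDegree ≤ N := by
    have := aeval_natDegree_le (n := 1) P hP (fun i => Polynomial.C (((x - c) i : ℝ) : ℂ) *
      Polynomial.X + Polynomial.C (((c - r₀) i : ℝ) : ℂ)) fun i => Polynomial.natDegree_linear_le
    rwa [mul_one] at this
  have hfin := hb g δ hdeg hδ fun t ht => by
    rw [hg]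
    refine hball _ ?_
    rw [Metric.mem_ball, dist_eq_norm, add_sub_cancel_left, norm_smul, Real.norm_eq_abs,
      ← dist_eq_norm]
    -- This distance is the reason for the parameter range |t| < ρ/2.
    have hxc : dist x c ≤ 2 * h := by
      linarith [dist_triangle x r₀ c, dist_comm c r₀]
    calc |t| * dist x c ≤ |t| * (2 * h) := by gcongr
      _ < ρ / 2 * (2 * h) := by gcongr
      _ = ρ * h := by ring
  have h1 := hg 1
  simp only [Complex.ofReal_one, one_smul, add_sub_cancel] at h1
  rwa [h1] at hfin

end Separation

/-! ### Polynomials vanishing on the isotropic lines are controlled by their Laplacian -/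

section Harmonic

/-- The restriction of a polynomial to the complex line `t ↦ (t, a t)`. -/
def line (a : ℂ) : MvPolynomial (Fin 2) ℂ →ₐ[ℂ] Polynomial ℂ :=
  aeval ![Polynomial.X, Polynomial.C a * Polynomial.X]

lemma eval_line (a t : ℂ) (p : MvPolynomial (Fin 2) ℂ) :
    (line a p).eval t = eval ![t, a * t] p := by
  rw [line, eval_aeval_polynomial]
  congr 2
  funext i
  fin_cases i <;> simp

lemma derivative_line (a : ℂ) (p : MvPolynomial (Fin 2) ℂ) :
    Polynomial.derivative (line a p) = line a (pderiv 0 p + C a * pderiv 1 p) := by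
  induction p using MvPolynomial.induction_on with
  | C b => simp [line]
  | add p q hp hq => simp only [map_add, hp, hq, mul_add]; ring
  | mul_X p i hp =>
    have hX0 : line a (X 0) = Polynomial.X := by simp [line]
    have hX1 : line a (X 1) = Polynomial.C a * Polynomial.X := by simp [line]
    have hC : line a (C a) = Polynomial.C a := by simp [line]
    fin_cases i
    · simp only [map_mul, Polynomial.derivative_mul, hp, pderiv_mul, map_add, hC]
      simp [hX0]
      ring
    · simp only [map_mul, Polynomial.derivative_mul, hp, pderiv_mul, map_add, hC]
      simp [hX1]
      ring

lemma polyLap_eq {𝕜 : Type*} [CommSemiring 𝕜] (p : MvPolynomial (Fin 2) 𝕜) :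
    polyLap p = pderiv 0 (pderiv 0 p) + pderiv 1 (pderiv 1 p) := by
  rw [polyLap, Fin.sum_univ_two]

lemma coeff_zero_line (a : ℂ) (p : MvPolynomial (Fin 2) ℂ) :
    (line a p).coeff 0 = constantCoeff p := by
  rw [Polynomial.coeff_zero_eq_eval_zero, eval_line]
  rw [mul_zero, show (![0, 0] : Fin 2 → ℂ) = 0 from by ext i; fin_cases i <;> rfl]
  rw [eval_zero]

/-- The Laplacian factors as (∂₁ + i∂₂)(∂₁ - i∂₂). For s = ±i the derivative Q = (∂₁ + s∂₂)P is
again harmonic, has smaller degree and again vanishes on both lines. By induction both Q are zero,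
so `P` is constant. -/
lemma eq_zero_of_harmonic_of_line (P : MvPolynomial (Fin 2) ℂ) (hP : polyLap P = 0)
    (h₁ : line Complex.I P = 0) (h₂ : line (-Complex.I) P = 0) : P = 0 := by
  obtain ⟨N, hN⟩ : ∃ N, P.totalDegree ≤ N := ⟨_, le_rfl⟩
  induction N generalizing P with
  | zero =>
    have hconst : P = C (constantCoeff P) :=
      totalDegree_eq_zero_iff_eq_C.mp (Nat.le_zero.mp hN)
    have := coeff_zero_line Complex.I P
    rw [h₁, Polynomial.coeff_zero] at this
    rw [hconst, ← this, C_0]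
  | succ N ih =>
    have step : ∀ s : ℂ, s * s = -1 → line s P = 0 → line (-s) P = 0 →
        pderiv 0 P + C s * pderiv 1 P = 0 := by
      intro s hs hl hl'
      have hCs : (C s * C s : MvPolynomial (Fin 2) ℂ) = -1 := by rw [← C_mul, hs]; simp
      set Q := pderiv 0 P + C s * pderiv 1 P with hQ
      have hconj : pderiv 0 Q + C (-s) * pderiv 1 Q = 0 := by
        rw [← hP, polyLap_eq, hQ]
        simp only [map_add, pderiv_C_mul, pderiv_comm' 1 0 P, C_neg]
        linear_combination (-pderiv 1 (pderiv 1 P)) * hCs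
      have hQ1 : line s Q = 0 := by rw [hQ, ← derivative_line, hl, map_zero]
      -- On the opposite line Q has zero derivative, by the factorization, and is therefore equal to
      -- its value at the origin. That value is zero because the first line also passes through the
      -- origin.
      have hQ2 : line (-s) Q = 0 := by
        have hd := derivative_line (-s) Q
        rw [hconj, map_zero] at hd
        rw [Polynomial.eq_C_of_derivative_eq_zero hd, coeff_zero_line, ← coeff_zero_line s, hQ1]
        simp
      have hQlap : polyLap Q = 0 := by
        have : polyLap Q = pderiv 0 (polyLap P) + C s * pderiv 1 (polyLap P) := by
          rw [hQ, polyLap_eq, polyLap_eq]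
          simp only [map_add, pderiv_C_mul, pderiv_comm' 1 0]
          ring
        rw [this, hP]
        simp
      have hQdeg : Q.totalDegree ≤ N := by
        refine (totalDegree_add _ _).trans (max_le (totalDegree_pderiv_le hN 0) ?_)
        refine (totalDegree_mul _ _).trans ?_
        rw [totalDegree_C, zero_add]
        exact totalDegree_pderiv_le hN 1
      have hsI : s = Complex.I ∨ s = -Complex.I := by
        have : (s - Complex.I) * (s + Complex.I) = 0 := by
          linear_combination hs - Complex.I_mul_I
        rcases mul_eq_zero.mp this with h | h
        · exact Or.inl (sub_eq_zero.mp h)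
        · exact Or.inr (eq_neg_of_add_eq_zero_left h)
      rcases hsI with rfl | rfl
      · exact ih Q hQlap hQ1 hQ2 hQdeg
      · rw [neg_neg] at hQ2
        exact ih Q hQlap hQ2 hQ1 hQdeg
    have e1 := step Complex.I Complex.I_mul_I h₁ h₂
    have e2 := step (-Complex.I) (by simp) h₂ (by rwa [neg_neg])
    have hCI : (C Complex.I * C Complex.I : MvPolynomial (Fin 2) ℂ) = -1 := by
      rw [← C_mul, Complex.I_mul_I]; simp
    rw [C_neg] at e2
    have hC2 : (C (1 / 2 : ℂ) * 2 : MvPolynomial (Fin 2) ℂ) = 1 := by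
      rw [show (2 : MvPolynomial (Fin 2) ℂ) = C 2 from (map_ofNat C 2).symm, ← C_mul]; norm_num
    have d0 : pderiv 0 P = 0 := by
      linear_combination C (1 / 2 : ℂ) * (e1 + e2) - pderiv 0 P * hC2
    have d1 : pderiv 1 P = 0 := by
      linear_combination (-C (1 / 2 : ℂ) * C Complex.I) * (e1 - e2) - pderiv 1 P * hC2 +
        C (1/2 : ℂ) * 2 * pderiv 1 P * hCI
    refine ih P hP h₁ h₂ (totalDegree_le_iff_coeff.mpr fun m hm => ?_)
    have hd : m.degree = m 0 + m 1 := by simp [Finsupp.degree_eq_sum]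
    have hz : ∀ i, pderiv i P = 0 := fun i => by fin_cases i; exacts [d0, d1]
    obtain ⟨i, hi⟩ : ∃ i, m i ≠ 0 := by
      by_contra! hcon
      have := hcon 0
      have := hcon 1
      omega
    have hm' : m = (m - Finsupp.single i 1) + Finsupp.single i 1 :=
      (tsub_add_cancel_of_le (by simpa [Nat.one_le_iff_ne_zero] using hi)).symm
    have := coeff_pderiv_eq i P (m - Finsupp.single i 1)
    rw [hz i, coeff_zero, ← hm'] at this
    refine (mul_eq_zero.mp this.symm).resolve_right ?_
    exact Nat.cast_add_one_ne_zero _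

/-- The polynomial `p (h X)`. -/
def scale (h : ℝ) (p : MvPolynomial (Fin 2) ℂ) : MvPolynomial (Fin 2) ℂ :=
  aeval (fun i => C (h : ℂ) * X i) p

lemma coeff_scale (h : ℝ) (p : MvPolynomial (Fin 2) ℂ) (m : Fin 2 →₀ ℕ) :
    coeff m (scale h p) = (h : ℂ) ^ m.degree * coeff m p := by
  classical
  induction p using MvPolynomial.induction_on' with
  | add p q hp hq => simp only [scale, map_add, coeff_add] at *; rw [hp, hq]; ring
  | monomial n a =>
    have : scale h (monomial n a) = monomial n (h ^ n.degree * a) := by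
      rw [scale, aeval_monomial, Finsupp.prod_fintype _ _ (by simp)]
      simp only [mul_pow, Finset.prod_mul_distrib, Fin.prod_univ_two]
      rw [monomial_eq, Finsupp.prod_fintype _ _ (by simp), Fin.prod_univ_two,
        Finsupp.degree_eq_sum, Fin.sum_univ_two, pow_add]
      simp only [algebraMap_eq, map_mul, map_pow]
      ring
    rw [this, coeff_monomial, coeff_monomial]
    split_ifs with h1
    · rw [h1]
    · simp

lemma pderiv_scale (h : ℝ) (p : MvPolynomial (Fin 2) ℂ) (i : Fin 2) :
    pderiv i (scale h p) = C (h : ℂ) * scale h (pderiv i p) := by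
  ext m
  rw [coeff_pderiv_eq, coeff_scale, coeff_C_mul, coeff_scale, coeff_pderiv_eq, map_add,
    Finsupp.degree_single, pow_succ]
  ring

lemma polyLap_scale (h : ℝ) (p : MvPolynomial (Fin 2) ℂ) :
    polyLap (scale h p) = C ((h : ℂ) ^ 2) * scale h (polyLap p) := by
  have hadd : ∀ a b, scale h (a + b) = scale h a + scale h b := fun a b => by simp [scale]
  simp only [polyLap_eq, pderiv_scale, pderiv_C_mul, hadd, C_pow]
  ring

lemma eval_scale (h : ℝ) (p : MvPolynomial (Fin 2) ℂ) (v : Fin 2 → ℂ) :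
    eval v (scale h p) = eval (fun i => h * v i) p := by
  induction p using MvPolynomial.induction_on with
  | C b => simp [scale]
  | add p q hp hq => simp only [scale, map_add] at *; rw [hp, hq]
  | mul_X p i hp => simp only [scale, map_mul, aeval_X] at *; rw [hp]; simp

lemma wnorm_one_scale {h : ℝ} (hh : 0 ≤ h) (p : MvPolynomial (Fin 2) ℂ) :
    wnorm 1 (scale h p) = wnorm h p := by
  have hs : (scale h p).support ⊆ p.support := fun m hm => by
    rw [mem_support_iff, coeff_scale] at hm
    exact mem_support_iff.mpr (right_ne_zero_of_mul hm)
  rw [wnorm_eq_sum hs, wnorm]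
  refine Finset.sum_congr rfl fun m _ => ?_
  rw [coeff_scale, norm_mul, norm_pow, Complex.norm_real, Real.norm_of_nonneg hh]
  ring

/-- On polynomials of degree at most `N`, the values of the Laplacian on the unit disc together with
the coefficients of both line restrictions separate points, so they control every coefficient. -/
lemma exists_wnorm_one_le_of_polyLap (N : ℕ) :
    ∃ C : ℝ, 0 ≤ C ∧ ∀ (P : MvPolynomial (Fin 2) ℂ) (δ : ℝ), P.totalDegree ≤ N → 0 ≤ δ →
      line Complex.I P = 0 → line (-Complex.I) P = 0 →
      (∀ y : Plane, ‖y‖ ≤ 1 → ‖eval (fun i => ((y i : ℝ) : ℂ)) (polyLap P)‖ ≤ δ) →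
      wnorm 1 P ≤ C * δ := by
  classical
  let V := restrictTotalDegree (Fin 2) ℂ N
  let lap : MvPolynomial (Fin 2) ℂ →ₗ[ℂ] MvPolynomial (Fin 2) ℂ :=
    ∑ i, (pderiv i).toLinearMap.comp (pderiv i).toLinearMap
  have hlap : ∀ p, lap p = polyLap p := fun p => by simp [lap, polyLap]
  let ev : Plane → V →ₗ[ℂ] ℂ := fun y =>
    ((aeval (fun i => ((y i : ℝ) : ℂ))).toLinearMap.comp lap).comp V.subtype
  let co : ℂ → ℕ → V →ₗ[ℂ] ℂ := fun a j =>
    ((Polynomial.lcoeff ℂ j).comp (line a).toLinearMap).comp V.subtype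
  let S : Set (V →ₗ[ℂ] ℂ) := ev '' {y | ‖y‖ ≤ 1} ∪
    (Set.range (co Complex.I) ∪ Set.range (co (-Complex.I)))
  have hev : ∀ y (p : V), ev y p = eval (fun i => ((y i : ℝ) : ℂ)) (polyLap p.1) := fun y p => by
    simp [ev, hlap, aeval_eq_eval]
  have hsep : ∀ v, (∀ f ∈ S, f v = 0) → v = 0 := by
    intro v hv
    refine Subtype.ext (eq_zero_of_harmonic_of_line _ ?_ ?_ ?_)
    -- The square of half-width 1/2 lies in the unit disc, and a polynomial that vanishes on a
    -- product of infinite sets is zero.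
    · have hinf : ((fun t : ℝ => (t : ℂ)) '' Set.Icc (-(1 / 2)) (1 / 2)).Infinite :=
        Set.Infinite.image Complex.ofReal_injective.injOn (Set.Icc_infinite (by norm_num))
      refine MvPolynomial.funext_set (fun _ => (fun t : ℝ => (t : ℂ)) '' Set.Icc (-(1 / 2)) (1 / 2))
        (fun _ => hinf) fun x hx => ?_
      have hx' : ∀ i, ∃ t : ℝ, t ∈ Set.Icc (-(1 / 2) : ℝ) (1 / 2) ∧ (t : ℂ) = x i :=
        fun i => hx i (Set.mem_univ i)
      choose t ht htx using hx'
      have h1 : x = fun i => (((WithLp.toLp 2 t : Plane) i : ℝ) : ℂ) := by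
        funext i; simp [htx]
      have h2 : ‖(WithLp.toLp 2 t : Plane)‖ ≤ 1 := by
        rw [EuclideanSpace.norm_eq, Real.sqrt_le_one, Fin.sum_univ_two]
        have h3 : ∀ i, ‖t i‖ ^ 2 ≤ 1 / 4 := fun i => by
          rw [Real.norm_eq_abs, sq_abs]
          nlinarith [(ht i).1, (ht i).2]
        linarith [h3 0, h3 1]
      have h3 := hv (ev (WithLp.toLp 2 t)) (Or.inl ⟨_, h2, rfl⟩)
      rw [hev, ← h1] at h3
      rw [h3, map_zero]
    · ext j
      exact hv (co Complex.I j) (Or.inr (Or.inl ⟨j, rfl⟩))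
    · ext j
      exact hv (co (-Complex.I) j) (Or.inr (Or.inr ⟨j, rfl⟩))
  have hcoeff : ∀ m : Fin 2 →₀ ℕ, ∃ C : ℝ, 0 ≤ C ∧ ∀ (v : V) δ, (∀ f ∈ S, ‖f v‖ ≤ δ) → 0 ≤ δ →
      ‖coeff m v.1‖ ≤ C * δ := fun m =>
    exists_bound_of_separating S hsep ((lcoeff ℂ m).comp V.subtype)
  choose C hC hCb using hcoeff
  have hfin : {m : Fin 2 →₀ ℕ | m.degree ≤ N}.Finite := Finsupp.finite_of_degree_le N
  refine ⟨∑ m ∈ hfin.toFinset, C m, Finset.sum_nonneg fun m _ => hC m,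
    fun P δ hP hδ h₁ h₂ hy => ?_⟩
  have hsub : P.support ⊆ hfin.toFinset := fun m hm => by
    rw [Set.Finite.mem_toFinset, Set.mem_ofPred_eq]
    by_contra hlt
    exact mem_support_iff.mp hm (totalDegree_le_iff_coeff.mp hP m (by omega))
  rw [wnorm_eq_sum hsub, Finset.sum_mul]
  refine Finset.sum_le_sum fun m _ => ?_
  rw [one_pow, mul_one]
  refine hCb m ⟨P, (mem_restrictTotalDegree _ _ _).mpr hP⟩ δ ?_ hδ
  rintro f (⟨y, hy1, rfl⟩ | ⟨j, rfl⟩ | ⟨j, rfl⟩)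
  · rw [hev]; exact hy y hy1
  · simpa [co, h₁] using hδ
  · simpa [co, h₂] using hδ

/-- The case h = 1 is applied to P(hX): the isotropic lines are invariant under dilation, and the
Laplacian produces the factor h². The constant depends on `N` and `ρ` alone. -/
lemma exists_wnorm_le_of_polyLap (N : ℕ) {ρ : ℝ} (hρ : 0 < ρ) :
    ∃ C : ℝ, 0 ≤ C ∧ ∀ (P : MvPolynomial (Fin 2) ℂ) (h δ : ℝ) (r₀ c : Plane), 0 < h →
      P.totalDegree ≤ N → line Complex.I P = 0 → line (-Complex.I) P = 0 → dist c r₀ ≤ h →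
      0 ≤ δ → (∀ x ∈ Metric.ball c (ρ * h), ‖peval r₀ (polyLap P) x‖ ≤ δ) →
      wnorm h P ≤ C * (h ^ 2 * δ) := by
  obtain ⟨C₁, hC₁, hb₁⟩ := exists_peval_le_of_ball N hρ
  obtain ⟨C₂, hC₂, hb₂⟩ := exists_wnorm_one_le_of_polyLap N
  refine ⟨C₂ * C₁, by positivity, fun P h δ r₀ c hh hP h₁ h₂ hc hδ hball => ?_⟩
  have hline : ∀ a, line a P = 0 → line a (scale h P) = 0 := fun a ha => by
    refine Polynomial.funext fun t => ?_
    have h3 := eval_line a (h * t) P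
    rw [ha, Polynomial.eval_zero] at h3
    rw [eval_line, eval_scale, Polynomial.eval_zero, h3]
    congr 2
    funext i
    fin_cases i
    · simp
    · simp; ring
  have hlapdeg : (polyLap P).totalDegree ≤ N := by
    rw [polyLap_eq]
    exact (totalDegree_add _ _).trans (max_le
      (totalDegree_pderiv_le' (totalDegree_pderiv_le' hP _) _)
      (totalDegree_pderiv_le' (totalDegree_pderiv_le' hP _) _))
  have hsdeg : (scale h P).totalDegree ≤ N := totalDegree_le_iff_coeff.mpr fun m hm => by
    rw [coeff_scale, totalDegree_le_iff_coeff.mp hP m hm, mul_zero]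
  rw [← wnorm_one_scale hh.le]
  have := hb₂ (scale h P) (h ^ 2 * (C₁ * δ)) hsdeg (by positivity) (hline _ h₁) (hline _ h₂)
    fun y hy => ?_
  · linarith
  · have h4 := hb₁ (polyLap P) h δ r₀ c hh hlapdeg hc hδ hball (r₀ + h • y) (by
      rw [dist_eq_norm, add_sub_cancel_left, norm_smul, Real.norm_of_nonneg hh.le]
      exact mul_le_of_le_one_right hh.le hy)
    rw [polyLap_scale, map_mul, eval_C, norm_mul, eval_scale, norm_pow, Complex.norm_real,
      Real.norm_of_nonneg hh.le]
    refine mul_le_mul_of_nonneg_left ?_ (by positivity)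
    simpa [peval] using h4

end Harmonic

/-! ### Derivatives of amplitude times exponential -/

section Waves

variable {K : Set Plane} {h : ℝ} {r₀ c : Plane}

/-- The function `b e^{iωτ}`, for polynomials `b` and `τ` in the local coordinates. -/
def wave (r₀ : Plane) (ω : ℝ) (τ : MvPolynomial (Fin 2) ℝ) (b : MvPolynomial (Fin 2) ℂ)
    (x : Plane) : ℂ :=
  peval r₀ b x * Complex.exp (Complex.I * ω * peval r₀ (toComplex τ) x)

/-- The polynomial `b'` with `∂ᵢ (b e^{iωτ}) = b' e^{iωτ}`. -/
def waveD (ω : ℝ) (τ : MvPolynomial (Fin 2) ℝ) (i : Fin 2) (b : MvPolynomial (Fin 2) ℂ) :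
    MvPolynomial (Fin 2) ℂ :=
  pderiv i b + C (Complex.I * ω) * (b * pderiv i (toComplex τ))

/-- The amplitude `∑ a_s / (iω)^s`. -/
def amp (q : ℕ) (ω : ℝ) (a : ℕ → MvPolynomial (Fin 2) ℂ) : MvPolynomial (Fin 2) ℂ :=
  ∑ s ∈ Finset.range (q - 1), C ((Complex.I * ω)⁻¹ ^ s) * a s

lemma peval_toComplex (r₀ : Plane) (τ : MvPolynomial (Fin 2) ℝ) (x : Plane) :
    peval r₀ (toComplex τ) x = ((peval r₀ τ x : ℝ) : ℂ) := by
  have : (fun i => algebraMap ℝ ℂ ((x - r₀) i)) =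
      (algebraMap ℝ ℂ) ∘ fun i => algebraMap ℝ ℝ ((x - r₀) i) := rfl
  rw [peval, toComplex, eval_map, this, ← eval₂_comp]
  rfl

lemma basisFun_eq_wave (K : Set Plane) (q : ℕ) (ω : ℝ) (τ : MvPolynomial (Fin 2) ℝ)
    (a : ℕ → MvPolynomial (Fin 2) ℂ) :
    basisFun K q ω τ a = wave (barycenter K) ω τ (amp q ω a) := by
  funext x
  rw [basisFun, wave, peval_toComplex]
  congr 1
  simp [peval, amp]

lemma contDiff_wave (r₀ : Plane) (ω : ℝ) (τ : MvPolynomial (Fin 2) ℝ)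
    (b : MvPolynomial (Fin 2) ℂ) {k : WithTop ℕ∞} : ContDiff ℝ k (wave r₀ ω τ b) :=
  (contDiff_peval r₀ b).mul (contDiff_const.mul (contDiff_peval r₀ _)).cexp

lemma pd_wave (hu : UniqueDiffOn ℝ K) (ω : ℝ) (τ : MvPolynomial (Fin 2) ℝ)
    (b : MvPolynomial (Fin 2) ℂ) (i : Fin 2) :
    Set.EqOn (pd K i (wave r₀ ω τ b)) (wave r₀ ω τ (waveD ω τ i b)) K := fun x hx => by
  have h1 : HasFDerivAt (wave r₀ ω τ b) _ x := (hasFDerivAt_peval r₀ b x).mul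
    (((hasFDerivAt_peval r₀ (toComplex τ) x).const_mul (Complex.I * ω)).cexp)
  rw [pd, HasFDerivWithinAt.fderivWithin (h1.hasFDerivWithinAt (s := K)) (hu x hx)]
  have hadd : peval r₀ (waveD ω τ i b) x = peval r₀ (pderiv i b) x +
      Complex.I * ω * (peval r₀ b x * peval r₀ (pderiv i (toComplex τ)) x) := by
    simp [peval, waveD]
  rw [wave, hadd]
  fin_cases i <;> simp [Fin.sum_univ_two] <;> ring

lemma norm_sub_apply_le {𝕜 : Type*} [RCLike 𝕜] {x : Plane} (hx : dist x r₀ ≤ h) (i : Fin 2) :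
    ‖algebraMap ℝ 𝕜 ((x - r₀) i)‖ ≤ h := by
  rw [norm_algebraMap']
  exact (PiLp.norm_apply_le (x - r₀) i).trans (by rwa [← dist_eq_norm])

lemma norm_wave_eq (ω : ℝ) (τ : MvPolynomial (Fin 2) ℝ) (b : MvPolynomial (Fin 2) ℂ) (x : Plane) :
    ‖wave r₀ ω τ b x‖ = ‖peval r₀ b x‖ := by
  have hexp : ‖Complex.exp (Complex.I * ω * peval r₀ (toComplex τ) x)‖ = 1 := by
    rw [peval_toComplex, mul_assoc, ← Complex.ofReal_mul, mul_comm]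
    exact Complex.norm_exp_ofReal_mul_I _
  rw [wave, norm_mul, hexp, mul_one]

lemma norm_wave_le {x : Plane} (hx : dist x r₀ ≤ h) (ω : ℝ) (τ : MvPolynomial (Fin 2) ℝ)
    (b : MvPolynomial (Fin 2) ℂ) : ‖wave r₀ ω τ b x‖ ≤ wnorm h b := by
  rw [norm_wave_eq]
  exact norm_eval_le (norm_sub_apply_le hx) b

lemma wnorm_waveD_le {R G ω : ℝ} {τ : MvPolynomial (Fin 2) ℝ} (hR : 0 < R) (hω : 1 ≤ ω)
    {i : Fin 2} (hτ : wnorm (R / 2) (pderiv i (toComplex τ)) ≤ G) (b : MvPolynomial (Fin 2) ℂ) :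
    wnorm (R / 2) (waveD ω τ i b) ≤ (R⁻¹ + G) * ω * wnorm R b := by
  have hR2 : (0 : ℝ) ≤ R / 2 := by positivity
  have hb := wnorm_nonneg hR.le b
  have hG : 0 ≤ G := (wnorm_nonneg hR2 _).trans hτ
  refine (wnorm_add_le hR2 _ _).trans ?_
  have h1 := wnorm_pderiv_le hR i b
  have h2 : wnorm (R / 2) (C (Complex.I * ω) * (b * pderiv i (toComplex τ))) ≤
      ω * (wnorm R b * G) := by
    rw [wnorm_C_mul, norm_mul, Complex.norm_I, one_mul, Complex.norm_real,
      Real.norm_of_nonneg (by linarith)]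
    refine mul_le_mul_of_nonneg_left ?_ (by linarith)
    refine (wnorm_mul_le hR2 _ _).trans (mul_le_mul ?_ hτ (wnorm_nonneg hR2 _) hb)
    exact wnorm_mono hR2 (by linarith) b
  have h3 : R⁻¹ * wnorm R b ≤ R⁻¹ * ω * wnorm R b := by
    gcongr
    exact le_mul_of_one_le_right (by positivity) hω
  linarith

/-- Each derivative replaces the amplitude by another polynomial, at the cost of a factor of order ω
and half the radius. After `k` of them the radius R/2^k must still cover `K`. -/
lemma partialsLE_wave (hu : UniqueDiffOn ℝ K) (hd : ∀ x ∈ K, dist x r₀ ≤ h) {G ω : ℝ}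
    {τ : MvPolynomial (Fin 2) ℝ} (hω : 1 ≤ ω) (k : ℕ) {R : ℝ} (hR : 0 < R) (hhR : h ≤ R / 2 ^ k)
    (hτ : ∀ i, wnorm (R / 2) (pderiv i (toComplex τ)) ≤ G) (b : MvPolynomial (Fin 2) ℂ) :
    PartialsLE K k ((2 ^ k / R + G) ^ k * ω ^ k * wnorm R b) (wave r₀ ω τ b) := by
  induction k generalizing R b with
  | zero =>
    intro x hx
    refine (norm_wave_le (hd x hx) ω τ b).trans ?_
    have hh : 0 ≤ h := dist_nonneg.trans (hd x hx)
    simpa using wnorm_mono hh (by simpa using hhR) b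
  | succ k ih =>
    intro i
    have hG : 0 ≤ G := (wnorm_nonneg (by positivity) _).trans (hτ 0)
    refine PartialsLE.congr ?_ (pd_wave hu ω τ b i).symm
    refine (ih (R := R / 2) (by positivity) ?_ (fun i => ?_) _).mono ?_
    · rw [div_div, ← pow_succ']; exact hhR
    · exact (wnorm_mono (by positivity) (by linarith) _).trans (hτ i)
    · have h1 := wnorm_waveD_le hR hω (hτ i) b
      have h2 : (2 : ℝ) ^ k / (R / 2) = 2 ^ (k + 1) / R := by
        rw [pow_succ]; field_simp
      have h3 : R⁻¹ ≤ 2 ^ (k + 1) / R := by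
        rw [inv_eq_one_div]
        gcongr
        exact one_le_pow₀ (by norm_num)
      have hb := wnorm_nonneg hR.le b
      rw [h2]
      calc (2 ^ (k + 1) / R + G) ^ k * ω ^ k * wnorm (R / 2) (waveD ω τ i b)
          ≤ (2 ^ (k + 1) / R + G) ^ k * ω ^ k * ((2 ^ (k + 1) / R + G) * ω * wnorm R b) := by
            gcongr
            exact h1.trans (by gcongr)
        _ = _ := by ring

/-- The derivative in the complex direction `(1, a)`. -/
def cder (a : ℂ) : MvPolynomial (Fin 2) ℂ →ₗ[ℂ] MvPolynomial (Fin 2) ℂ :=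
  (pderiv 0).toLinearMap + a • (pderiv 1).toLinearMap

/-- The polynomial counterpart of the derivative of `b e^{iωτ}` in the complex direction `(1, a)`. -/
def waveA (ω : ℝ) (τ : MvPolynomial (Fin 2) ℝ) (a : ℂ) :
    MvPolynomial (Fin 2) ℂ →ₗ[ℂ] MvPolynomial (Fin 2) ℂ :=
  cder a + LinearMap.mulLeft ℂ (C (Complex.I * ω) * cder a (toComplex τ))

lemma waveA_apply (ω : ℝ) (τ : MvPolynomial (Fin 2) ℝ) (a : ℂ) (b : MvPolynomial (Fin 2) ℂ) :
    waveA ω τ a b = waveD ω τ 0 b + a • waveD ω τ 1 b := by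
  simp [waveA, waveD, cder, smul_eq_C_mul]
  ring

/-- Evaluation of the j-th Taylor term at (1, a) gives the j-th derivative in that complex
direction, divided by j!. The exponential is 1 at `r₀` because `τ` has no constant term. -/
lemma eval_tayH_wave (hu : UniqueDiffOn ℝ K) (hr : r₀ ∈ K) (ω : ℝ) {τ : MvPolynomial (Fin 2) ℝ}
    (hτ : constantCoeff τ = 0) (a : ℂ) (j : ℕ) (b : MvPolynomial (Fin 2) ℂ) :
    eval ![1, a] (tayH K r₀ j (wave r₀ ω τ b)) =
      ((j ! : ℕ) : ℂ)⁻¹ * constantCoeff ((waveA ω τ a ^ j) b) := by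
  induction j generalizing b with
  | zero =>
    have h0 : ∀ p : MvPolynomial (Fin 2) ℂ, peval r₀ p r₀ = constantCoeff p := fun p => by
      rw [← eval_zero, peval]
      congr 2
      funext i
      simp
    have h1 : constantCoeff (toComplex τ) = 0 := by
      rw [toComplex, constantCoeff_map, hτ, map_zero]
    simp [tayH, wave, h0, h1]
  | succ j ih =>
    rw [tayH]
    simp only [tayH_congr hr j (pd_wave hu ω τ b _), map_mul, map_add, Fin.sum_univ_two, eval_X,
      eval_C, ih]
    rw [pow_succ, Module.End.mul_apply, waveA_apply, map_add, map_smul, map_add, smul_eq_C_mul,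
      map_mul, constantCoeff_C, Nat.factorial_succ]
    push_cast
    rw [mul_inv]
    simp
    ring

lemma wnorm_cder_le {R : ℝ} (hR : 0 < R) {a : ℂ} (ha : ‖a‖ = 1) (p : MvPolynomial (Fin 2) ℂ) :
    wnorm (R / 2) (cder a p) ≤ 2 * R⁻¹ * wnorm R p := by
  have : cder a p = pderiv 0 p + C a * pderiv 1 p := by simp [cder, smul_eq_C_mul]
  rw [this]
  refine (wnorm_add_le (by positivity) _ _).trans ?_
  rw [wnorm_C_mul, ha, one_mul]
  linarith [wnorm_pderiv_le hR 0 p, wnorm_pderiv_le hR 1 p]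

lemma norm_constantCoeff_le {R : ℝ} (hR : 0 ≤ R) (p : MvPolynomial (Fin 2) ℂ) :
    ‖constantCoeff p‖ ≤ wnorm R p := by
  rw [← eval_zero]
  exact norm_eval_le (fun i => by simpa using hR) p

/-- If all derivatives fall on the exponential, the result is (iωσ)^j b; every derivative falling on
a polynomial loses a power of ω. The remainder O(ω^{j-1}) is written with a factor ω on the left so
that j = 0 needs no negative exponent. -/
lemma exists_waveA_pow_bound (R G b₀ : ℝ) (hR : 0 < R) (hG : 0 ≤ G) (hb₀ : 0 ≤ b₀) (j : ℕ) :
    ∃ D : ℝ, 0 ≤ D ∧ ∀ (ω : ℝ) (τ : MvPolynomial (Fin 2) ℝ) (a : ℂ) (b : MvPolynomial (Fin 2) ℂ),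
      1 ≤ ω → ‖a‖ = 1 → wnorm R (cder a (toComplex τ)) ≤ G → wnorm R b ≤ b₀ →
      ω * wnorm (R / 2 ^ j) ((waveA ω τ a ^ j) b -
        (C (Complex.I * ω) * cder a (toComplex τ)) ^ j * b) ≤ D * ω ^ j := by
  induction j with
  | zero => exact ⟨0, le_rfl, fun ω τ a b _ _ _ _ => by simp⟩
  | succ j ih =>
    obtain ⟨D, hD, hb⟩ := ih
    refine ⟨G * D + 2 * (2 ^ j / R) * (G ^ j * b₀ + D), by positivity,
      fun ω τ a b hω ha hσ hbb => ?_⟩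
    have hω0 : 0 < ω := by linarith
    set σ := cder a (toComplex τ) with hσdef
    set r := (waveA ω τ a ^ j) b - (C (Complex.I * ω) * σ) ^ j * b with hr
    have hstep : (waveA ω τ a ^ (j + 1)) b - (C (Complex.I * ω) * σ) ^ (j + 1) * b =
        C (Complex.I * ω) * (σ * r) + cder a ((C (Complex.I * ω) * σ) ^ j * b + r) := by
      have h1 : (waveA ω τ a ^ j) b = (C (Complex.I * ω) * σ) ^ j * b + r := by rw [hr]; ring
      rw [pow_succ' (waveA ω τ a), Module.End.mul_apply, h1, waveA, LinearMap.add_apply,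
        LinearMap.mulLeft_apply, ← hσdef]
      ring
    have hRj : 0 < R / 2 ^ j := by positivity
    have hRj' : R / 2 ^ (j + 1) = R / 2 ^ j / 2 := by rw [pow_succ]; field_simp
    have hRR : R / 2 ^ j ≤ R := div_le_self hR.le (one_le_pow₀ (by norm_num))
    have hnC : ‖Complex.I * (ω : ℂ)‖ = ω := by
      rw [norm_mul, Complex.norm_I, one_mul, Complex.norm_real, Real.norm_of_nonneg hω0.le]
    have hrn := wnorm_nonneg hRj.le r
    have ihr := hb ω τ a b hω ha hσ hbb
    rw [← hσdef, ← hr] at ihr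
    have hr1 : wnorm (R / 2 ^ j) r ≤ D * ω ^ j := by
      refine le_trans ?_ ihr
      exact le_mul_of_one_le_left hrn hω
    have hσ' : wnorm (R / 2 ^ j) σ ≤ G := (wnorm_mono hRj.le hRR σ).trans hσ
    have e1 : wnorm (R / 2 ^ (j + 1)) (C (Complex.I * ω) * (σ * r)) ≤
        ω * (G * wnorm (R / 2 ^ j) r) := by
      rw [wnorm_C_mul, hnC]
      refine mul_le_mul_of_nonneg_left ?_ hω0.le
      refine (wnorm_mul_le (by positivity) _ _).trans ?_
      rw [hRj']
      gcongr
      · exact wnorm_nonneg (by positivity) _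
      · exact (wnorm_mono (by positivity) (by linarith) σ).trans hσ'
      · exact wnorm_mono (by positivity) (by linarith) r
    have e2 : wnorm (R / 2 ^ j) ((C (Complex.I * ω) * σ) ^ j * b + r) ≤
        (G ^ j * b₀ + D) * ω ^ j := by
      refine (wnorm_add_le hRj.le _ _).trans ?_
      have h1 : wnorm (R / 2 ^ j) ((C (Complex.I * ω) * σ) ^ j * b) ≤ (ω * G) ^ j * b₀ := by
        refine (wnorm_mul_le hRj.le _ _).trans ?_
        refine mul_le_mul ((wnorm_pow_le hRj.le _ j).trans ?_) ((wnorm_mono hRj.le hRR b).trans hbb)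
          (wnorm_nonneg hRj.le _) (by positivity)
        refine pow_le_pow_left₀ (wnorm_nonneg hRj.le _) ?_ j
        rw [wnorm_C_mul, hnC]
        gcongr
      rw [mul_pow ω G] at h1
      linarith
    have e3 := wnorm_cder_le hRj ha ((C (Complex.I * ω) * σ) ^ j * b + r)
    rw [hstep]
    have h4 := wnorm_add_le (R := R / 2 ^ (j + 1)) (by positivity) (C (Complex.I * ω) * (σ * r))
      (cder a ((C (Complex.I * ω) * σ) ^ j * b + r))
    rw [hRj'] at h4 e1 ⊢
    have hinv : (R / 2 ^ j)⁻¹ = 2 ^ j / R := inv_div _ _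
    rw [hinv] at e3
    have e4 : 2 * (2 ^ j / R) * wnorm (R / 2 ^ j) ((C (Complex.I * ω) * σ) ^ j * b + r) ≤
        2 * (2 ^ j / R) * ((G ^ j * b₀ + D) * ω ^ j) := by gcongr
    calc ω * wnorm (R / 2 ^ j / 2) (C (Complex.I * ω) * (σ * r) +
          cder a ((C (Complex.I * ω) * σ) ^ j * b + r))
        ≤ ω * (ω * (G * wnorm (R / 2 ^ j) r) + 2 * (2 ^ j / R) * ((G ^ j * b₀ + D) * ω ^ j)) := by
          gcongr
          linarith
      _ = ω * G * (ω * wnorm (R / 2 ^ j) r) + ω * (2 * (2 ^ j / R) * ((G ^ j * b₀ + D) * ω ^ j)) := by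
          ring
      _ ≤ ω * G * (D * ω ^ j) + ω * (2 * (2 ^ j / R) * ((G ^ j * b₀ + D) * ω ^ j)) := by gcongr
      _ = _ := by ring

end Waves

/-! ### The Helmholtz residual of a basis function -/

section Residual

variable {K : Set Plane} {h : ℝ} {r₀ c : Plane}

/-- The left-hand side `2 ∇b · ∇τ + b Δτ` of the transport equation. -/
def transport {𝕜 : Type*} [CommSemiring 𝕜] (τ b : MvPolynomial (Fin 2) 𝕜) :
    MvPolynomial (Fin 2) 𝕜 :=
  2 * gradDot b τ + b * polyLap τ

lemma sum_waveD_waveD (ω : ℝ) (τ : MvPolynomial (Fin 2) ℝ) (b : MvPolynomial (Fin 2) ℂ) :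
    waveD ω τ 0 (waveD ω τ 0 b) + waveD ω τ 1 (waveD ω τ 1 b) =
      polyLap b + C (Complex.I * ω) * transport (toComplex τ) b -
        C ((ω : ℂ) ^ 2) * (b * gradDot (toComplex τ) (toComplex τ)) := by
  have hI : (C (Complex.I * ω) * C (Complex.I * ω) : MvPolynomial (Fin 2) ℂ) =
      -C ((ω : ℂ) ^ 2) := by
    rw [← C_mul, ← C_neg]
    congr 1
    linear_combination (ω : ℂ) ^ 2 * Complex.I_mul_I
  simp only [waveD, transport, gradDot, polyLap, Fin.sum_univ_two, map_add, pderiv_mul,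
    pderiv_C]
  linear_combination (b * pderiv 0 (toComplex τ) * pderiv 0 (toComplex τ) +
    b * pderiv 1 (toComplex τ) * pderiv 1 (toComplex τ)) * hI

/-- The terms of the transport hierarchy. -/
def hierarchy (τ : MvPolynomial (Fin 2) ℂ) (a : ℕ → MvPolynomial (Fin 2) ℂ) :
    ℕ → MvPolynomial (Fin 2) ℂ
  | 0 => transport τ (a 0)
  | s + 1 => transport τ (a (s + 1)) + polyLap (a s)

/-- The Laplacian of `a s` has the same power of iω as the transport term of `a (s + 1)`. After this
shift of index the Laplacian of the last component would be left over; it is zero by assumption. -/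
lemma polyLap_amp_add {q : ℕ} (hq : 2 ≤ q) {ω : ℝ} (hω : ω ≠ 0) (τ : MvPolynomial (Fin 2) ℂ)
    (a : ℕ → MvPolynomial (Fin 2) ℂ) (hlast : polyLap (a (q - 2)) = 0) :
    polyLap (amp q ω a) + C (Complex.I * ω) * transport τ (amp q ω a) =
      C (Complex.I * ω) * ∑ s ∈ Finset.range (q - 1),
        C ((Complex.I * ω)⁻¹ ^ s) * hierarchy τ a s := by
  obtain ⟨k, rfl⟩ := Nat.exists_eq_add_of_le' hq
  simp only [Nat.add_sub_cancel] at hlast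
  have hk : k + 2 - 1 = k + 1 := by omega
  have hx : (C (Complex.I * ω) * C ((Complex.I * ω)⁻¹) : MvPolynomial (Fin 2) ℂ) = 1 := by
    rw [← C_mul, mul_inv_cancel₀ (mul_ne_zero Complex.I_ne_zero (by exact_mod_cast hω)), C_1]
  have hlap : polyLap (amp (k + 2) ω a) =
      ∑ s ∈ Finset.range (k + 1), C ((Complex.I * ω)⁻¹ ^ s) * polyLap (a s) := by
    simp only [amp, hk, polyLap_eq, map_sum, pderiv_C_mul, ← Finset.sum_add_distrib, mul_add]
  have htr : transport τ (amp (k + 2) ω a) =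
      ∑ s ∈ Finset.range (k + 1), C ((Complex.I * ω)⁻¹ ^ s) * transport τ (a s) := by
    simp only [amp, hk, transport, gradDot, Fin.sum_univ_two, map_sum, pderiv_C_mul,
      Finset.sum_mul, ← Finset.sum_add_distrib, Finset.mul_sum]
    exact Finset.sum_congr rfl fun s _ => by ring
  rw [hlap, htr, hk, Finset.sum_range_succ, hlast, mul_zero, add_zero,
    Finset.sum_range_succ' _ k, Finset.sum_range_succ' _ k]
  simp only [hierarchy, mul_add, Finset.sum_add_distrib, pow_zero]
  rw [show ∑ s ∈ Finset.range k, C ((Complex.I * (ω : ℂ))⁻¹ ^ s) * polyLap (a s) =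
    C (Complex.I * ω) * ∑ s ∈ Finset.range k, C ((Complex.I * (ω : ℂ))⁻¹ ^ (s + 1)) * polyLap (a s)
    from ?_]
  · ring
  · rw [Finset.mul_sum]
    refine Finset.sum_congr rfl fun s _ => ?_
    have hs : (C ((Complex.I * (ω : ℂ))⁻¹ ^ (s + 1)) : MvPolynomial (Fin 2) ℂ) =
        C ((Complex.I * (ω : ℂ))⁻¹) * C ((Complex.I * (ω : ℂ))⁻¹ ^ s) := by rw [pow_succ', C_mul]
    rw [hs]
    linear_combination (-C ((Complex.I * (ω : ℂ))⁻¹ ^ s) * polyLap (a s)) * hx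

lemma wnorm_polyLap_le {𝕜 : Type*} [RCLike 𝕜] {R T : ℝ} (hR : 0 < R) {p : MvPolynomial (Fin 2) 𝕜}
    (hp : wnorm R p ≤ T) : wnorm (R / 4) (polyLap p) ≤ 4 * T / R ^ 2 := by
  have h1 : ∀ i, wnorm (R / 4) (pderiv i (pderiv i p)) ≤ 2 * T / R ^ 2 := fun i => by
    have h2 := wnorm_pderiv_le (R := R / 2) (by positivity) i (pderiv i p)
    have h3 := wnorm_pderiv_le hR i p
    rw [show R / 2 / 2 = R / 4 by ring] at h2
    calc _ ≤ (R / 2)⁻¹ * (R⁻¹ * T) := h2.trans (by gcongr; exact h3.trans (by gcongr))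
      _ = _ := by field_simp
  rw [polyLap_eq]
  refine (wnorm_add_le (by positivity) _ _).trans ?_
  refine (add_le_add (h1 0) (h1 1)).trans_eq (by ring)

lemma wnorm_gradDot_le {𝕜 : Type*} [RCLike 𝕜] {R T S : ℝ} (hR : 0 < R)
    {p r : MvPolynomial (Fin 2) 𝕜} (hp : wnorm R p ≤ T) (hr : wnorm R r ≤ S) :
    wnorm (R / 4) (gradDot p r) ≤ 2 * (T * S) / R ^ 2 := by
  have hT := (wnorm_nonneg hR.le p).trans hp
  have h0 : ∀ {U : ℝ} {w : MvPolynomial (Fin 2) 𝕜} (i : Fin 2), wnorm R w ≤ U →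
      wnorm (R / 4) (pderiv i w) ≤ R⁻¹ * U := fun {U w} i hw =>
    (wnorm_mono (by positivity) (by linarith) _).trans
      ((wnorm_pderiv_le hR i w).trans (by gcongr))
  have h1 : ∀ i, wnorm (R / 4) (pderiv i p * pderiv i r) ≤ R⁻¹ * T * (R⁻¹ * S) := fun i =>
    (wnorm_mul_le (by positivity) _ _).trans
      (mul_le_mul (h0 i hp) (h0 i hr) (wnorm_nonneg (by positivity) _) (by positivity))
  rw [gradDot, Fin.sum_univ_two]
  refine (wnorm_add_le (by positivity) _ _).trans ?_
  refine (add_le_add (h1 0) (h1 1)).trans_eq ?_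
  field_simp
  ring

lemma wnorm_transport_le {R T S : ℝ} (hR : 0 < R) {τ b : MvPolynomial (Fin 2) ℂ}
    (hτ : wnorm R τ ≤ T) (hb : wnorm R b ≤ S) :
    wnorm (R / 4) (transport τ b) ≤ 8 * (S * T) / R ^ 2 := by
  have hS := (wnorm_nonneg hR.le b).trans hb
  have h1 := wnorm_gradDot_le hR hb hτ
  have h2 := wnorm_polyLap_le hR hτ
  have h3 : wnorm (R / 4) (b * polyLap τ) ≤ S * (4 * T / R ^ 2) :=
    (wnorm_mul_le (by positivity) _ _).trans
      (mul_le_mul ((wnorm_mono (by positivity) (by linarith) _).trans hb) h2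
        (wnorm_nonneg (by positivity) _) hS)
  have h4 : wnorm (R / 4) (2 * gradDot b τ) ≤ 2 * (2 * (S * T) / R ^ 2) := by
    rw [two_mul]
    exact (wnorm_add_le (by positivity) _ _).trans (by linarith)
  refine (wnorm_add_le (by positivity) _ _).trans ((add_le_add h4 h3).trans_eq ?_)
  ring

lemma wnorm_amp_le {R T ω : ℝ} (hR : 0 ≤ R) (hω : 2 ≤ ω) {q : ℕ} (hq : 2 ≤ q)
    {a : ℕ → MvPolynomial (Fin 2) ℂ} (hT : 0 ≤ T) (ha : ∀ s ≤ q - 2, wnorm R (a s) ≤ T) :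
    wnorm R (amp q ω a) ≤ 2 * T := by
  refine (wnorm_sum_le hR _ _).trans ?_
  have hnC : ‖(Complex.I * (ω : ℂ))⁻¹‖ ≤ 1 / 2 := by
    rw [norm_inv, norm_mul, Complex.norm_I, one_mul, Complex.norm_real,
      Real.norm_of_nonneg (by linarith), inv_eq_one_div]
    exact one_div_le_one_div_of_le (by norm_num) hω
  calc ∑ s ∈ Finset.range (q - 1), wnorm R (C ((Complex.I * (ω : ℂ))⁻¹ ^ s) * a s)
      ≤ ∑ s ∈ Finset.range (q - 1), (1 / 2 : ℝ) ^ s * T := by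
        refine Finset.sum_le_sum fun s hs => ?_
        have hs' : s ≤ q - 2 := by have := Finset.mem_range.mp hs; omega
        rw [wnorm_C_mul, norm_pow]
        exact mul_le_mul (pow_le_pow_left₀ (norm_nonneg _) hnC s) (ha s hs') (wnorm_nonneg hR _)
          (by positivity)
    _ = (∑ s ∈ Finset.range (q - 1), (1 / 2 : ℝ) ^ s) * T := by rw [Finset.sum_mul]
    _ ≤ 2 * T := by
        gcongr
        simpa using sum_geometric_two_le (q - 1)

lemma vanish_hierarchy {q : ℕ} {ω : ℝ} {τ : MvPolynomial (Fin 2) ℝ}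
    {a : ℕ → MvPolynomial (Fin 2) ℂ} (ha : IsAmplitude q ω τ a) {s : ℕ} (hs : s ≤ q - 2) :
    Vanish (q + 1 - s) (hierarchy (toComplex τ) a s) := by
  cases s with
  | zero => exact fun m hm => ha.transport_zero m hm
  | succ s => exact fun m hm => ha.transport_succ s hs m hm

/-- Read from the last index s = q - 2 backwards, the terms form a geometric progression of ratio ωy
≤ 1/2. The last one dominates, and no factor q appears. -/
lemma sum_hierarchy_weights_le {ω y : ℝ} (hω : 0 < ω) (hy : 0 ≤ y) (hωy : ω * y ≤ 1 / 2) {q : ℕ}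
    (hq : 2 ≤ q) :
    ∑ s ∈ Finset.range (q - 1), ω⁻¹ ^ s * y ^ (q + 1 - s) ≤ 2 * (ω⁻¹ ^ (q - 2) * y ^ 3) := by
  obtain ⟨k, rfl⟩ := Nat.exists_eq_add_of_le' hq
  have hk : k + 2 - 1 = k + 1 := by omega
  rw [hk, ← Finset.sum_range_reflect]
  have hterm : ∀ i ∈ Finset.range (k + 1), ω⁻¹ ^ (k + 1 - 1 - i) * y ^ (k + 2 + 1 - (k + 1 - 1 - i)) =
      ω⁻¹ ^ k * y ^ 3 * (ω * y) ^ i := fun i hi => by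
    have hi' := Finset.mem_range.mp hi
    obtain ⟨d, rfl⟩ : ∃ d, k = i + d := ⟨k - i, by omega⟩
    rw [show i + d + 1 - 1 - i = d by omega, show i + d + 2 + 1 - d = 3 + i by omega]
    have : ω⁻¹ ^ i * ω ^ i = 1 := by rw [← mul_pow, inv_mul_cancel₀ hω.ne', one_pow]
    rw [pow_add ω⁻¹, mul_pow, pow_add y]
    linear_combination (-(ω⁻¹ ^ d * y ^ 3 * y ^ i)) * this
  rw [Finset.sum_congr rfl hterm, ← Finset.mul_sum, Nat.add_sub_cancel, mul_comm (2 : ℝ)]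
  refine mul_le_mul_of_nonneg_left ?_ (by positivity)
  calc ∑ i ∈ Finset.range (k + 1), (ω * y) ^ i ≤ ∑ i ∈ Finset.range (k + 1), (1 / 2 : ℝ) ^ i :=
        Finset.sum_le_sum fun i _ => pow_le_pow_left₀ (by positivity) hωy i
    _ ≤ 2 := by simpa using sum_geometric_two_le (k + 1)

lemma vanish_gradDot_sub_tayP {ξ : Plane → ℝ} {q : ℕ} {θ : ℝ} {τ : MvPolynomial (Fin 2) ℝ}
    (hu : UniqueDiffOn ℝ K) (hb : barycenter K ∈ K)
    (hξ : ContDiffOn ℝ ((q + 1 : ℕ) : WithTop ℕ∞) ξ K) (hτ : IsPhase K ξ q θ τ) {m : ℕ}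
    (hm : m ≤ q + 1) : Vanish m (gradDot τ τ - tayP K (barycenter K) m ξ) := by
  have key : ∀ j ≤ q + 1, homogeneousComponent j (gradDot τ τ) = tayH K (barycenter K) j ξ := by
    intro j hj
    refine MvPolynomial.funext fun v => ?_
    have h1 := hτ.eikonal j hj (WithLp.toLp 2 v)
    have h2 := eval_tayH hu hb j (hξ.of_le (by exact_mod_cast hj)) (WithLp.toLp 2 v)
    rw [h1]
    exact h2.symm
  intro n hn
  rw [coeff_sub, tayP, coeff_sum, Finset.sum_eq_single n.degree, ← key _ (by omega),
    coeff_homogeneousComponent, if_pos rfl, sub_self]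
  · intro j _ hj
    exact (tayH_isHomogeneous j ξ).coeff_eq_zero (by simpa [Finsupp.degree_apply] using hj.symm)
  · intro hnm
    exact absurd (Finset.mem_range.mpr hn) hnm

/-- The residual has an eikonal part ω²(ξ - |∇τ|²)a and a transport part. In the first, |∇τ|² is
compared with the Taylor polynomial of degree less than `m` only, since the norm of ξ is bounded up
to order `m ≤ n`. The constant is independent of `q`. -/
lemma exists_residual_bound (n : ℕ) (B M : ℝ) (hB : 1 ≤ B) (hM : 0 ≤ M) :
    ∃ D : ℝ, 0 ≤ D ∧ ∀ (ω h : ℝ) (K : Set Plane) (c : Plane) (ξ : Plane → ℝ) (q m : ℕ) (θ : ℝ)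
      (τ : MvPolynomial (Fin 2) ℝ) (a : ℕ → MvPolynomial (Fin 2) ℂ),
      2 ≤ ω → 0 < h → ω * h ≤ (32 * B)⁻¹ → IsTame K h (barycenter K) c → 2 ≤ q →
      m ≤ n → m ≤ q + 1 → ContDiffOn ℝ ((q + 1 : ℕ) : WithTop ℕ∞) ξ K →
      ckNorm K m ξ ≤ ENNReal.ofReal M → IsPhase K ξ q θ τ → IsAmplitude q ω τ a →
      CoeffBound q B τ a → ∀ x ∈ K,
      ‖pd K 0 (pd K 0 (basisFun K q ω τ a)) x + pd K 1 (pd K 1 (basisFun K q ω τ a)) x +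
        ((ω ^ 2 * ξ x : ℝ) : ℂ) * basisFun K q ω τ a x‖ ≤
        D * (ω ^ 2 * h ^ m + ω * ω⁻¹ ^ (q - 2) * h ^ 3) := by
  have hB0 : 0 < B := by linarith
  set R : ℝ := (4 * B)⁻¹ with hRdef
  have hR : 0 < R := by positivity
  set T : ℝ := 2 * B
  set G : ℝ := 8 * (T * T) / R ^ 2 + 4 * T / R ^ 2 with hGdef
  have hG : 0 ≤ G := by positivity
  set E : ℝ := 2 * (T * T) / R ^ 2 + ∑ j ∈ Finset.range n, 2 ^ j * M with hEdef
  have hE : 0 ≤ E := by positivity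
  set D₁ : ℝ := 2 * T * (M * 4 ^ n + ((R / 4)⁻¹ + 1) ^ n * E) with hD₁
  set D₂ : ℝ := G * 2 * (R / 4)⁻¹ ^ 3 with hD₂
  refine ⟨D₁ + D₂, by positivity, ?_⟩
  intro ω h K c ξ q m θ τ a hω hh hωh hK hq hmn hmq hξ hξM hτ ha hco x hx
  have hω0 : 0 < ω := by linarith
  have hR4 : (0 : ℝ) < R / 4 := by positivity
  have hR1 : R / 4 ≤ 1 := by
    have : R ≤ 1 := inv_le_one_of_one_le₀ (by linarith)
    linarith
  -- The threshold 1/(32B) is R/8. The working radius is R/4 because second derivatives halve the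
  -- radius twice.
  have hhR : ω * (h / (R / 4)) ≤ 1 / 2 := by
    rw [mul_div_assoc', div_le_iff₀ hR4]
    refine hωh.trans_eq ?_
    rw [hRdef]
    field_simp
    norm_num
  have hhR' : h ≤ R / 4 := by
    have h1 : h / (R / 4) ≤ ω * (h / (R / 4)) := le_mul_of_one_le_left (by positivity) (by linarith)
    have h2 : h / (R / 4) ≤ 1 := by linarith
    rwa [div_le_one hR4] at h2
  set r₀ := barycenter K
  have hd : ∀ y ∈ K, dist y r₀ ≤ h := fun y hy => hK.dist_le y hy r₀ hK.base_mem
  have hu := hK.unique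
  have hτn : wnorm R τ ≤ T := wnorm_le_of_coeff_le hB0 hco.phase
  have hτc : wnorm R (toComplex τ) ≤ T := by rwa [wnorm_map]
  have han : ∀ s ≤ q - 2, wnorm R (a s) ≤ T := fun s hs =>
    wnorm_le_of_coeff_le hB0 (hco.amplitude s hs)
  have hamp : wnorm R (amp q ω a) ≤ 2 * T := wnorm_amp_le hR.le hω hq (by positivity) han
  -- the transport part
  have hhier : ∀ s ≤ q - 2, wnorm (R / 4) (hierarchy (toComplex τ) a s) ≤ G := by
    intro s hs
    cases s with
    | zero =>
      refine (wnorm_transport_le hR hτc (han 0 hs)).trans ?_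
      rw [hGdef]
      exact le_add_of_nonneg_right (by positivity)
    | succ s =>
      exact (wnorm_add_le hR4.le _ _).trans (add_le_add (wnorm_transport_le hR hτc (han _ hs))
        (wnorm_polyLap_le hR (han s (by omega))))
  have hnC : ‖Complex.I * (ω : ℂ)‖ = ω := by
    rw [norm_mul, Complex.norm_I, one_mul, Complex.norm_real, Real.norm_of_nonneg hω0.le]
  have htrans : wnorm h (C (Complex.I * ω) * ∑ s ∈ Finset.range (q - 1),
      C ((Complex.I * ω)⁻¹ ^ s) * hierarchy (toComplex τ) a s) ≤
      D₂ * (ω * ω⁻¹ ^ (q - 2) * h ^ 3) := by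
    rw [wnorm_C_mul, hnC]
    have h1 : wnorm h (∑ s ∈ Finset.range (q - 1),
        C ((Complex.I * (ω : ℂ))⁻¹ ^ s) * hierarchy (toComplex τ) a s) ≤
        G * ∑ s ∈ Finset.range (q - 1), ω⁻¹ ^ s * (h / (R / 4)) ^ (q + 1 - s) := by
      refine (wnorm_sum_le hh.le _ _).trans ?_
      rw [Finset.mul_sum]
      refine Finset.sum_le_sum fun s hs => ?_
      have hs' : s ≤ q - 2 := by have := Finset.mem_range.mp hs; omega
      rw [wnorm_C_mul, norm_pow, norm_inv, hnC]
      have h2 := (vanish_hierarchy ha hs').wnorm_le hh.le hR4 hhR'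
      calc ω⁻¹ ^ s * wnorm h (hierarchy (toComplex τ) a s)
          ≤ ω⁻¹ ^ s * ((h / (R / 4)) ^ (q + 1 - s) * G) := by
            gcongr
            exact h2.trans (by gcongr; exact hhier s hs')
        _ = _ := by ring
    have h3 := sum_hierarchy_weights_le hω0 (y := h / (R / 4)) (by positivity) hhR hq
    calc _ ≤ ω * (G * (2 * (ω⁻¹ ^ (q - 2) * (h / (R / 4)) ^ 3))) := by
          gcongr
          exact h1.trans (by gcongr)
      _ = _ := by rw [hD₂, div_pow, inv_pow]; ring
  -- the eikonal part
  have heik : |ξ x - peval r₀ (gradDot τ τ) x| ≤ (M * 4 ^ n + ((R / 4)⁻¹ + 1) ^ n * E) * h ^ m := by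
    have hξm : ContDiffOn ℝ (m : WithTop ℕ∞) ξ K := hξ.of_le (by exact_mod_cast hmq)
    have h1 := norm_sub_tayP_le hK m hξm (partialsLE_of_ckNorm hu le_rfl hM hξm hξM) hx
    have hv := (vanish_gradDot_sub_tayP hu hK.base_mem hξ hτ hmq).wnorm_le hh.le hR4 hhR'
    have h2 : wnorm (R / 4) (gradDot τ τ - tayP K r₀ m ξ) ≤ E := by
      refine (wnorm_sub_le hR4.le _ _).trans (add_le_add (wnorm_gradDot_le hR hτn hτn) ?_)
      refine (wnorm_sum_le hR4.le _ _).trans ?_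
      calc _ ≤ ∑ j ∈ Finset.range m, 2 ^ j * M := Finset.sum_le_sum fun j hj => by
            have hjm : j ≤ m := (Finset.mem_range.mp hj).le
            exact (wnorm_mono hR4.le hR1 _).trans (wnorm_tayH_le hK.base_mem j
              (partialsLE_of_ckNorm hu hjm hM hξm hξM))
        _ ≤ _ := Finset.sum_le_sum_of_subset_of_nonneg (Finset.range_mono hmn)
            fun _ _ _ => by positivity
    have h3 : |peval r₀ (tayP K r₀ m ξ) x - peval r₀ (gradDot τ τ) x| ≤
        (h / (R / 4)) ^ m * E := by
      have h4 : peval r₀ (tayP K r₀ m ξ) x - peval r₀ (gradDot τ τ) x =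
          -peval r₀ (gradDot τ τ - tayP K r₀ m ξ) x := by simp [peval]
      rw [h4, abs_neg]
      refine (norm_eval_le (h := h) (fun i => ?_) _).trans (hv.trans (by gcongr))
      exact norm_sub_apply_le (hd x hx) i
    have h5 : |ξ x - peval r₀ (gradDot τ τ) x| ≤ M * (4 * h) ^ m + (h / (R / 4)) ^ m * E := by
      calc _ = |(ξ x - peval r₀ (tayP K r₀ m ξ) x) +
            (peval r₀ (tayP K r₀ m ξ) x - peval r₀ (gradDot τ τ) x)| := by congr 1; ring
        _ ≤ _ := (abs_add_le _ _).trans (add_le_add h1 h3)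
    refine h5.trans ?_
    have h6 : (4 : ℝ) ^ m ≤ 4 ^ n := pow_le_pow_right₀ (by norm_num) hmn
    have h7 : (R / 4)⁻¹ ^ m ≤ ((R / 4)⁻¹ + 1) ^ n :=
      (pow_le_pow_left₀ (by positivity) (by linarith) m).trans
        (pow_le_pow_right₀ (by have := inv_pos.mpr hR4; linarith) hmn)
    rw [mul_pow, div_eq_mul_inv, mul_pow, add_mul]
    calc M * (4 ^ m * h ^ m) + h ^ m * (R / 4)⁻¹ ^ m * E
        ≤ M * (4 ^ n * h ^ m) + h ^ m * ((R / 4)⁻¹ + 1) ^ n * E := by gcongr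
      _ = _ := by ring
  -- combination
  have hpd : ∀ i, pd K i (pd K i (basisFun K q ω τ a)) x =
      wave r₀ ω τ (waveD ω τ i (waveD ω τ i (amp q ω a))) x := fun i => by
    rw [basisFun_eq_wave, pd_congr (pd_wave hu ω τ (amp q ω a) i) i hx]
    exact pd_wave hu ω τ _ i hx
  rw [hpd, hpd, basisFun_eq_wave]
  have hsum : wave r₀ ω τ (waveD ω τ 0 (waveD ω τ 0 (amp q ω a))) x +
      wave r₀ ω τ (waveD ω τ 1 (waveD ω τ 1 (amp q ω a))) x +
      ((ω ^ 2 * ξ x : ℝ) : ℂ) * wave r₀ ω τ (amp q ω a) x =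
      wave r₀ ω τ (C (Complex.I * ω) * ∑ s ∈ Finset.range (q - 1),
        C ((Complex.I * ω)⁻¹ ^ s) * hierarchy (toComplex τ) a s) x +
      ((ω ^ 2 * (ξ x - peval r₀ (gradDot τ τ) x) : ℝ) : ℂ) * wave r₀ ω τ (amp q ω a) x := by
    have hgrad : peval r₀ (gradDot (toComplex τ) (toComplex τ)) x =
        ((peval r₀ (gradDot τ τ) x : ℝ) : ℂ) := by
      rw [← peval_toComplex]
      congr 1
      simp [toComplex, gradDot, pderiv_map]
    have h1 := congrArg (fun p => peval r₀ p x) (sum_waveD_waveD ω τ (amp q ω a))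
    rw [polyLap_amp_add hq hω0.ne' (toComplex τ) a ha.harmonic_last] at h1
    have hpa : ∀ p r : MvPolynomial (Fin 2) ℂ, peval r₀ (p + r) x = peval r₀ p x + peval r₀ r x :=
      fun p r => by simp [peval]
    have hps : ∀ p r : MvPolynomial (Fin 2) ℂ, peval r₀ (p - r) x = peval r₀ p x - peval r₀ r x :=
      fun p r => by simp [peval]
    have hpm : ∀ p r : MvPolynomial (Fin 2) ℂ, peval r₀ (p * r) x = peval r₀ p x * peval r₀ r x :=
      fun p r => by simp [peval]
    have hpC : ∀ z : ℂ, peval r₀ (C z) x = z := fun z => by simp [peval]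
    simp only [hpa, hps] at h1
    rw [hpm (C ((ω : ℂ) ^ 2)), hpm (amp q ω a), hpC, hgrad] at h1
    simp only [wave]
    push_cast
    linear_combination Complex.exp (Complex.I * ω * peval r₀ (toComplex τ) x) * h1
  rw [hsum]
  have hw1 := (norm_wave_le (hd x hx) ω τ _).trans htrans
  have hw2 : ‖wave r₀ ω τ (amp q ω a) x‖ ≤ 2 * T :=
    (norm_wave_le (hd x hx) ω τ _).trans ((wnorm_mono hh.le (by linarith) _).trans hamp)
  refine (norm_add_le _ _).trans ?_
  rw [norm_mul, Complex.norm_real, Real.norm_eq_abs, abs_mul, abs_of_nonneg (sq_nonneg ω)]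
  have hw3 : ω ^ 2 * |ξ x - peval r₀ (gradDot τ τ) x| * ‖wave r₀ ω τ (amp q ω a) x‖ ≤
      D₁ * (ω ^ 2 * h ^ m) := by
    calc _ ≤ ω ^ 2 * ((M * 4 ^ n + ((R / 4)⁻¹ + 1) ^ n * E) * h ^ m) * (2 * T) := by gcongr
      _ = _ := by rw [hD₁]; ring
  have hD₁0 : 0 ≤ D₁ := by positivity
  have hD₂0 : 0 ≤ D₂ := by positivity
  have hp1 : 0 ≤ ω ^ 2 * h ^ m := by positivity
  have hp2 : 0 ≤ ω * ω⁻¹ ^ (q - 2) * h ^ 3 := by positivity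
  nlinarith [mul_nonneg hD₁0 hp2, mul_nonneg hD₂0 hp1]

end Residual

/-! ### Perturbed Vandermonde systems -/

section LinearSystem

/-- An injective matrix is bounded below, and a small perturbation keeps half of that lower bound.
For square matrices injectivity gives solvability, and the lower bound is the estimate of the
solution. -/
lemma exists_solution_of_near {p : ℕ} (V : Matrix (Fin p) (Fin p) ℂ)
    (hV : ∀ x : Fin p → ℂ, V.mulVec x = 0 → x = 0) :
    ∃ ε D : ℝ, 0 < ε ∧ 0 ≤ D ∧ ∀ G : Matrix (Fin p) (Fin p) ℂ,
      (∀ r l, ‖G r l - V r l‖ ≤ ε) → ∀ g : Fin p → ℂ, ∃ x, G.mulVec x = g ∧ ‖x‖ ≤ D * ‖g‖ := by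
  obtain ⟨κ, hκ', hlow⟩ : ∃ κ : ℝ, 0 < κ ∧ ∀ x : Fin p → ℂ, ‖x‖ ≤ κ * ‖V.mulVec x‖ := by
    obtain ⟨κ, hκ, hanti⟩ := (Matrix.mulVecLin V).exists_antilipschitzWith
      (LinearMap.ker_eq_bot'.mpr fun x hx => hV x hx)
    refine ⟨κ, by exact_mod_cast hκ, fun x => ?_⟩
    simpa using hanti.le_mul_dist x 0
  -- A row sum of `p` entries of this size is below 1/(2κ); the + 1 keeps the denominator nonzero
  -- for p = 0.
  refine ⟨(2 * κ * (p + 1))⁻¹, 2 * κ, by positivity, by positivity, fun G hG g => ?_⟩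
  have hdiff : ∀ x : Fin p → ℂ, ‖V.mulVec x‖ ≤ ‖G.mulVec x‖ + (2 * κ)⁻¹ * ‖x‖ := fun x => by
    have h1 : ‖(G - V).mulVec x‖ ≤ (2 * κ)⁻¹ * ‖x‖ := by
      refine (pi_norm_le_iff_of_nonneg (by positivity)).mpr fun r => ?_
      calc ‖(G - V).mulVec x r‖ ≤ ∑ l, ‖(G - V) r l * x l‖ := by
            rw [Matrix.mulVec, dotProduct]; exact norm_sum_le _ _
        _ ≤ ∑ _l : Fin p, (2 * κ * (p + 1))⁻¹ * ‖x‖ := Finset.sum_le_sum fun l _ => by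
            rw [norm_mul]
            exact mul_le_mul (hG r l) (norm_le_pi_norm x l) (norm_nonneg _) (by positivity)
        _ = p * ((2 * κ * (p + 1))⁻¹ * ‖x‖) := by simp
        _ = (p / (p + 1)) * ((2 * κ)⁻¹ * ‖x‖) := by rw [mul_inv]; field_simp
        _ ≤ 1 * ((2 * κ)⁻¹ * ‖x‖) := by
            gcongr
            rw [div_le_one (by positivity)]
            linarith
        _ = _ := one_mul _
    have h2 : V.mulVec x = G.mulVec x - (G - V).mulVec x := by
      rw [Matrix.sub_mulVec]; abel
    rw [h2]
    exact (norm_sub_le _ _).trans (by linarith)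
  have hbound : ∀ x : Fin p → ℂ, ‖x‖ ≤ 2 * κ * ‖G.mulVec x‖ := fun x => by
    have h1 := (hlow x).trans (mul_le_mul_of_nonneg_left (hdiff x) hκ'.le)
    have h2 : (κ : ℝ) * ((2 * κ)⁻¹ * ‖x‖) = ‖x‖ / 2 := by field_simp
    rw [mul_add, h2] at h1
    linarith
  have hinj : Function.Injective (Matrix.mulVecLin G) := by
    rw [← LinearMap.ker_eq_bot, LinearMap.ker_eq_bot']
    intro x hx
    have := hbound x
    rw [Matrix.mulVecLin_apply] at hx
    rw [hx, norm_zero, mul_zero] at this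
    exact norm_le_zero_iff.mp this
  obtain ⟨x, hx⟩ := LinearMap.injective_iff_surjective.mp hinj g
  rw [Matrix.mulVecLin_apply] at hx
  exact ⟨x, hx, hx ▸ hbound x⟩

/-- The matrix `e^{i(r-n)θ_l}`. -/
def fourierMatrix (n : ℕ) (θ : Fin (2 * n + 1) → ℝ) :
    Matrix (Fin (2 * n + 1)) (Fin (2 * n + 1)) ℂ :=
  fun r l => Complex.exp (θ l * Complex.I) ^ (((r : ℕ) : ℤ) - n)

/-- With z_l^{-n} moved from the columns into the unknowns, this is the Vandermonde matrix of the
points e^{iθ_l}, which are distinct because the directions are. -/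
lemma fourierMatrix_injective (n : ℕ) (θ : Fin (2 * n + 1) → ℝ)
    (hθ : Function.Injective fun l => (Real.cos (θ l), Real.sin (θ l)))
    (x : Fin (2 * n + 1) → ℂ) (hx : (fourierMatrix n θ).mulVec x = 0) : x = 0 := by
  set z : Fin (2 * n + 1) → ℂ := fun l => Complex.exp (θ l * Complex.I) with hz
  have hz0 : ∀ l, z l ≠ 0 := fun l => Complex.exp_ne_zero _
  have hzinj : Function.Injective z := fun l l' h => by
    apply hθ
    simp only [hz] at h
    have h1 := congrArg Complex.re h
    have h2 := congrArg Complex.im h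
    rw [Complex.exp_ofReal_mul_I_re, Complex.exp_ofReal_mul_I_re] at h1
    rw [Complex.exp_ofReal_mul_I_im, Complex.exp_ofReal_mul_I_im] at h2
    exact Prod.ext h1 h2
  have hy : (fun l => z l ^ (-(n : ℤ)) * x l) = 0 := by
    refine Matrix.eq_zero_of_forall_pow_sum_mul_pow_eq_zero hzinj fun r => ?_
    have := congrFun hx r
    simp only [Matrix.mulVec, dotProduct, fourierMatrix, Pi.zero_apply] at this
    rw [← this]
    refine Finset.sum_congr rfl fun l _ => ?_
    rw [sub_eq_add_neg, zpow_add₀ (hz0 l), zpow_natCast]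
    ring
  funext l
  have := congrFun hy l
  simpa [hz0 l] using this

end LinearSystem

/-! ### The choice of the order -/

section Order

lemma two_le_order (n : ℕ) (ω h : ℝ) : 2 ≤ order n ω h := le_max_left _ _

/-- The logarithmic form of the definition of the order. The exponent is q + 1 since only the floor
plus one exceeds the real quotient. -/
lemma inv_pow_order_le {n : ℕ} (hn : 4 ≤ n) {ω h : ℝ} (hω : 1 < ω) (hh : 0 < h) :
    ω⁻¹ ^ (order n ω h + 1) ≤ (ω * h) ^ (n - 4) := by
  have hω0 : 0 < ω := by linarith
  have hy : 0 < ω * h := mul_pos hω0 hh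
  have hlog : 0 < Real.log ω := Real.log_pos hω
  have h1 := Nat.lt_floor_add_one (((n : ℝ) - 4) * Real.log ((ω * h)⁻¹) / Real.log ω)
  have h2 : ((⌊((n : ℝ) - 4) * Real.log ((ω * h)⁻¹) / Real.log ω⌋₊ : ℕ) : ℝ) ≤ order n ω h := by
    exact Nat.cast_le.mpr (le_max_right _ _)
  have h3 : ((n : ℝ) - 4) * Real.log ((ω * h)⁻¹) ≤ (order n ω h + 1) * Real.log ω := by
    rw [← div_le_iff₀ hlog]
    linarith
  have h4 : (ω * h)⁻¹ ^ (n - 4) ≤ ω ^ (order n ω h + 1) := by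
    rw [← Real.log_le_log_iff (by positivity) (by positivity), Real.log_pow, Real.log_pow,
      Nat.cast_sub hn]
    push_cast
    exact h3
  rw [inv_pow] at h4 ⊢
  rw [inv_le_comm₀ (by positivity) (by positivity)]
  exact h4

/-- With y = ωh the two terms are y^{m+2} ω^{-m} for m = min(q + 1, n), and y⁵ ω^{-(q+2)}. If q + 1
< n, then q ≥ 2 gives m + 2 ≥ 5, and ω^{-(q+1)} ≤ y^{n-4} supplies the missing powers of y. For n <
4 the powers of y already suffice. -/
lemma order_estimate {n : ℕ} {ω h : ℝ} (hω : 1 < ω) (hh : 0 < h) (hωh : ω * h ≤ 1) :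
    h ^ 2 * (ω ^ 2 * h ^ (min (order n ω h + 1) n) + ω * ω⁻¹ ^ (order n ω h - 2) * h ^ 3) ≤
      2 * (ω * h) ^ (n + 1) := by
  have hω0 : 0 < ω := by linarith
  have hq := two_le_order n ω h
  have hE := fun hn : 4 ≤ n => inv_pow_order_le hn hω hh
  set q := order n ω h
  set y := ω * h with hy
  have hy0 : 0 < y := mul_pos hω0 hh
  have hinv : ω⁻¹ ≤ 1 := inv_le_one_of_one_le₀ hω.le
  have hinv0 : 0 ≤ ω⁻¹ := by positivity
  have hhy : h = y * ω⁻¹ := by rw [hy]; field_simp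
  have key : 4 ≤ n → y ^ 5 * ω⁻¹ ^ (q + 1) ≤ y ^ (n + 1) := fun hn => by
    calc y ^ 5 * ω⁻¹ ^ (q + 1) ≤ y ^ 5 * y ^ (n - 4) := by gcongr; exact hE hn
      _ = y ^ (n + 1) := by rw [← pow_add]; congr 1; omega
  have t1 : h ^ 2 * (ω ^ 2 * h ^ (min (q + 1) n)) ≤ y ^ (n + 1) := by
    have h1 : h ^ 2 * (ω ^ 2 * h ^ (min (q + 1) n)) =
        y ^ (min (q + 1) n + 2) * ω⁻¹ ^ (min (q + 1) n) := by
      conv_lhs => rw [← mul_assoc, ← mul_pow, mul_comm h ω, ← hy, hhy, mul_pow]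
      ring
    rw [h1]
    rcases le_or_gt n (q + 1) with hle | hlt
    · rw [min_eq_right hle]
      calc y ^ (n + 2) * ω⁻¹ ^ n ≤ y ^ (n + 2) * 1 := by gcongr; exact pow_le_one₀ hinv0 hinv
        _ ≤ y ^ (n + 1) := by rw [mul_one]; exact pow_le_pow_of_le_one hy0.le hωh (by omega)
    · rw [min_eq_left hlt.le]
      refine le_trans ?_ (key (by omega))
      gcongr 1
      exact pow_le_pow_of_le_one hy0.le hωh (by omega)
  have t2 : h ^ 2 * (ω * ω⁻¹ ^ (q - 2) * h ^ 3) ≤ y ^ (n + 1) := by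
    have h1 : h ^ 2 * (ω * ω⁻¹ ^ (q - 2) * h ^ 3) = y ^ 5 * ω⁻¹ ^ (q + 2) := by
      have h2 : ω⁻¹ ^ (q + 2) = ω⁻¹ ^ (q - 2) * ω⁻¹ ^ 4 := by rw [← pow_add]; congr 1; omega
      rw [h2, hy]
      field_simp
    rw [h1]
    rcases le_or_gt 4 n with hle | hlt
    · refine le_trans ?_ (key hle)
      gcongr y ^ 5 * ?_
      exact pow_le_pow_of_le_one hinv0 hinv (by omega)
    · calc y ^ 5 * ω⁻¹ ^ (q + 2) ≤ y ^ 5 * 1 := by gcongr; exact pow_le_one₀ hinv0 hinv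
        _ ≤ y ^ (n + 1) := by rw [mul_one]; exact pow_le_pow_of_le_one hy0.le hωh (by omega)
  rw [mul_add]
  linarith

end Order

/-! ### Estimate of the error from its Laplacian and its isotropic derivatives -/

section Core

lemma eval_mul_tayH {K : Set Plane} {r₀ : Plane} (t : ℂ) (v : Fin 2 → ℂ) (j : ℕ)
    (f : Plane → ℂ) :
    eval (fun i => t * v i) (tayH K r₀ j f) = t ^ j * eval v (tayH K r₀ j f) := by
  induction j generalizing f with
  | zero => simp [tayH]
  | succ j ih =>
    rw [tayH, Fin.sum_univ_two]
    simp only [map_mul, map_add, eval_X, eval_C, ih]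
    ring

lemma line_tayP_eq_zero {K : Set Plane} {r₀ : Plane} {a : ℂ} {k : ℕ} {f : Plane → ℂ}
    (hf : ∀ j < k, eval ![1, a] (tayH K r₀ j f) = 0) : line a (tayP K r₀ k f) = 0 := by
  refine Polynomial.funext fun t => ?_
  have hv : (![t, a * t] : Fin 2 → ℂ) = fun i => t * (![1, a] : Fin 2 → ℂ) i := by
    funext i
    fin_cases i <;> simp [mul_comm]
  rw [eval_line, Polynomial.eval_zero, tayP, map_sum, hv]
  refine Finset.sum_eq_zero fun j hj => ?_
  rw [eval_mul_tayH, hf j (Finset.mem_range.mp hj), mul_zero]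

lemma totalDegree_tayP_le {K : Set Plane} {r₀ : Plane} (k : ℕ) (f : Plane → ℂ) :
    (tayP K r₀ (k + 1) f).totalDegree ≤ k := by
  refine (totalDegree_finsetSum _ _).trans (Finset.sup_le fun j hj => ?_)
  exact (tayH_isHomogeneous j f).totalDegree_le.trans
    (Nat.lt_succ_iff.mp (Finset.mem_range.mp hj))

/-- The Taylor polynomial P of `e` vanishes on both isotropic lines, hence is bounded by h² sup
|ΔP|. The hypothesis bounds ΔP by ω²M sup |e| plus terms of the right order. The resulting
inequality for sup |e| has the factor LM(ωh)² on the right, which is absorbed for small ωh. -/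
lemma exists_error_bound (n : ℕ) {ρ M N E : ℝ} (hρ : 0 < ρ) (hM : 0 ≤ M) (hN : 0 ≤ N)
    (hE : 0 ≤ E) :
    ∃ D δ : ℝ, 0 ≤ D ∧ 0 < δ ∧ δ ≤ 1 ∧ ∀ (K : Set Plane) (h ω : ℝ) (r₀ c : Plane) (k : ℕ)
      (e : Plane → ℂ), IsTame K h r₀ c → Metric.ball c (ρ * h) ⊆ K → IsCompact K →
      3 ≤ k → k ≤ n + 1 → 0 < h → 0 < ω → ω * h ≤ δ →
      ContDiffOn ℝ (k : WithTop ℕ∞) e K → PartialsLE K k (N * ω ^ k) e →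
      (∀ j < k, eval ![1, Complex.I] (tayH K r₀ j e) = 0) →
      (∀ j < k, eval ![1, -Complex.I] (tayH K r₀ j e) = 0) →
      (∀ x ∈ K, ‖pd K 0 (pd K 0 e) x + pd K 1 (pd K 1 e) x‖ ≤
        ω ^ 2 * M * ‖e x‖ + E * (ω ^ k * h ^ (k - 2))) →
      ∀ x ∈ K, ‖e x‖ ≤ D * (ω * h) ^ k ∧ ∀ i, ‖pd K i e x‖ ≤ D * (ω ^ k * h ^ (k - 1)) := by
  obtain ⟨L, hL, hlem⟩ := exists_wnorm_le_of_polyLap n hρ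
  -- `C₅` collects the source term and the remainders of the two second derivatives, `C₆` bounds sup
  -- |e| after absorption, and `C₇` bounds P.
  set C₅ : ℝ := E + 2 * N * 4 ^ (n + 1) with hC₅
  set C₆ : ℝ := 2 * (L * C₅ + N * 4 ^ (n + 1)) with hC₆
  set C₇ : ℝ := L * (M * C₆ + C₅) with hC₇
  refine ⟨C₆ + (n * C₇ + N * 4 ^ (n + 1)), min 1 (2 * (L * M + 1))⁻¹, by positivity,
    lt_min one_pos (by positivity), min_le_left _ _, ?_⟩
  intro K h ω r₀ c k e hK hball hcpt hk3 hkn hh hω hωh hek hNe hI hI' hlap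
  obtain ⟨k, rfl⟩ := Nat.exists_eq_add_of_le' (show 2 ≤ k by omega)
  simp only [Nat.add_sub_cancel] at hlap
  rw [show k + 2 - 1 = k + 1 by omega]
  set y := ω * h with hy
  have hy0 : 0 < y := mul_pos hω hh
  have hy1 : y ≤ 1 := hωh.trans (min_le_left _ _)
  have hyL : L * M * y ^ 2 ≤ 1 / 2 := by
    have h1 : y ≤ (2 * (L * M + 1))⁻¹ := hωh.trans (min_le_right _ _)
    have h2 : y ^ 2 ≤ (2 * (L * M + 1))⁻¹ :=
      (pow_le_of_le_one hy0.le hy1 two_ne_zero).trans h1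
    calc L * M * y ^ 2 ≤ (L * M + 1) * (2 * (L * M + 1))⁻¹ := by gcongr; linarith
      _ = 1 / 2 := by field_simp
  have hu := hK.unique
  have hcl := hK.subset_closure
  have hr := hK.base_mem
  have hd : ∀ x ∈ K, dist x r₀ ≤ h := fun x hx => hK.dist_le x hx r₀ hr
  set P := tayP K r₀ (k + 2) e with hP
  have hpd : ∀ i, ContDiffOn ℝ ((k + 1 : ℕ) : WithTop ℕ∞) (pd K i e) K := contDiffOn_pd hu hek
  have h4 : ∀ j ≤ n + 1, (4 : ℝ) ^ j ≤ 4 ^ (n + 1) := fun j hj =>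
    pow_le_pow_right₀ (by norm_num) hj
  -- Compactness makes sup |e| finite and attained, which the absorption requires.
  obtain ⟨x₀, hx₀, hmax⟩ := hcpt.exists_isMaxOn ⟨r₀, hr⟩ hek.continuousOn.norm
  set S := ‖e x₀‖ with hS
  have hSmax : ∀ x ∈ K, ‖e x‖ ≤ S := fun x hx => hmax hx
  have hS0 : 0 ≤ S := norm_nonneg _
  have hyk : ω ^ (k + 2) * h ^ k * h ^ 2 = y ^ (k + 2) := by rw [hy]; ring
  have hlapP : ∀ x ∈ K, ‖peval r₀ (polyLap P) x‖ ≤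
      ω ^ 2 * M * S + C₅ * (ω ^ (k + 2) * h ^ k) := by
    intro x hx
    have hdd : ∀ i, pderiv i (pderiv i P) = tayP K r₀ k (pd K i (pd K i e)) := fun i => by
      rw [hP, pderiv_tayP hu hcl hr (k + 1) hek i, pderiv_tayP hu hcl hr k (hpd i) i]
    have herr : ∀ i, ‖pd K i (pd K i e) x - peval r₀ (pderiv i (pderiv i P)) x‖ ≤
        N * 4 ^ (n + 1) * (ω ^ (k + 2) * h ^ k) := fun i => by
      rw [hdd]
      refine (norm_sub_tayP_le hK k (contDiffOn_pd hu (hpd i) i) (hNe i i) hx).trans ?_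
      rw [mul_pow]
      have := h4 k (by omega)
      calc N * ω ^ (k + 2) * (4 ^ k * h ^ k) ≤ N * ω ^ (k + 2) * (4 ^ (n + 1) * h ^ k) := by gcongr
        _ = _ := by ring
    have hsplit : peval r₀ (polyLap P) x = (pd K 0 (pd K 0 e) x + pd K 1 (pd K 1 e) x) -
        (pd K 0 (pd K 0 e) x - peval r₀ (pderiv 0 (pderiv 0 P)) x) -
        (pd K 1 (pd K 1 e) x - peval r₀ (pderiv 1 (pderiv 1 P)) x) := by
      rw [polyLap_eq, peval, map_add, ← peval, ← peval]
      ring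
    rw [hsplit]
    refine (norm_sub_le _ _).trans ((add_le_add ((norm_sub_le _ _).trans
      (add_le_add (hlap x hx) (herr 0))) (herr 1)).trans ?_)
    have : ω ^ 2 * M * ‖e x‖ ≤ ω ^ 2 * M * S := by gcongr; exact hSmax x hx
    rw [hC₅]
    linarith
  have hwP : wnorm h P ≤ L * (M * y ^ 2 * S + C₅ * y ^ (k + 2)) := by
    have := hlem P h (ω ^ 2 * M * S + C₅ * (ω ^ (k + 2) * h ^ k)) r₀ c hh
      ((totalDegree_tayP_le (k + 1) e).trans (by omega)) (line_tayP_eq_zero hI)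
      (line_tayP_eq_zero hI') (hd c hK.center_mem) (by positivity)
      fun x hx => hlapP x (hball hx)
    refine this.trans_eq ?_
    rw [← hyk, hy]
    ring
  have hPx : ∀ x ∈ K, ‖e x‖ ≤ wnorm h P + N * 4 ^ (n + 1) * y ^ (k + 2) := fun x hx => by
    have h1 := norm_sub_tayP_le hK (k + 2) hek hNe hx
    have h2 : ‖peval r₀ P x‖ ≤ wnorm h P := norm_eval_le (norm_sub_apply_le (hd x hx)) P
    have h3 : N * ω ^ (k + 2) * (4 * h) ^ (k + 2) ≤ N * 4 ^ (n + 1) * y ^ (k + 2) := by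
      rw [mul_pow, hy, mul_pow]
      have := h4 (k + 2) hkn
      calc N * ω ^ (k + 2) * (4 ^ (k + 2) * h ^ (k + 2))
          ≤ N * ω ^ (k + 2) * (4 ^ (n + 1) * h ^ (k + 2)) := by gcongr
        _ = _ := by ring
    have h5 : ‖e x‖ ≤ ‖e x - peval r₀ P x‖ + ‖peval r₀ P x‖ := norm_le_norm_sub_add _ _
    linarith
  have hyk0 : 0 ≤ y ^ (k + 2) := by positivity
  have hSb : S ≤ C₆ * y ^ (k + 2) := by
    have h1 := (hPx x₀ hx₀).trans (add_le_add_left hwP _)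
    have h2 : L * M * y ^ 2 * S ≤ 1 / 2 * S := by gcongr
    rw [hC₆]
    linarith
  have hwP' : wnorm h P ≤ C₇ * y ^ (k + 2) := by
    refine hwP.trans ?_
    have h1 : M * y ^ 2 * S ≤ M * 1 * (C₆ * y ^ (k + 2)) := by
      gcongr
      exact pow_le_one₀ hy0.le hy1
    calc L * (M * y ^ 2 * S + C₅ * y ^ (k + 2))
        ≤ L * (M * 1 * (C₆ * y ^ (k + 2)) + C₅ * y ^ (k + 2)) := by gcongr
      _ = _ := by rw [hC₇]; ring
  have hC₆0 : 0 ≤ C₆ := by positivity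
  have hC₇0 : 0 ≤ C₇ := by positivity
  intro x hx
  constructor
  · refine (hSmax x hx).trans (hSb.trans ?_)
    gcongr
    exact le_add_of_nonneg_right (by positivity)
  · intro i
    have h1 := norm_sub_tayP_le hK (k + 1) (hpd i) (hNe i) hx
    rw [← pderiv_tayP hu hcl hr (k + 1) hek i, ← hP] at h1
    -- Here the radius stays at `h`, so the derivative costs n/h; the degree of P is bounded by `n`,
    -- independently of q.
    have h2 : ‖peval r₀ (pderiv i P) x‖ ≤ n * C₇ * (ω ^ (k + 2) * h ^ (k + 1)) := by
      refine (norm_eval_le (norm_sub_apply_le (hd x hx)) _).trans ?_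
      refine (wnorm_pderiv_le_of_totalDegree hh (N := n)
        ((totalDegree_tayP_le (k + 1) e).trans (by omega)) i).trans ?_
      calc n / h * wnorm h P ≤ n / h * (C₇ * y ^ (k + 2)) := by gcongr
        _ = _ := by rw [hy, mul_pow, pow_succ h (k + 1)]; field_simp
    have h3 : N * ω ^ (k + 2) * (4 * h) ^ (k + 1) ≤
        N * 4 ^ (n + 1) * (ω ^ (k + 2) * h ^ (k + 1)) := by
      rw [mul_pow]
      have := h4 (k + 1) (by omega)
      calc N * ω ^ (k + 2) * (4 ^ (k + 1) * h ^ (k + 1))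
          ≤ N * ω ^ (k + 2) * (4 ^ (n + 1) * h ^ (k + 1)) := by gcongr
        _ = _ := by ring
    have h5 : ‖pd K i e x‖ ≤ ‖pd K i e x - peval r₀ (pderiv i P) x‖ + ‖peval r₀ (pderiv i P) x‖ :=
      norm_le_norm_sub_add _ _
    have h6 : 0 ≤ C₆ * (ω ^ (k + 2) * h ^ (k + 1)) := by positivity
    linarith

end Core

/-! ### Choice of the coefficients and the approximation theorem -/

section Approximation

lemma CoeffBound.mono {q : ℕ} {B B' : ℝ} (hB : 0 ≤ B) (hBB : B ≤ B') {τ : MvPolynomial (Fin 2) ℝ}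
    {a : ℕ → MvPolynomial (Fin 2) ℂ} (h : CoeffBound q B τ a) : CoeffBound q B' τ a where
  phase m := (h.phase m).trans (pow_le_pow_left₀ hB hBB _)
  amplitude s hs m := (h.amplitude s hs m).trans (pow_le_pow_left₀ hB hBB _)

lemma constantCoeff_cder {a : ℂ} (τ : MvPolynomial (Fin 2) ℝ) :
    constantCoeff (cder a (toComplex τ)) =
      ((coeff (Finsupp.single 0 1) τ : ℝ) : ℂ) +
        a * ((coeff (Finsupp.single 1 1) τ : ℝ) : ℂ) := by
  have h1 : ∀ i, constantCoeff (pderiv i (toComplex τ)) =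
      ((coeff (Finsupp.single i 1) τ : ℝ) : ℂ) :=
    fun i => by
      rw [constantCoeff_eq, coeff_pderiv_eq]
      simp [toComplex, coeff_map]
  have h2 : cder a (toComplex τ) = pderiv 0 (toComplex τ) + C a * pderiv 1 (toComplex τ) := by
    simp [cder, smul_eq_C_mul]
  rw [h2, map_add, map_mul, h1, h1, constantCoeff_C]

lemma constantCoeff_amp {q : ℕ} {ω : ℝ} {τ : MvPolynomial (Fin 2) ℝ}
    {a : ℕ → MvPolynomial (Fin 2) ℂ} (ha : IsAmplitude q ω τ a) :
    constantCoeff (amp q ω a) = 1 := by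
  rw [← ha.normalized, amp, map_sum]
  simp

/-- The complex direction `(1, ±i)` belonging to a row of the linear system. -/
def rowDir (n r : ℕ) : ℂ := if n ≤ r then Complex.I else -Complex.I

/-- The order of differentiation belonging to a row of the linear system. -/
def rowDeg (n r : ℕ) : ℕ := ((r : ℤ) - n).natAbs

lemma norm_rowDir (n r : ℕ) : ‖rowDir n r‖ = 1 := by
  rw [rowDir]
  split_ifs <;> simp

lemma cos_add_rowDir_mul_sin_pow (n r : ℕ) (θ : ℝ) :
    ((Real.cos θ : ℂ) + rowDir n r * (Real.sin θ : ℂ)) ^ rowDeg n r =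
      Complex.exp (θ * Complex.I) ^ ((r : ℤ) - n) := by
  rw [rowDir, rowDeg]
  split_ifs with h
  · have h1 : ((r : ℤ) - n) = ((((r : ℤ) - n).natAbs : ℕ) : ℤ) := by omega
    conv_rhs => rw [h1, zpow_natCast, Complex.exp_mul_I]
    rw [Complex.ofReal_cos, Complex.ofReal_sin, mul_comm Complex.I]
  · have h1 : ((r : ℤ) - n) = -((((r : ℤ) - n).natAbs : ℕ) : ℤ) := by omega
    conv_rhs => rw [h1, zpow_neg, zpow_natCast, ← inv_pow, ← Complex.exp_neg, ← neg_mul,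
      Complex.exp_mul_I, Complex.cos_neg, Complex.sin_neg]
    rw [Complex.ofReal_cos, Complex.ofReal_sin, neg_mul, neg_mul, mul_comm Complex.I]

/-- Row r imposes the condition of order |r - n| in direction (1, i) or (1, -i). Divided by
(iωκ)^{|r-n|}, its entries are e^{i(r-n)θ_l} + O(1/ω), and its right-hand side is bounded because
the j-th derivatives of `u` are O(ω^j). -/
lemma exists_coefficients (n : ℕ) (θ : Fin (2 * n + 1) → ℝ)
    (hθ : Function.Injective fun l => (Real.cos (θ l), Real.sin (θ l))) {μ A B : ℝ}
    (hμ : 0 < μ) (hA : 0 ≤ A) (hB : 0 < B) :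
    ∃ ω₁ X₀ : ℝ, 0 ≤ X₀ ∧ ∀ (ω : ℝ) (K : Set Plane) (ξ : Plane → ℝ) (q k : ℕ)
      (τ : Fin (2 * n + 1) → MvPolynomial (Fin 2) ℝ)
      (a : Fin (2 * n + 1) → ℕ → MvPolynomial (Fin 2) ℂ) (u : Plane → ℂ),
      ω₁ ≤ ω → 2 ≤ ω → UniqueDiffOn ℝ K → barycenter K ∈ K → μ ≤ ξ (barycenter K) → 2 ≤ q →
      k ≤ n + 1 →
      (∀ l, IsPhase K ξ q (θ l) (τ l) ∧ IsAmplitude q ω (τ l) (a l) ∧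
        CoeffBound q B (τ l) (a l)) →
      ContDiffOn ℝ (k : WithTop ℕ∞) u K → (∀ j < k, PartialsLE K j (A * ω ^ j) u) →
      ∃ x : Fin (2 * n + 1) → ℂ, (∀ l, ‖x l‖ ≤ X₀) ∧
        (∀ j < k, eval ![1, Complex.I] (tayH K (barycenter K) j
          (fun y => u y - ∑ l, x l * basisFun K q ω (τ l) (a l) y)) = 0) ∧
        (∀ j < k, eval ![1, -Complex.I] (tayH K (barycenter K) j
          (fun y => u y - ∑ l, x l * basisFun K q ω (τ l) (a l) y)) = 0) := by
  obtain ⟨ε, Dₛ, hε, hDₛ, hsolve⟩ := exists_solution_of_near (fourierMatrix n θ)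
    (fourierMatrix_injective n θ hθ)
  set R : ℝ := (4 * B)⁻¹ with hRdef
  have hR : 0 < R := by positivity
  -- The radius is R/2 because the directional derivative of the phase has already used half of R.
  have hpow := fun j => exists_waveA_pow_bound (R / 2) (2 * R⁻¹ * (2 * B)) (2 * (2 * B))
    (by positivity) (by positivity) (by positivity) j
  choose D hD hDb using hpow
  -- An upper bound for 1/κ, kept at least 1 so that its powers increase.
  set κ₀ : ℝ := 1 + (√μ)⁻¹ with hκ₀
  have hκ₀1 : 1 ≤ κ₀ := le_add_of_nonneg_right (by positivity)
  set D' : ℝ := κ₀ ^ n * ∑ j ∈ Finset.range (n + 1), D j with hD'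
  have hsumD : 0 ≤ ∑ j ∈ Finset.range (n + 1), D j := Finset.sum_nonneg fun j _ => hD j
  set g₀ : ℝ := κ₀ ^ n * (n ! * (2 ^ n * A)) with hg₀
  refine ⟨D' / ε, Dₛ * g₀, by positivity, ?_⟩
  intro ω K ξ q k τ a u hω₁ hω hu hr hξ hq hkn hall huk huj
  set r₀ := barycenter K
  have hω0 : 0 < ω := by linarith
  set κ : ℝ := √(ξ r₀) with hκ
  have hκpos : 0 < κ := Real.sqrt_pos.mpr (hμ.trans_le hξ)
  have hκinv : κ⁻¹ ≤ κ₀ := by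
    have h1 : √μ ≤ κ := Real.sqrt_le_sqrt hξ
    have h2 : κ⁻¹ ≤ (√μ)⁻¹ := inv_anti₀ (Real.sqrt_pos.mpr hμ) h1
    linarith
  have hκpow : ∀ j ≤ n, κ⁻¹ ^ j ≤ κ₀ ^ n := fun j hj =>
    (pow_le_pow_left₀ (by positivity) hκinv j).trans (pow_le_pow_right₀ hκ₀1 hj)
  set z : ℂ := Complex.I * ω * κ with hz
  have hz0 : z ≠ 0 := mul_ne_zero (mul_ne_zero Complex.I_ne_zero (by exact_mod_cast hω0.ne'))
    (by exact_mod_cast hκpos.ne')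
  have hzn : ‖z‖ = ω * κ := by
    rw [hz, norm_mul, norm_mul, Complex.norm_I, one_mul, Complex.norm_real, Complex.norm_real,
      Real.norm_of_nonneg hω0.le, Real.norm_of_nonneg hκpos.le]
  have hdeg : ∀ r : Fin (2 * n + 1), rowDeg n r ≤ n := fun r => by
    have := r.2
    rw [rowDeg]
    omega
  let W : Fin (2 * n + 1) → Fin (2 * n + 1) → ℂ := fun r l =>
    constantCoeff ((waveA ω (τ l) (rowDir n r) ^ rowDeg n r) (amp q ω (a l)))
  have hnear : ∀ r l : Fin (2 * n + 1), ‖z⁻¹ ^ rowDeg n r * W r l - fourierMatrix n θ r l‖ ≤ ε := by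
    intro r l
    obtain ⟨hτ, ha, hco⟩ := hall l
    set j := rowDeg n r with hj
    set d := rowDir n r with hd
    have hτn : wnorm R (toComplex (τ l)) ≤ 2 * B := by
      rw [wnorm_map]; exact wnorm_le_of_coeff_le hB hco.phase
    have hamp : wnorm R (amp q ω (a l)) ≤ 2 * (2 * B) := wnorm_amp_le hR.le hω hq (by positivity)
      fun s hs => wnorm_le_of_coeff_le hB (hco.amplitude s hs)
    have h1 := hDb j ω (τ l) d (amp q ω (a l)) (by linarith) (norm_rowDir n r)
      ((wnorm_cder_le hR (norm_rowDir n r) _).trans (by gcongr))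
      ((wnorm_mono (by positivity) (by linarith) _).trans hamp)
    set rem := (waveA ω (τ l) d ^ j) (amp q ω (a l)) -
      (C (Complex.I * ω) * cder d (toComplex (τ l))) ^ j * amp q ω (a l) with hrem
    have h2 : ‖constantCoeff rem‖ ≤ D j * ω ^ j / ω := by
      rw [le_div_iff₀ hω0, mul_comm]
      exact (mul_le_mul_of_nonneg_left (norm_constantCoeff_le (by positivity) rem) hω0.le).trans h1
    have h3 : constantCoeff rem = W r l - z ^ j * fourierMatrix n θ r l := by
      have hβ : constantCoeff (cder d (toComplex (τ l))) =
          κ * ((Real.cos (θ l) : ℂ) + d * (Real.sin (θ l) : ℂ)) := by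
        rw [constantCoeff_cder, hτ.linear_x, hτ.linear_y]
        push_cast
        ring
      rw [hrem, map_sub, map_mul, map_pow, map_mul, constantCoeff_C, hβ, constantCoeff_amp ha,
        mul_one, ← mul_assoc, ← hz, mul_pow, hj, hd, cos_add_rowDir_mul_sin_pow]
      rfl
    have h4 : z⁻¹ ^ j * W r l - fourierMatrix n θ r l = z⁻¹ ^ j * constantCoeff rem := by
      rw [h3, mul_sub, ← mul_assoc, ← mul_pow, inv_mul_cancel₀ hz0, one_pow, one_mul]
    rw [h4, norm_mul, norm_pow, norm_inv, hzn]
    have h5 : D j ≤ ∑ i ∈ Finset.range (n + 1), D i :=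
      Finset.single_le_sum (f := D) (fun i _ => hD i) (Finset.mem_range.mpr (by have := hdeg r; omega))
    calc (ω * κ)⁻¹ ^ j * ‖constantCoeff rem‖ ≤ (ω * κ)⁻¹ ^ j * (D j * ω ^ j / ω) := by gcongr
      _ = κ⁻¹ ^ j * D j / ω := by
          rw [mul_inv, mul_pow, inv_pow, inv_pow]
          field_simp
      _ ≤ D' / ω := by
          gcongr
          exact mul_le_mul (hκpow j (hdeg r)) h5 (hD j) (by positivity)
      _ ≤ ε := by
          rw [div_le_iff₀ hω0]
          rwa [div_le_iff₀ hε, mul_comm] at hω₁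
  -- For k < n + 1 only orders below `k` are prescribed, as `u` is merely `C^k`. The remaining rows
  -- get the right-hand side 0, which keeps the system square.
  let g : Fin (2 * n + 1) → ℂ := fun r => if rowDeg n r < k then
    z⁻¹ ^ rowDeg n r * (((rowDeg n r) ! : ℕ) * eval ![1, rowDir n r] (tayH K r₀ (rowDeg n r) u))
    else 0
  have hg : ‖g‖ ≤ g₀ := by
    refine (pi_norm_le_iff_of_nonneg (by positivity)).mpr fun r => ?_
    simp only [g]
    split_ifs with hlt
    · set j := rowDeg n r with hj
      have h1 : ‖eval ![1, rowDir n r] (tayH K r₀ j u)‖ ≤ 2 ^ j * (A * ω ^ j) := by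
        refine (norm_eval_le (h := 1) (fun i => ?_) _).trans (wnorm_tayH_le hr j (huj j hlt))
        fin_cases i
        · simp
        · simpa using (norm_rowDir n r).le
      have hjn : j ≤ n := hdeg r
      have h2 : ((j ! : ℕ) : ℝ) ≤ n ! := by exact_mod_cast Nat.factorial_le hjn
      have h3 : (2 : ℝ) ^ j ≤ 2 ^ n := pow_le_pow_right₀ (by norm_num) hjn
      rw [norm_mul, norm_mul, norm_pow, norm_inv, hzn, Complex.norm_natCast]
      calc (ω * κ)⁻¹ ^ j * ((j ! : ℕ) * ‖eval ![1, rowDir n r] (tayH K r₀ j u)‖)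
          ≤ (ω * κ)⁻¹ ^ j * ((j ! : ℕ) * (2 ^ j * (A * ω ^ j))) := by gcongr
        _ = κ⁻¹ ^ j * ((j ! : ℕ) * (2 ^ j * A)) := by
            rw [mul_inv, mul_pow, inv_pow, inv_pow]
            field_simp
        _ ≤ κ₀ ^ n * (n ! * (2 ^ n * A)) := by
            gcongr
            exact hκpow j hjn
    · simpa using (by positivity : 0 ≤ g₀)
  obtain ⟨x, hx, hxn⟩ := hsolve (fun r l => z⁻¹ ^ rowDeg n r * W r l) hnear g
  have hrow : ∀ r : Fin (2 * n + 1), rowDeg n r < k →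
      eval ![1, rowDir n r] (tayH K r₀ (rowDeg n r)
        (fun y => u y - ∑ l, x l * basisFun K q ω (τ l) (a l) y)) = 0 := by
    intro r hlt
    have h1 := congrFun hx r
    simp only [Matrix.mulVec, dotProduct, g, if_pos hlt] at h1
    set j := rowDeg n r
    have hj0 : ((j ! : ℕ) : ℂ) ≠ 0 := by exact_mod_cast Nat.factorial_ne_zero j
    rw [tayH_sub_sum hu hr x j (huk.of_le (by exact_mod_cast hlt.le))
      (fun l => by rw [basisFun_eq_wave]; exact (contDiff_wave _ _ _ _).contDiffOn),
      map_sub, map_sum]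
    have h2 : ∀ l, eval ![1, rowDir n r] (C (x l) * tayH K r₀ j (basisFun K q ω (τ l) (a l))) =
        x l * (((j ! : ℕ) : ℂ)⁻¹ * W r l) := fun l => by
      rw [map_mul, eval_C, basisFun_eq_wave, eval_tayH_wave hu hr ω (hall l).1.constant]
    simp only [h2]
    have h3 : z⁻¹ ^ j * ∑ l, x l * W r l =
        z⁻¹ ^ j * ((j ! : ℕ) * eval ![1, rowDir n r] (tayH K r₀ j u)) := by
      rw [← h1, Finset.mul_sum]
      exact Finset.sum_congr rfl fun l _ => by ring
    have h4 := mul_left_cancel₀ (pow_ne_zero j (inv_ne_zero hz0)) h3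
    have h5 : ∑ l, x l * (((j ! : ℕ) : ℂ)⁻¹ * W r l) = ((j ! : ℕ) : ℂ)⁻¹ * ∑ l, x l * W r l := by
      rw [Finset.mul_sum]
      exact Finset.sum_congr rfl fun l _ => by ring
    rw [h5, h4, inv_mul_cancel_left₀ hj0, sub_self]
  have hplus : ∀ j < k, eval ![1, Complex.I] (tayH K r₀ j
      (fun y => u y - ∑ l, x l * basisFun K q ω (τ l) (a l) y)) = 0 := by
    intro j hj
    have h1 : rowDeg n (n + j) = j := by rw [rowDeg]; omega
    have h2 : rowDir n (n + j) = Complex.I := by rw [rowDir, if_pos (by omega)]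
    have := hrow ⟨n + j, by omega⟩ (by simpa [h1] using hj)
    simpa only [h1, h2] using this
  refine ⟨x, fun l => (norm_le_pi_norm x l).trans (hxn.trans (by gcongr)), hplus, ?_⟩
  intro j hj
  -- Order 0 has one row, shared by both directions: the Taylor term is constant there.
  rcases Nat.eq_zero_or_pos j with rfl | hjpos
  · have := hplus 0 hj
    rw [tayH, eval_C] at this ⊢
    exact this
  · have h1 : rowDeg n (n - j) = j := by rw [rowDeg]; omega
    have h2 : rowDir n (n - j) = -Complex.I := by rw [rowDir, if_neg (by omega)]
    have := hrow ⟨n - j, by omega⟩ (by simpa [h1] using hj)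
    simpa only [h1, h2] using this

lemma exists_partialsLE_basisFun (n : ℕ) {B : ℝ} (hB : 0 < B) :
    ∃ N : ℝ, 0 ≤ N ∧ ∀ (ω h : ℝ) (K : Set Plane) (q j : ℕ) (τ : MvPolynomial (Fin 2) ℝ)
      (a : ℕ → MvPolynomial (Fin 2) ℂ), 2 ≤ ω → UniqueDiffOn ℝ K →
      (∀ x ∈ K, dist x (barycenter K) ≤ h) → h ≤ (4 * B)⁻¹ / 2 ^ (n + 1) → 2 ≤ q → j ≤ n + 1 →
      CoeffBound q B τ a → PartialsLE K j (N * ω ^ j) (basisFun K q ω τ a) := by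
  set R : ℝ := (4 * B)⁻¹ with hRdef
  have hR : 0 < R := by positivity
  set Q : ℝ := 2 ^ (n + 1) / R + R⁻¹ * (2 * B) + 1 with hQ
  have hQ1 : 1 ≤ Q := le_add_of_nonneg_left (by positivity)
  refine ⟨Q ^ (n + 1) * (2 * (2 * B)), by positivity, ?_⟩
  intro ω h K q j τ a hω hu hd hh hq hj hco
  have hτn : wnorm R (toComplex τ) ≤ 2 * B := by
    rw [wnorm_map]; exact wnorm_le_of_coeff_le hB hco.phase
  have hamp : wnorm R (amp q ω a) ≤ 2 * (2 * B) := wnorm_amp_le hR.le hω hq (by positivity)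
    fun s hs => wnorm_le_of_coeff_le hB (hco.amplitude s hs)
  have h2 : (2 : ℝ) ^ j ≤ 2 ^ (n + 1) := pow_le_pow_right₀ (by norm_num) hj
  rw [basisFun_eq_wave]
  refine (partialsLE_wave hu hd (G := R⁻¹ * (2 * B)) (by linarith) j hR
    (hh.trans (by gcongr)) (fun i => (wnorm_pderiv_le hR i _).trans (by gcongr)) _).mono ?_
  have h3 : (2 ^ j / R + R⁻¹ * (2 * B)) ^ j ≤ Q ^ (n + 1) := by
    refine (pow_le_pow_left₀ (by positivity) ?_ j).trans (pow_le_pow_right₀ hQ1 hj)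
    calc 2 ^ j / R + R⁻¹ * (2 * B) ≤ 2 ^ (n + 1) / R + R⁻¹ * (2 * B) := by gcongr
      _ ≤ Q := by rw [hQ]; linarith
  calc (2 ^ j / R + R⁻¹ * (2 * B)) ^ j * ω ^ j * wnorm R (amp q ω a)
      ≤ Q ^ (n + 1) * ω ^ j * (2 * (2 * B)) := by gcongr; exact wnorm_nonneg hR.le _
    _ = _ := by ring

/-- There are two regimes. For ωh ≤ δ the error estimate applies to e = u - ∑ x_l w_l. For ωh > δ
the bounds |e| ≤ N and |∂e| ≤ Nω are enough, since (ωh)^j is bounded below. -/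
theorem exists_approximation (n : ℕ) (θ : Fin (2 * n + 1) → ℝ)
    (hθ : Function.Injective fun l => (Real.cos (θ l), Real.sin (θ l)))
    (C₀ ρ μ M : ℝ) (hρ : 0 < ρ) (hμ : 0 < μ) (hM : 0 < M) (A B : ℝ) (hA : 0 < A)
    (hB : 0 < B) :
    ∃ ω₀ D : ℝ, 1 < ω₀ ∧ C₀ ≤ ω₀ ∧ 0 ≤ D ∧
      ∀ (ω h : ℝ) (K : Set Plane) (ξ : Plane → ℝ) (q : ℕ)
        (τ : Fin (2 * n + 1) → MvPolynomial (Fin 2) ℝ)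
        (a : Fin (2 * n + 1) → ℕ → MvPolynomial (Fin 2) ℂ),
        ω₀ ≤ ω → 0 < h → ω * h ≤ C₀ → q = order n ω h → IsElement K h ρ →
        ContDiffOn ℝ ((q + 1 : ℕ) : WithTop ℕ∞) ξ K → (∀ x ∈ K, μ ≤ ξ x) →
        ckNorm K (min (q + 1) n) ξ ≤ ENNReal.ofReal M →
        (∀ l, IsPhase K ξ q (θ l) (τ l) ∧ IsAmplitude q ω (τ l) (a l) ∧
          CoeffBound q B (τ l) (a l)) →
        ∀ k, 3 ≤ k → k ≤ n + 1 → ∀ u : Plane → ℂ, IsStableSolution K ξ ω A k u →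
          ∃ u_p ∈ space K q ω τ a, ∀ x ∈ K, ‖(u - u_p) x‖ ≤ D * (ω * h) ^ k ∧
            ∀ i, ‖pd K i (u - u_p) x‖ ≤ D * (ω ^ k * h ^ (k - 1)) := by
  -- The residual estimate assumes a coefficient bound of at least 1, which makes its radii at most
  -- 1.
  set B₁ : ℝ := max B 1 with hB₁
  have hB₁1 : 1 ≤ B₁ := le_max_right _ _
  have hB₁0 : 0 < B₁ := by linarith
  obtain ⟨ω₁, X₀, hX₀, hcoef⟩ := exists_coefficients n θ hθ hμ hA.le hB₁0
  obtain ⟨Nφ, hNφ, hpart⟩ := exists_partialsLE_basisFun n hB₁0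
  obtain ⟨Dr, hDr, hres⟩ := exists_residual_bound n B₁ M hB₁1 hM.le
  set p : ℝ := ((2 * n + 1 : ℕ) : ℝ) with hp
  set N : ℝ := A + p * X₀ * Nφ with hN
  obtain ⟨De, δ₀, hDe, hδ₀, hδ₀1, herr⟩ := exists_error_bound n (E := p * (X₀ * (Dr * 2))) hρ hM.le
    (show 0 ≤ N by positivity) (by positivity)
  set δ : ℝ := min δ₀ (32 * B₁)⁻¹ with hδdef
  have hδ : 0 < δ := lt_min hδ₀ (by positivity)
  have hδ1 : δ ≤ 1 := (min_le_left _ _).trans hδ₀1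
  set R : ℝ := (4 * B₁)⁻¹ / 2 ^ (n + 1) with hR
  have hR0 : 0 < R := by positivity
  -- From ω ≥ C₀/R and ωh ≤ C₀ follows h ≤ R, so `K` fits into the disc where derivatives of the
  -- basis functions are controlled. The summand with δ^{-(n+1)} serves the regime ωh > δ.
  refine ⟨max (max ω₁ 2) (max C₀ (C₀ / R)), De + N * (δ ^ (n + 1))⁻¹, ?_, ?_, by positivity, ?_⟩
  · exact lt_of_lt_of_le (by norm_num) ((le_max_right ω₁ 2).trans (le_max_left _ _))
  · exact (le_max_left _ _).trans (le_max_right _ _)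
  intro ω h K ξ q τ a hω hh hωh hq hK hξ hμξ hξM hall k hk3 hkn u hu'
  have hω1 : ω₁ ≤ ω := ((le_max_left _ _).trans (le_max_left _ _)).trans hω
  have hω2 : 2 ≤ ω := ((le_max_right ω₁ 2).trans (le_max_left _ _)).trans hω
  have hωR : C₀ / R ≤ ω := ((le_max_right _ _).trans (le_max_right _ _)).trans hω
  have hω0 : 0 < ω := by linarith
  have hhR : h ≤ R := by
    rw [div_le_iff₀ hR0] at hωR
    have : ω * h ≤ ω * R := hωh.trans hωR
    exact le_of_mul_le_mul_left this hω0
  have hq2 : 2 ≤ q := hq ▸ two_le_order n ω h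
  obtain ⟨c, hball, hT⟩ := hK.exists_isTame hh hρ
  have hu := hT.unique
  have hr := hT.base_mem
  have hd : ∀ x ∈ K, dist x (barycenter K) ≤ h := fun x hx => hT.dist_le x hx _ hr
  have hall' : ∀ l, IsPhase K ξ q (θ l) (τ l) ∧ IsAmplitude q ω (τ l) (a l) ∧
      CoeffBound q B₁ (τ l) (a l) := fun l =>
    ⟨(hall l).1, (hall l).2.1, (hall l).2.2.mono hB.le (le_max_left _ _)⟩
  have huP : ∀ j ≤ k, PartialsLE K j (A * ω ^ j) u := fun j hj =>
    partialsLE_of_ckNorm hu le_rfl (by positivity)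
      (hu'.contDiffOn.of_le (by exact_mod_cast hj)) (hu'.stability j hj)
  obtain ⟨x, hxX, hI, hI'⟩ := hcoef ω K ξ q k τ a u hω1 hω2 hu hr (hμξ _ hr) hq2 hkn hall'
    hu'.contDiffOn fun j hj => huP j hj.le
  let w : Fin (2 * n + 1) → Plane → ℂ := fun l => basisFun K q ω (τ l) (a l)
  have hw : ∀ l (j : ℕ), ContDiffOn ℝ (j : WithTop ℕ∞) (w l) K := fun l j => by
    simp only [w]
    rw [basisFun_eq_wave]
    exact (contDiff_wave _ _ _ _).contDiffOn
  let e : Plane → ℂ := fun y => u y - ∑ l, x l * w l y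
  have hsumx : ∑ l, ‖x l‖ ≤ p * X₀ := by
    refine (Finset.sum_le_sum fun l _ => hxX l).trans_eq ?_
    simp [hp]
  have heP : ∀ j ≤ k, PartialsLE K j (N * ω ^ j) e := fun j hj => by
    refine (PartialsLE.sub_sum hu x j (hu'.contDiffOn.of_le (by exact_mod_cast hj))
      (fun l => hw l j) (huP j hj) fun l => hpart ω h K q j (τ l) (a l) hω2 hu hd hhR hq2
        (hj.trans hkn) (hall' l).2.2).mono ?_
    calc A * ω ^ j + (∑ l, ‖x l‖) * (Nφ * ω ^ j) ≤ A * ω ^ j + p * X₀ * (Nφ * ω ^ j) := by gcongr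
      _ = _ := by rw [hN]; ring
  have hek : ContDiffOn ℝ (k : WithTop ℕ∞) e K :=
    hu'.contDiffOn.sub (ContDiffOn.sum fun l _ => contDiffOn_const.mul (hw l k))
  have hmem : (∑ l, x l • w l) ∈ space K q ω τ a :=
    Submodule.sum_mem _ fun l _ => Submodule.smul_mem _ _ (Submodule.subset_span ⟨l, rfl⟩)
  refine ⟨∑ l, x l • w l, hmem, ?_⟩
  have hue : u - ∑ l, x l • w l = e := by
    funext y
    simp [e]
  rw [hue]
  set y := ω * h with hy
  have hy0 : 0 < y := mul_pos hω0 hh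
  rcases le_or_gt y δ with hyδ | hyδ
  · have hy1 : y ≤ 1 := hyδ.trans hδ1
    have hlap : ∀ z ∈ K, ‖pd K 0 (pd K 0 e) z + pd K 1 (pd K 1 e) z‖ ≤
        ω ^ 2 * M * ‖e z‖ + p * (X₀ * (Dr * 2)) * (ω ^ k * h ^ (k - 2)) := by
      intro z hz
      have hu2 : ContDiffOn ℝ 2 u K :=
        hu'.contDiffOn.of_le (by exact_mod_cast (by omega : 2 ≤ k))
      have hdd : ∀ i, pd K i (pd K i e) z =
          pd K i (pd K i u) z - ∑ l, x l * pd K i (pd K i (w l)) z := fun i => by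
        rw [pd_congr (pd_sub_sum hu x (hu2.differentiableOn (by simp))
          (fun l => (hw l 1).differentiableOn (by simp)) i) i hz]
        exact pd_sub_sum hu x
          ((contDiffOn_pd hu (k := 1) hu2 i).differentiableOn (by simp))
          (fun l => (contDiffOn_pd hu (k := 1) (hw l 2) i).differentiableOn (by simp)) i hz
      have hhelm := hu'.helmholtz z hz
      rw [laplacianWithin_eq_pd hu hu2 hz] at hhelm
      -- The equation for `u` replaces Δu by -ω²ξu; adding and subtracting ω²ξw_l leaves the
      -- residuals of the basis functions.
      have hsplit : pd K 0 (pd K 0 e) z + pd K 1 (pd K 1 e) z =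
          -(((ω ^ 2 * ξ z : ℝ) : ℂ) * e z) - ∑ l, x l * (pd K 0 (pd K 0 (w l)) z +
            pd K 1 (pd K 1 (w l)) z + ((ω ^ 2 * ξ z : ℝ) : ℂ) * w l z) := by
        rw [hdd, hdd]
        simp only [e, mul_add, Finset.sum_add_distrib]
        have : ∑ l, x l * (((ω ^ 2 * ξ z : ℝ) : ℂ) * w l z) =
            ((ω ^ 2 * ξ z : ℝ) : ℂ) * ∑ l, x l * w l z := by
          rw [Finset.mul_sum]
          exact Finset.sum_congr rfl fun l _ => by ring
        rw [this]
        linear_combination hhelm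
      have hξz : |ξ z| ≤ M := by
        have := norm_iteratedFDerivWithin_le_of_ckNorm (j := 0) (Nat.zero_le _) hM.le hξM hz
        simpa using this
      have hh2 : h ^ 2 * (ω ^ k * h ^ (k - 2)) = y ^ k := by
        obtain ⟨i, rfl⟩ := Nat.exists_eq_add_of_le' (show 2 ≤ k by omega)
        rw [hy, Nat.add_sub_cancel]
        ring
      have horder : ω ^ 2 * h ^ (min (q + 1) n) + ω * ω⁻¹ ^ (q - 2) * h ^ 3 ≤
          2 * (ω ^ k * h ^ (k - 2)) := by
        have h1 := order_estimate (n := n) (by linarith : 1 < ω) hh hy1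
        rw [← hq, ← hy] at h1
        have h2 : y ^ (n + 1) ≤ y ^ k := pow_le_pow_of_le_one hy0.le hy1 hkn
        refine le_of_mul_le_mul_left ?_ (by positivity : 0 < h ^ 2)
        linarith
      have hresl : ∀ l, ‖pd K 0 (pd K 0 (w l)) z + pd K 1 (pd K 1 (w l)) z +
          ((ω ^ 2 * ξ z : ℝ) : ℂ) * w l z‖ ≤ Dr * 2 * (ω ^ k * h ^ (k - 2)) := fun l => by
        refine (hres ω h K c ξ q (min (q + 1) n) (θ l) (τ l) (a l) hω2 hh
          (hyδ.trans (min_le_right _ _)) hT hq2 (min_le_right _ _) (min_le_left _ _) hξ hξM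
          (hall' l).1 (hall' l).2.1 (hall' l).2.2 z hz).trans ?_
        rw [mul_assoc Dr]
        gcongr
      rw [hsplit]
      refine (norm_sub_le _ _).trans (add_le_add ?_ ?_)
      · rw [norm_neg, norm_mul, Complex.norm_real, Real.norm_eq_abs, abs_mul,
          abs_of_nonneg (sq_nonneg ω)]
        gcongr
      · refine (norm_sum_le _ _).trans ?_
        calc _ ≤ ∑ _l : Fin (2 * n + 1), X₀ * (Dr * 2 * (ω ^ k * h ^ (k - 2))) :=
              Finset.sum_le_sum fun l _ => by
                rw [norm_mul]
                exact mul_le_mul (hxX l) (hresl l) (norm_nonneg _) hX₀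
          _ = _ := by
              rw [Finset.sum_const, Finset.card_univ, Fintype.card_fin, nsmul_eq_mul, hp]
              ring
    intro z hz
    obtain ⟨h1, h2⟩ := herr K h ω (barycenter K) c k e hT hball hK.isCompact hk3 hkn hh hω0
      (hyδ.trans (min_le_left _ _)) hek (heP k le_rfl) hI hI' hlap z hz
    have hle : De ≤ De + N * (δ ^ (n + 1))⁻¹ := le_add_of_nonneg_right (by positivity)
    exact ⟨h1.trans (by gcongr), fun i => (h2 i).trans (by gcongr)⟩
  · have hpow : ∀ j ≤ n + 1, 1 ≤ (δ ^ (n + 1))⁻¹ * y ^ j := fun j hj => by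
      rw [inv_mul_eq_div, one_le_div (by positivity)]
      exact (pow_le_pow_of_le_one hδ.le hδ1 hj).trans (pow_le_pow_left₀ hδ.le hyδ.le j)
    have hN0 : 0 ≤ N := by positivity
    intro z hz
    have h0 : ‖e z‖ ≤ N := by simpa [PartialsLE] using heP 0 (by omega) z hz
    have h1 : ∀ i, ‖pd K i e z‖ ≤ N * ω := fun i => by
      simpa [PartialsLE] using heP 1 (by omega) i z hz
    constructor
    · calc ‖e z‖ ≤ N * 1 := by linarith
        _ ≤ N * ((δ ^ (n + 1))⁻¹ * y ^ k) := by gcongr; exact hpow k hkn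
        _ ≤ _ := by
            have : 0 ≤ De * y ^ k := by positivity
            linarith
    · intro i
      have hyk : y ^ (k - 1) * ω = ω ^ k * h ^ (k - 1) := by
        obtain ⟨i, rfl⟩ := Nat.exists_eq_add_of_le' (show 1 ≤ k by omega)
        rw [hy, Nat.add_sub_cancel]
        ring
      calc ‖pd K i e z‖ ≤ N * (1 * ω) := by rw [one_mul]; exact h1 i
        _ ≤ N * ((δ ^ (n + 1))⁻¹ * y ^ (k - 1) * ω) := by gcongr; exact hpow (k - 1) (by omega)
        _ = N * (δ ^ (n + 1))⁻¹ * (ω ^ k * h ^ (k - 1)) := by rw [← hyk]; ring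
        _ ≤ _ := by
            have : 0 ≤ De * (ω ^ k * h ^ (k - 1)) := by positivity
            linarith

lemma ckNorm_le_of_pd {K : Set Plane} (hu : UniqueDiffOn ℝ K) {e : Plane → ℂ} {l : ℕ} (hl : l ≤ 1)
    {N : ℝ} (h0 : ∀ x ∈ K, ‖e x‖ ≤ N) (h1 : l = 1 → ∀ x ∈ K, ∀ i, 2 * ‖pd K i e x‖ ≤ N) :
    ckNorm K l e ≤ ENNReal.ofReal N := by
  refine iSup₂_le fun j hj => iSup₂_le fun x hx => ?_
  rw [← ofReal_norm]
  refine ENNReal.ofReal_le_ofReal ?_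
  have hj' := Finset.mem_range.mp hj
  obtain rfl | rfl : j = 0 ∨ j = 1 := by omega
  · rw [norm_iteratedFDerivWithin_zero]
    exact h0 x hx
  · rw [norm_iteratedFDerivWithin_one _ (hu x hx)]
    refine (norm_fderivWithin_le_of_pd (N := N / 2) fun i => ?_).trans_eq (by ring)
    linarith [h1 (by omega) x hx i]

end Approximation

theorem exists_ckNorm_approximation (n : ℕ) (hn : 2 ≤ n) (θ : Fin (2 * n + 1) → ℝ)
    (hθ : Function.Injective fun l => (Real.cos (θ l), Real.sin (θ l)))
    (C₀ ρ μ M : ℝ) (hC₀ : 0 < C₀) (hρ : 0 < ρ) (hμ : 0 < μ) (hM : 0 < M) (A B : ℝ) (hA : 0 < A)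
    (hB : 0 < B) :
    ∃ ω₀ C : ℝ, 1 < ω₀ ∧ 0 < C ∧
      ∀ (ω h : ℝ) (K : Set Plane) (ξ : Plane → ℝ) (q : ℕ)
        (τ : Fin (2 * n + 1) → MvPolynomial (Fin 2) ℝ)
        (a : Fin (2 * n + 1) → ℕ → MvPolynomial (Fin 2) ℂ),
        ω₀ ≤ ω → 0 < h → ω * h ≤ C₀ → q = order n ω h → IsElement K h ρ →
        ContDiffOn ℝ ((q + 1 : ℕ) : WithTop ℕ∞) ξ K → (∀ x ∈ K, μ ≤ ξ x) →
        ckNorm K (min (q + 1) n) ξ ≤ ENNReal.ofReal M →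
        (∀ l, IsPhase K ξ q (θ l) (τ l) ∧ IsAmplitude q ω (τ l) (a l) ∧
          CoeffBound q B (τ l) (a l)) →
        (∀ u : Plane → ℂ, IsStableSolution K ξ ω A (n + 1) u →
          ∃ u_p ∈ space K q ω τ a,
            (∀ x ∈ K, ‖u x - u_p x‖ ≤ C * h ^ (n + 1) * ω ^ (n + 1)) ∧
            ∀ k, 3 ≤ k → k ≤ n + 1 → ∀ l ≤ 1,
              ckNorm K l (u - u_p) ≤ ENNReal.ofReal (C * h ^ (k - l) * ω ^ k)) ∧
        (∀ k, 3 ≤ k → k ≤ n + 1 → ∀ u : Plane → ℂ, IsStableSolution K ξ ω A k u →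
          ∃ u_p ∈ space K q ω τ a, ∀ l ≤ 1,
            ckNorm K l (u - u_p) ≤ ENNReal.ofReal (C * h ^ (k - l) * ω ^ k)) := by
  obtain ⟨ω₀, D, hω₀, hCω, hD, happ⟩ := exists_approximation n θ hθ C₀ ρ μ M hρ hμ hM A B hA hB
  have hE : (1 : ℝ) ≤ (1 + C₀) ^ (n + 1) := one_le_pow₀ (by linarith)
  -- The 2 converts partial derivatives into the operator norm, the + 1 makes the constant positive,
  -- and the power of 1 + C₀ absorbs surplus factors ωh when one `u_p`, built for n + 1, serves all
  -- smaller `k`.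
  refine ⟨ω₀, (2 * D + 1) * (1 + C₀) ^ (n + 1), hω₀, by positivity, ?_⟩
  intro ω h K ξ q τ a hω hh hωh hq hK hξ hξμ hξM hτ
  have hω0 : 0 < ω := by linarith
  -- From ωh ≤ C₀ ≤ ω₀ ≤ ω. It is needed because the C¹ norm contains the sup norm, so that h^k must
  -- be bounded by h^{k-1}.
  have hh1 : h ≤ 1 := by
    by_contra hcon
    nlinarith
  obtain ⟨c, -, htame⟩ := hK.exists_isTame hh hρ
  have hu := htame.unique
  -- the bounds of order `m` imply those of lower order
  have key : ∀ k m : ℕ, 3 ≤ k → k ≤ m → m ≤ n + 1 → ∀ e : Plane → ℂ,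
      (∀ x ∈ K, ‖e x‖ ≤ D * (ω * h) ^ m ∧ ∀ i, ‖pd K i e x‖ ≤ D * (ω ^ m * h ^ (m - 1))) →
      ∀ l ≤ 1, ckNorm K l e ≤
        ENNReal.ofReal ((2 * D + 1) * (1 + C₀) ^ (n + 1) * h ^ (k - l) * ω ^ k) := by
    intro k m hk hkm hm e he l hl
    obtain ⟨i, rfl⟩ := Nat.exists_eq_add_of_le hkm
    have hi : (ω * h) ^ i ≤ (1 + C₀) ^ (n + 1) :=
      (pow_le_pow_left₀ (by positivity) (by linarith) i).trans
        (pow_le_pow_right₀ (by linarith) (by omega))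
    have hlow : 2 * D * (h ^ (k - l) * ω ^ k * (ω * h) ^ i) ≤
        (2 * D + 1) * (1 + C₀) ^ (n + 1) * h ^ (k - l) * ω ^ k :=
      calc 2 * D * (h ^ (k - l) * ω ^ k * (ω * h) ^ i)
          ≤ (2 * D + 1) * (h ^ (k - l) * ω ^ k * (1 + C₀) ^ (n + 1)) := by gcongr; linarith
        _ = _ := by ring
    refine ckNorm_le_of_pd hu hl (fun x hx => ?_) fun hl1 x hx j => ?_
    · refine (he x hx).1.trans (le_trans ?_ hlow)
      have hhk : h ^ k ≤ h ^ (k - l) := pow_le_pow_of_le_one hh.le hh1 (by omega)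
      calc D * (ω * h) ^ (k + i) = D * (h ^ k * ω ^ k * (ω * h) ^ i) := by rw [pow_add, mul_pow]; ring
        _ ≤ (2 * D) * (h ^ (k - l) * ω ^ k * (ω * h) ^ i) := by gcongr; linarith
    · subst hl1
      refine le_trans ?_ hlow
      have := (he x hx).2 j
      calc 2 * ‖pd K j e x‖ ≤ 2 * (D * (ω ^ (k + i) * h ^ (k + i - 1))) := by gcongr
        _ = _ := by
            rw [show k + i - 1 = k - 1 + i by omega, pow_add, pow_add, mul_pow]
            ring
  have main := happ ω h K ξ q τ a hω hh hωh hq hK hξ hξμ hξM hτ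
  refine ⟨fun u hsol => ?_, fun k hk hkn u hsol => ?_⟩
  · obtain ⟨u_p, hmem, hup⟩ := main (n + 1) (by omega) le_rfl u hsol
    refine ⟨u_p, hmem, fun x hx => ?_, fun k hk hkn => key k (n + 1) hk hkn le_rfl _ hup⟩
    calc ‖u x - u_p x‖ ≤ D * (ω * h) ^ (n + 1) := (hup x hx).1
      _ = D * 1 * h ^ (n + 1) * ω ^ (n + 1) := by rw [mul_pow]; ring
      _ ≤ _ := by gcongr; linarith
  · obtain ⟨u_p, hmem, hup⟩ := main k hk hkn u hsol
    exact ⟨u_p, hmem, key k k hk le_rfl hkn _ hup⟩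

/-! ### Homogeneous components and bounds at radius one -/

section Homogeneous

variable {𝕜 : Type*} [RCLike 𝕜]

lemma vanish_of_isHomogeneous {j : ℕ} {p : MvPolynomial (Fin 2) 𝕜} (hp : p.IsHomogeneous j) :
    Vanish j p := fun _ hm => hp.coeff_eq_zero hm.ne

lemma Vanish.sub_homogeneousComponent {j : ℕ} {p : MvPolynomial (Fin 2) 𝕜} (hp : Vanish j p) :
    Vanish (j + 1) (p - homogeneousComponent j p) := fun m hm => by
  rw [coeff_sub, coeff_homogeneousComponent]
  split_ifs with h
  · rw [sub_self]
  · rw [hp m (by omega), sub_zero]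

lemma wnorm_homogeneousComponent_le (j : ℕ) (p : MvPolynomial (Fin 2) 𝕜) :
    wnorm 1 (homogeneousComponent j p) ≤ wnorm 1 p := by
  have hs : (homogeneousComponent j p).support ⊆ p.support := fun m hm => by
    rw [mem_support_iff, coeff_homogeneousComponent] at hm
    exact mem_support_iff.mpr fun h => hm (by rw [h, ite_self])
  rw [wnorm_eq_sum hs, wnorm]
  refine Finset.sum_le_sum fun m _ => ?_
  rw [coeff_homogeneousComponent]
  split_ifs <;> simp

lemma vanish_one_sub_C (p : MvPolynomial (Fin 2) 𝕜) : Vanish 1 (p - C (constantCoeff p)) :=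
  fun m hm => by
    obtain rfl : m = 0 := (Finsupp.degree_eq_zero_iff m).mp (by omega)
    simp [constantCoeff_eq]

lemma constantCoeff_eq_zero_of_vanish {j : ℕ} {p : MvPolynomial (Fin 2) 𝕜}
    (hp : Vanish (j + 1) p) : constantCoeff p = 0 := hp 0 (by simp)

lemma wnorm_one_gradDot_le {M N : ℕ} {p r : MvPolynomial (Fin 2) 𝕜} (hp : p.totalDegree ≤ M)
    (hr : r.totalDegree ≤ N) :
    wnorm 1 (gradDot p r) ≤ 2 * M * N * wnorm 1 p * wnorm 1 r := by
  have h0 := wnorm_nonneg zero_le_one p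
  have h1 : ∀ i, wnorm 1 (pderiv i p * pderiv i r) ≤ M * wnorm 1 p * (N * wnorm 1 r) := fun i =>
    (wnorm_mul_le zero_le_one _ _).trans (mul_le_mul (wnorm_one_pderiv_le i hp)
      (wnorm_one_pderiv_le i hr) (wnorm_nonneg zero_le_one _) (by positivity))
  rw [gradDot, Fin.sum_univ_two]
  refine (wnorm_add_le zero_le_one _ _).trans ?_
  linarith [h1 0, h1 1]

lemma wnorm_one_polyLap_le {N : ℕ} {p : MvPolynomial (Fin 2) 𝕜} (hp : p.totalDegree ≤ N) :
    wnorm 1 (polyLap p) ≤ 2 * N * N * wnorm 1 p := by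
  have h1 : ∀ i, wnorm 1 (pderiv i (pderiv i p)) ≤ N * (N * wnorm 1 p) := fun i =>
    (wnorm_one_pderiv_le i (totalDegree_pderiv_le' hp i)).trans
      (mul_le_mul_of_nonneg_left (wnorm_one_pderiv_le i hp) (by positivity))
  rw [polyLap_eq]
  refine (wnorm_add_le zero_le_one _ _).trans ?_
  linarith [h1 0, h1 1]

lemma wnorm_one_transport_le {M N : ℕ} {τ b : MvPolynomial (Fin 2) 𝕜} (hτ : τ.totalDegree ≤ M)
    (hb : b.totalDegree ≤ N) :
    wnorm 1 (transport τ b) ≤ (4 * N * M + 2 * M * M) * wnorm 1 τ * wnorm 1 b := by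
  have h0 := wnorm_nonneg zero_le_one b
  have h1 : wnorm 1 (2 * gradDot b τ) ≤ 2 * (2 * N * M * wnorm 1 b * wnorm 1 τ) := by
    have : (2 : MvPolynomial (Fin 2) 𝕜) = C 2 := (map_ofNat C 2).symm
    rw [this, wnorm_C_mul, RCLike.norm_ofNat]
    exact mul_le_mul_of_nonneg_left (wnorm_one_gradDot_le hb hτ) zero_le_two
  have h2 : wnorm 1 (b * polyLap τ) ≤ wnorm 1 b * (2 * M * M * wnorm 1 τ) :=
    (wnorm_mul_le zero_le_one _ _).trans
      (mul_le_mul_of_nonneg_left (wnorm_one_polyLap_le hτ) h0)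
  refine (wnorm_add_le zero_le_one _ _).trans ?_
  linarith

end Homogeneous

/-! ### Primitives of homogeneous polynomials in a fixed direction -/

section Direction

variable {𝕜 : Type*} [RCLike 𝕜] {c s : 𝕜}

/-- The linear form with coefficients `c` and `s`. -/
def lin (c s : 𝕜) : MvPolynomial (Fin 2) 𝕜 := C c * X 0 + C s * X 1

lemma pderiv_zero_lin (c s : 𝕜) : pderiv 0 (lin c s) = C c := by simp [lin]

lemma pderiv_one_lin (c s : 𝕜) : pderiv 1 (lin c s) = C s := by simp [lin]

lemma isHomogeneous_lin (c s : 𝕜) : (lin c s).IsHomogeneous 1 :=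
  (isHomogeneous_C_mul_X c 0).add (isHomogeneous_C_mul_X s 1)

lemma gradDot_lin (f : MvPolynomial (Fin 2) 𝕜) (c s : 𝕜) :
    gradDot f (lin c s) = C c * pderiv 0 f + C s * pderiv 1 f := by
  rw [gradDot, Fin.sum_univ_two, pderiv_zero_lin, pderiv_one_lin]
  ring

lemma gradDot_lin_self (hcs : c * c + s * s = 1) : gradDot (lin c s) (lin c s) = 1 := by
  rw [gradDot_lin, pderiv_zero_lin, pderiv_one_lin, ← C_mul, ← C_mul, ← C_add, hcs, C_1]

lemma isHomogeneous_gradDot_lin {N : ℕ} {f : MvPolynomial (Fin 2) 𝕜} (hf : f.IsHomogeneous (N + 1))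
    (c s : 𝕜) : (gradDot f (lin c s)).IsHomogeneous N := by
  rw [gradDot_lin]
  exact (hf.pderiv.C_mul c).add (hf.pderiv.C_mul s)

lemma gradDot_mul_left (f g r : MvPolynomial (Fin 2) 𝕜) :
    gradDot (f * g) r = f * gradDot g r + g * gradDot f r := by
  simp only [gradDot, Fin.sum_univ_two, pderiv_mul]
  ring

lemma gradDot_C_mul_left (a : 𝕜) (g r : MvPolynomial (Fin 2) 𝕜) :
    gradDot (C a * g) r = C a * gradDot g r := by
  simp only [gradDot, Fin.sum_univ_two, pderiv_C_mul]
  ring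

lemma gradDot_sub_left (f g r : MvPolynomial (Fin 2) 𝕜) :
    gradDot (f - g) r = gradDot f r - gradDot g r := by
  simp only [gradDot, Fin.sum_univ_two, map_sub]
  ring

lemma gradDot_pow_left (f r : MvPolynomial (Fin 2) 𝕜) (k : ℕ) :
    gradDot (f ^ (k + 1)) r = C ((k : 𝕜) + 1) * (f ^ k * gradDot f r) := by
  simp only [gradDot, Fin.sum_univ_two, pderiv_pow]
  simp
  ring

/-- Integration by parts. Let D be the derivative in direction (c, s) and ℓ = `lin c s`, so that Dℓ
= 1. Then D(ℓ^{k+1} f) = (k + 1) ℓ^k f + ℓ^{k+1} Df, and Df has smaller degree; the power of ℓ is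
there for this induction. The case k = 0 yields primitives. -/
lemma exists_gradDot_lin_eq_pow_mul (hcs : c * c + s * s = 1) (N k : ℕ) :
    ∃ D : ℝ, 0 ≤ D ∧ ∀ f : MvPolynomial (Fin 2) 𝕜, f.IsHomogeneous N →
      ∃ g : MvPolynomial (Fin 2) 𝕜, g.IsHomogeneous (N + k + 1) ∧
        gradDot g (lin c s) = lin c s ^ k * f ∧ wnorm 1 g ≤ D * wnorm 1 f := by
  have hk : ∀ k : ℕ, C ((k : 𝕜) + 1)⁻¹ * C ((k : 𝕜) + 1) = (1 : MvPolynomial (Fin 2) 𝕜) :=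
    fun k => by rw [← C_mul, inv_mul_cancel₀ (by exact_mod_cast Nat.succ_ne_zero k), C_1]
  have hD : ∀ (k : ℕ) (f : MvPolynomial (Fin 2) 𝕜), gradDot (lin c s ^ (k + 1) * f) (lin c s) =
      C ((k : 𝕜) + 1) * (lin c s ^ k * f) + lin c s ^ (k + 1) * gradDot f (lin c s) := fun k f => by
    rw [gradDot_mul_left, gradDot_pow_left, gradDot_lin_self hcs]
    ring
  induction N generalizing k with
  | zero =>
    refine ⟨‖((k : 𝕜) + 1)⁻¹‖ * wnorm 1 (lin c s ^ (k + 1)),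
      mul_nonneg (norm_nonneg _) (wnorm_nonneg zero_le_one _), fun f hf => ?_⟩
    refine ⟨C ((k : 𝕜) + 1)⁻¹ * (lin c s ^ (k + 1) * f), ?_, ?_, ?_⟩
    · have := (((isHomogeneous_lin c s).pow (k + 1)).mul hf).C_mul ((k : 𝕜) + 1)⁻¹
      rwa [show 1 * (k + 1) + 0 = 0 + k + 1 by ring] at this
    · have hf' : gradDot f (lin c s) = 0 := by
        rw [totalDegree_eq_zero_iff_eq_C.mp ((totalDegree_zero_iff_isHomogeneous _).mpr hf),
          gradDot_lin]
        simp
      rw [gradDot_C_mul_left, hD, hf', mul_zero, add_zero, ← mul_assoc, hk, one_mul]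
    · rw [wnorm_C_mul, mul_assoc]
      exact mul_le_mul_of_nonneg_left (wnorm_mul_le zero_le_one _ _) (norm_nonneg _)
  | succ N ih =>
    obtain ⟨D, hD0, hDb⟩ := ih (k + 1)
    have hw := wnorm_nonneg (𝕜 := 𝕜) zero_le_one (lin c s)
    refine ⟨‖((k : 𝕜) + 1)⁻¹‖ * (wnorm 1 (lin c s ^ (k + 1)) +
      D * (2 * (N + 1 : ℕ) * (1 : ℕ) * wnorm 1 (lin c s))),
      mul_nonneg (norm_nonneg _) (add_nonneg (wnorm_nonneg zero_le_one _) (by positivity)),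
      fun f hf => ?_⟩
    obtain ⟨g, hg, hgD, hgb⟩ := hDb _ (isHomogeneous_gradDot_lin hf c s)
    refine ⟨C ((k : 𝕜) + 1)⁻¹ * (lin c s ^ (k + 1) * f - g), ?_, ?_, ?_⟩
    · have h1 := ((isHomogeneous_lin c s).pow (k + 1)).mul hf
      rw [show 1 * (k + 1) + (N + 1) = N + 1 + k + 1 by ring] at h1
      rw [show N + (k + 1) + 1 = N + 1 + k + 1 by ring] at hg
      exact (h1.sub hg).C_mul _
    · rw [gradDot_C_mul_left, gradDot_sub_left, hD, hgD, add_sub_cancel_right, ← mul_assoc, hk,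
        one_mul]
    · have h1 := wnorm_one_gradDot_le hf.totalDegree_le (isHomogeneous_lin c s).totalDegree_le
      rw [wnorm_C_mul, mul_assoc]
      refine mul_le_mul_of_nonneg_left ((wnorm_sub_le zero_le_one _ _).trans ?_) (norm_nonneg _)
      calc _ ≤ wnorm 1 (lin c s ^ (k + 1)) * wnorm 1 f + D * (2 * (N + 1 : ℕ) * (1 : ℕ) *
            wnorm 1 f * wnorm 1 (lin c s)) :=
            add_le_add (wnorm_mul_le zero_le_one _ _)
              (hgb.trans (mul_le_mul_of_nonneg_left h1 hD0))
        _ = _ := by ring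

/-- Every homogeneous polynomial of degree `j` has a primitive in the direction `(c, s)` in the
space `P`, with a bound for its coefficients. -/
def HasPrimitives (c s : 𝕜) (P : Submodule 𝕜 (MvPolynomial (Fin 2) 𝕜)) (j : ℕ) : Prop :=
  ∃ D : ℝ, 0 ≤ D ∧ ∀ f : MvPolynomial (Fin 2) 𝕜, f.IsHomogeneous j →
    ∃ g ∈ P, g.IsHomogeneous (j + 1) ∧ gradDot g (lin c s) = f ∧ wnorm 1 g ≤ D * wnorm 1 f

lemma hasPrimitives_top (hcs : c * c + s * s = 1) (j : ℕ) : HasPrimitives c s ⊤ j := by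
  obtain ⟨D, hD, h⟩ := exists_gradDot_lin_eq_pow_mul hcs j 0
  refine ⟨D, hD, fun f hf => ?_⟩
  obtain ⟨g, hg, hgf, hgb⟩ := h f hf
  exact ⟨g, trivial, hg, by rw [hgf, pow_zero, one_mul], hgb⟩

/-- The harmonic polynomials. -/
def harmonic (𝕜 : Type*) [RCLike 𝕜] : Submodule 𝕜 (MvPolynomial (Fin 2) 𝕜) :=
  LinearMap.ker (∑ i, (pderiv i).toLinearMap ∘ₗ (pderiv i).toLinearMap)

lemma mem_harmonic {p : MvPolynomial (Fin 2) 𝕜} : p ∈ harmonic 𝕜 ↔ polyLap p = 0 := by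
  simp [harmonic, polyLap]

lemma eq_C_of_isHomogeneous_zero {f : MvPolynomial (Fin 2) 𝕜} (hf : f.IsHomogeneous 0) :
    ∃ a, f = C a ∧ ‖a‖ ≤ wnorm 1 f :=
  ⟨_, totalDegree_eq_zero_iff_eq_C.mp ((totalDegree_zero_iff_isHomogeneous _).mpr hf),
    norm_coeff_le_wnorm _ _⟩

lemma eq_lin_of_isHomogeneous_one {f : MvPolynomial (Fin 2) 𝕜} (hf : f.IsHomogeneous 1) :
    ∃ a b, f = C a * X 0 + C b * X 1 ∧ ‖a‖ ≤ wnorm 1 f ∧ ‖b‖ ≤ wnorm 1 f := by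
  obtain ⟨a, ha, hab⟩ := eq_C_of_isHomogeneous_zero (hf.pderiv (i := 0))
  obtain ⟨b, hb, hbb⟩ := eq_C_of_isHomogeneous_zero (hf.pderiv (i := 1))
  have h1 : ∀ i, wnorm 1 (pderiv i f) ≤ wnorm 1 f := fun i => by
    simpa using wnorm_one_pderiv_le i hf.totalDegree_le
  have h2 := hf.sum_X_mul_pderiv
  rw [Fin.sum_univ_two, ha, hb, one_smul] at h2
  exact ⟨a, b, by rw [← h2]; ring, hab.trans (h1 0), hbb.trans (h1 1)⟩

lemma eq_quadratic_of_isHomogeneous_two {f : MvPolynomial (Fin 2) 𝕜} (hf : f.IsHomogeneous 2) :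
    ∃ a b d, f = C a * X 0 ^ 2 + C b * (X 0 * X 1) + C d * X 1 ^ 2 ∧ ‖a‖ ≤ 2 * wnorm 1 f ∧
      ‖b‖ ≤ 2 * wnorm 1 f ∧ ‖d‖ ≤ 2 * wnorm 1 f := by
  obtain ⟨a, b, hab, ha, hb⟩ := eq_lin_of_isHomogeneous_one (hf.pderiv (i := 0))
  obtain ⟨b', d, hbd, hb', hd⟩ := eq_lin_of_isHomogeneous_one (hf.pderiv (i := 1))
  have h1 : ∀ i, wnorm 1 (pderiv i f) ≤ 2 * wnorm 1 f := fun i => by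
    simpa using wnorm_one_pderiv_le i hf.totalDegree_le
  have h2 := hf.sum_X_mul_pderiv
  rw [Fin.sum_univ_two, hab, hbd] at h2
  have h3 : f = C (2⁻¹ : 𝕜) * ((2 : ℕ) • f) := by
    rw [nsmul_eq_mul, ← mul_assoc, ← map_natCast (C : 𝕜 →+* MvPolynomial (Fin 2) 𝕜), ← C_mul]
    simp
  have hhalf : ‖(2⁻¹ : 𝕜)‖ = 2⁻¹ := by simp
  have hw := wnorm_nonneg zero_le_one f
  refine ⟨2⁻¹ * a, 2⁻¹ * (b + b'), 2⁻¹ * d, ?_, ?_, ?_, ?_⟩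
  · conv_lhs => rw [h3, ← h2]
    simp only [C_mul, C_add]
    ring
  · rw [norm_mul, hhalf]; linarith [h1 0]
  · rw [norm_mul, hhalf]; linarith [h1 0, h1 1, norm_add_le b b']
  · rw [norm_mul, hhalf]; linarith [h1 1]

end Direction

/-! ### Transport equations and harmonic solutions -/

section Transport

variable {𝕜 : Type*} [RCLike 𝕜] {c s : 𝕜}

lemma wnorm_C_mul_add_C_mul_le (a b : 𝕜) (p r : MvPolynomial (Fin 2) 𝕜) {N : ℝ} (ha : ‖a‖ ≤ N)
    (hb : ‖b‖ ≤ N) : wnorm 1 (C a * p + C b * r) ≤ (wnorm 1 p + wnorm 1 r) * N := by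
  refine (wnorm_add_le zero_le_one _ _).trans ?_
  rw [wnorm_C_mul, wnorm_C_mul]
  nlinarith [wnorm_nonneg zero_le_one p, wnorm_nonneg zero_le_one r]

lemma C_mem_harmonic (a : 𝕜) : (C a : MvPolynomial (Fin 2) 𝕜) ∈ harmonic 𝕜 := by
  rw [mem_harmonic, polyLap_eq]
  simp

lemma hasPrimitives_harmonic_zero (hcs : c * c + s * s = 1) : HasPrimitives c s (harmonic 𝕜) 0 := by
  refine ⟨wnorm 1 (lin c s), wnorm_nonneg zero_le_one _, fun f hf => ?_⟩
  obtain ⟨a, rfl, ha⟩ := eq_C_of_isHomogeneous_zero hf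
  refine ⟨C a * lin c s, ?_, (isHomogeneous_lin c s).C_mul a, ?_, ?_⟩
  · rw [mem_harmonic, polyLap_eq]
    simp [pderiv_zero_lin, pderiv_one_lin]
  · rw [gradDot_C_mul_left, gradDot_lin_self hcs, mul_one]
  · rw [wnorm_C_mul, mul_comm, wnorm_C]

lemma isHomogeneous_C_mul_add_C_mul {j : ℕ} {p r : MvPolynomial (Fin 2) 𝕜} (hp : p.IsHomogeneous j)
    (hr : r.IsHomogeneous j) (a b : 𝕜) : (C a * p + C b * r).IsHomogeneous j :=
  (hp.C_mul a).add (hr.C_mul b)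

lemma C_mul_add_C_mul_mem_harmonic {p r : MvPolynomial (Fin 2) 𝕜} (hp : p ∈ harmonic 𝕜)
    (hr : r ∈ harmonic 𝕜) (a b : 𝕜) : C a * p + C b * r ∈ harmonic 𝕜 := by
  rw [← smul_eq_C_mul, ← smul_eq_C_mul]
  exact add_mem (Submodule.smul_mem _ a hp) (Submodule.smul_mem _ b hr)

lemma gradDot_C_mul_add_C_mul (a b : 𝕜) (p r t : MvPolynomial (Fin 2) 𝕜) :
    gradDot (C a * p + C b * r) t = C a * gradDot p t + C b * gradDot r t := by
  simp only [gradDot, Fin.sum_univ_two, map_add, pderiv_C_mul]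
  ring

lemma C_mul_self_add (hcs : c * c + s * s = 1) :
    (C c * C c + C s * C s : MvPolynomial (Fin 2) 𝕜) = 1 := by
  rw [← C_mul, ← C_mul, ← C_add, hcs, C_1]

lemma gradDot_quadratic_lin (c s : 𝕜) :
    gradDot (X 0 ^ 2 - X 1 ^ 2) (lin c s) = 2 * (C c * X 0 - C s * X 1) ∧
    gradDot (2 * (X 0 * X 1)) (lin c s) = 2 * (C s * X 0 + C c * X 1) := by
  constructor <;> rw [gradDot_lin] <;> simp [← map_ofNat C 2] <;> ring

lemma gradDot_cubic_lin (c s : 𝕜) :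
    gradDot (X 0 ^ 3 - 3 * (X 0 * X 1 ^ 2)) (lin c s) =
      3 * (C c * (X 0 ^ 2 - X 1 ^ 2) - 2 * C s * (X 0 * X 1)) ∧
    gradDot (3 * (X 0 ^ 2 * X 1) - X 1 ^ 3) (lin c s) =
      3 * (C s * (X 0 ^ 2 - X 1 ^ 2) + 2 * C c * (X 0 * X 1)) := by
  constructor <;> rw [gradDot_lin] <;> simp [← map_ofNat C 3] <;> ring

lemma quadratic_mem_harmonic : (X 0 ^ 2 - X 1 ^ 2 : MvPolynomial (Fin 2) 𝕜) ∈ harmonic 𝕜 ∧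
    (2 * (X 0 * X 1) : MvPolynomial (Fin 2) 𝕜) ∈ harmonic 𝕜 := by
  constructor <;> rw [mem_harmonic, polyLap_eq] <;> simp [← map_ofNat C 2]

lemma cubic_mem_harmonic :
    (X 0 ^ 3 - 3 * (X 0 * X 1 ^ 2) : MvPolynomial (Fin 2) 𝕜) ∈ harmonic 𝕜 ∧
    (3 * (X 0 ^ 2 * X 1) - X 1 ^ 3 : MvPolynomial (Fin 2) 𝕜) ∈ harmonic 𝕜 := by
  have h2 : ∀ i, pderiv i (2 : MvPolynomial (Fin 2) 𝕜) = 0 := fun i => by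
    rw [← map_ofNat C 2, pderiv_C]
  constructor <;> rw [mem_harmonic, polyLap_eq] <;> simp [← map_ofNat C 3, h2] <;> ring

lemma cubic_isHomogeneous :
    (X 0 ^ 3 - 3 * (X 0 * X 1 ^ 2) : MvPolynomial (Fin 2) 𝕜).IsHomogeneous 3 ∧
    (3 * (X 0 ^ 2 * X 1) - X 1 ^ 3 : MvPolynomial (Fin 2) 𝕜).IsHomogeneous 3 := by
  rw [← map_ofNat C 3]
  exact ⟨(isHomogeneous_X_pow 0 3).sub
    (((isHomogeneous_X _ 0).mul (isHomogeneous_X_pow 1 2)).C_mul _),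
    (((isHomogeneous_X_pow 0 2).mul (isHomogeneous_X _ 1)).C_mul _).sub (isHomogeneous_X_pow 1 3)⟩

lemma quadratic_isHomogeneous :
    (X 0 ^ 2 - X 1 ^ 2 : MvPolynomial (Fin 2) 𝕜).IsHomogeneous 2 ∧
    (2 * (X 0 * X 1) : MvPolynomial (Fin 2) 𝕜).IsHomogeneous 2 := by
  rw [← map_ofNat C 2]
  exact ⟨(isHomogeneous_X_pow 0 2).sub (isHomogeneous_X_pow 1 2),
    ((isHomogeneous_X _ 0).mul (isHomogeneous_X _ 1)).C_mul _⟩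

lemma ofNat_mul_C_div {n : ℕ} [n.AtLeastTwo] (a : 𝕜) :
    (OfNat.ofNat n * C (a / OfNat.ofNat n) : MvPolynomial (Fin 2) 𝕜) = C a := by
  rw [← map_ofNat C n, ← C_mul, mul_div_cancel₀ _ (OfNat.ofNat_ne_zero n)]

lemma exists_harmonic_quadratics (hcs : c * c + s * s = 1) :
    ∃ g₁ ∈ harmonic 𝕜, ∃ g₂ ∈ harmonic 𝕜, g₁.IsHomogeneous 2 ∧ g₂.IsHomogeneous 2 ∧
      gradDot g₁ (lin c s) = X 0 ∧ gradDot g₂ (lin c s) = X 1 := by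
  have hp := quadratic_mem_harmonic (𝕜 := 𝕜)
  have hh := quadratic_isHomogeneous (𝕜 := 𝕜)
  refine ⟨_, C_mul_add_C_mul_mem_harmonic hp.1 hp.2 (c / 2) (s / 2), _,
    C_mul_add_C_mul_mem_harmonic hp.1 hp.2 (-s / 2) (c / 2),
    isHomogeneous_C_mul_add_C_mul hh.1 hh.2 _ _, isHomogeneous_C_mul_add_C_mul hh.1 hh.2 _ _, ?_, ?_⟩
  all_goals
    rw [gradDot_C_mul_add_C_mul, (gradDot_quadratic_lin c s).1, (gradDot_quadratic_lin c s).2]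
    have h1 := C_mul_self_add hcs
    have h2 := ofNat_mul_C_div (n := 2) c
    have h3 := ofNat_mul_C_div (n := 2) s
    have h4 := ofNat_mul_C_div (n := 2) (-s)
    rw [C_neg] at h4
  · linear_combination X 0 * h1 + (C c * X 0 - C s * X 1) * h2 + (C s * X 0 + C c * X 1) * h3
  · linear_combination X 1 * h1 + (C c * X 0 - C s * X 1) * h4 + (C s * X 0 + C c * X 1) * h2

lemma exists_harmonic_cubics (hcs : c * c + s * s = 1) :
    ∃ g₁ ∈ harmonic 𝕜, ∃ g₂ ∈ harmonic 𝕜, g₁.IsHomogeneous 3 ∧ g₂.IsHomogeneous 3 ∧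
      gradDot g₁ (lin c s) = X 0 ^ 2 - X 1 ^ 2 ∧ gradDot g₂ (lin c s) = X 0 * X 1 := by
  have hp := cubic_mem_harmonic (𝕜 := 𝕜)
  have hh := cubic_isHomogeneous (𝕜 := 𝕜)
  refine ⟨_, C_mul_add_C_mul_mem_harmonic hp.1 hp.2 (c / 3) (s / 3), _,
    C_mul_add_C_mul_mem_harmonic hp.1 hp.2 (-s / 6) (c / 6),
    isHomogeneous_C_mul_add_C_mul hh.1 hh.2 _ _, isHomogeneous_C_mul_add_C_mul hh.1 hh.2 _ _, ?_, ?_⟩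
  all_goals
    rw [gradDot_C_mul_add_C_mul, (gradDot_cubic_lin c s).1, (gradDot_cubic_lin c s).2]
    have h1 := C_mul_self_add hcs
  · have h2 := ofNat_mul_C_div (n := 3) c
    have h3 := ofNat_mul_C_div (n := 3) s
    linear_combination (X 0 ^ 2 - X 1 ^ 2) * h1 +
      (C c * (X 0 ^ 2 - X 1 ^ 2) - 2 * C s * (X 0 * X 1)) * h2 +
      (C s * (X 0 ^ 2 - X 1 ^ 2) + 2 * C c * (X 0 * X 1)) * h3
  · have h2 := ofNat_mul_C_div (n := 6) c
    have h3 := ofNat_mul_C_div (n := 6) (-s)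
    have h4 : (C (-s / 6) * C c + C (c / 6) * C s : MvPolynomial (Fin 2) 𝕜) = 0 := by
      rw [← C_mul, ← C_mul, ← C_add, ← C_0]
      congr 1
      ring
    rw [C_neg] at h3
    linear_combination X 0 * X 1 * h1 + 3 * (X 0 ^ 2 - X 1 ^ 2) * h4 - C s * (X 0 * X 1) * h3
      + C c * (X 0 * X 1) * h2

lemma hasPrimitives_harmonic_one (hcs : c * c + s * s = 1) : HasPrimitives c s (harmonic 𝕜) 1 := by
  obtain ⟨g₁, h₁, g₂, h₂, hd₁, hd₂, hg₁, hg₂⟩ := exists_harmonic_quadratics hcs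
  refine ⟨wnorm 1 g₁ + wnorm 1 g₂, add_nonneg (wnorm_nonneg zero_le_one _)
    (wnorm_nonneg zero_le_one _), fun f hf => ?_⟩
  obtain ⟨a, b, hfe, ha, hb⟩ := eq_lin_of_isHomogeneous_one hf
  refine ⟨C a * g₁ + C b * g₂, C_mul_add_C_mul_mem_harmonic h₁ h₂ a b,
    isHomogeneous_C_mul_add_C_mul hd₁ hd₂ a b, ?_, wnorm_C_mul_add_C_mul_le a b g₁ g₂ ha hb⟩
  rw [gradDot_C_mul_add_C_mul, hg₁, hg₂, hfe]

/-- Derivatives of harmonic cubics are harmonic, so only quadratics a x² + b xy + d y² with a + d =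
0 have harmonic primitives. Since `lin (-s) c ^ 2` has trace s² + c² = 1, subtracting a + d times it
leaves such a quadratic. -/
lemma exists_harmonic_primitive_two (hcs : c * c + s * s = 1) :
    ∃ D : ℝ, 0 ≤ D ∧ ∀ f : MvPolynomial (Fin 2) 𝕜, f.IsHomogeneous 2 →
      ∃ g ∈ harmonic 𝕜, ∃ e : 𝕜, g.IsHomogeneous 3 ∧
        gradDot g (lin c s) = f - C e * lin (-s) c ^ 2 ∧ wnorm 1 g ≤ D * wnorm 1 f ∧
        ‖e‖ ≤ D * wnorm 1 f := by
  obtain ⟨g₁, h₁, g₂, h₂, hd₁, hd₂, hg₁, hg₂⟩ := exists_harmonic_cubics hcs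
  set E : ℝ := 4 + 4 * ‖s‖ ^ 2 + 8 * ‖s‖ * ‖c‖ with hE
  have hE0 : 0 ≤ E := by positivity
  have w₁ := wnorm_nonneg zero_le_one g₁
  have w₂ := wnorm_nonneg zero_le_one g₂
  refine ⟨(wnorm 1 g₁ + wnorm 1 g₂) * E + E, by positivity, fun f hf => ?_⟩
  obtain ⟨a, b, d, hfe, ha, hb, hd⟩ := eq_quadratic_of_isHomogeneous_two hf
  set w := wnorm 1 f with hw
  have hw0 : 0 ≤ w := wnorm_nonneg zero_le_one f
  have had : ‖a + d‖ ≤ 4 * w := (norm_add_le _ _).trans (by linarith)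
  have hbd₁ : ‖a - (a + d) * (s * s)‖ ≤ E * w := by
    have h1 : ‖(a + d) * (s * s)‖ ≤ 4 * w * ‖s‖ ^ 2 := by
      rw [norm_mul, norm_mul, ← sq]
      gcongr
    have h2 : 0 ≤ ‖s‖ * ‖c‖ * w := by positivity
    rw [hE]
    linarith [norm_sub_le a ((a + d) * (s * s))]
  have hbd₂ : ‖b + 2 * (s * c) * (a + d)‖ ≤ E * w := by
    have h1 : ‖2 * (s * c) * (a + d)‖ ≤ 2 * (‖s‖ * ‖c‖) * (4 * w) := by
      rw [norm_mul, norm_mul, norm_mul, RCLike.norm_ofNat]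
      gcongr
    have h2 : 0 ≤ ‖s‖ ^ 2 * w := by positivity
    rw [hE]
    linarith [norm_add_le b (2 * (s * c) * (a + d))]
  refine ⟨_, C_mul_add_C_mul_mem_harmonic h₁ h₂ (a - (a + d) * (s * s))
    (b + 2 * (s * c) * (a + d)), a + d, isHomogeneous_C_mul_add_C_mul hd₁ hd₂ _ _, ?_, ?_, ?_⟩
  · rw [gradDot_C_mul_add_C_mul, hg₁, hg₂, hfe, lin]
    have h1 := C_mul_self_add hcs
    simp only [C_add, C_sub, C_mul, C_neg, map_ofNat]
    linear_combination (C a + C d) * X 1 ^ 2 * h1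
  · calc _ ≤ (wnorm 1 g₁ + wnorm 1 g₂) * (E * w) := wnorm_C_mul_add_C_mul_le _ _ _ _ hbd₁ hbd₂
      _ ≤ _ := by
        rw [add_mul _ E w, mul_assoc]
        exact le_add_of_nonneg_right (by positivity)
  · refine had.trans ?_
    have h4 : 4 ≤ E := by rw [hE]; linarith [show 0 ≤ 4 * ‖s‖ ^ 2 + 8 * ‖s‖ * ‖c‖ by positivity]
    have h1 : 0 ≤ (wnorm 1 g₁ + wnorm 1 g₂) * E * w := by positivity
    have h2 : 4 * w ≤ E * w := by gcongr
    linarith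

/-- To leading order the transport operator is 2κ times the directional derivative: the nonlinear
part of the phase and the term g Δτ only enter one degree higher. -/
lemma vanish_transport_sub {j : ℕ} {κ : 𝕜} {τ g : MvPolynomial (Fin 2) 𝕜}
    (hτ : Vanish 2 (τ - C κ * lin c s)) (hg : Vanish (j + 1) g) :
    Vanish (j + 1) (transport τ g - C (2 * κ) * gradDot g (lin c s)) := by
  have h1 : transport τ g - C (2 * κ) * gradDot g (lin c s) =
      2 * gradDot g (τ - C κ * lin c s) + g * polyLap τ := by
    simp only [transport, gradDot, Fin.sum_univ_two, map_sub, pderiv_C_mul, C_mul, map_ofNat]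
    ring
  rw [h1]
  exact (Vanish.mul_left 2 (hg.gradDot (j := 1) hτ)).add (hg.mul_right _)

lemma transport_sub (τ a b : MvPolynomial (Fin 2) 𝕜) :
    transport τ (a - b) = transport τ a - transport τ b := by
  simp only [transport, gradDot_sub_left]
  ring

/-- One step in the solution of the transport equation: the correction `g / (2κ)` with
`(c, s) · ∇g` the lowest order terms `r` of the residual replaces them by `e`. -/
lemma vanish_transport_step {j : ℕ} {κ : 𝕜} (hκ : κ ≠ 0) {τ a f g e : MvPolynomial (Fin 2) 𝕜}
    (hτ : Vanish 2 (τ - C κ * lin c s)) (hg : g.IsHomogeneous (j + 1))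
    (ha : Vanish j (transport τ a + f))
    (hge : gradDot g (lin c s) = homogeneousComponent j (transport τ a + f) - e) :
    Vanish (j + 1) (transport τ (a - C (2 * κ)⁻¹ * g) + f - e) := by
  have h1 := vanish_transport_sub hτ (g := C (2 * κ)⁻¹ * g)
    (vanish_of_isHomogeneous (hg.C_mul _))
  have h2 : C (2 * κ) * gradDot (C (2 * κ)⁻¹ * g) (lin c s) = gradDot g (lin c s) := by
    rw [gradDot_C_mul_left, ← mul_assoc, ← C_mul, mul_inv_cancel₀ (by simpa using hκ), C_1, one_mul]
  rw [h2, hge] at h1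
  have h3 := ha.sub_homogeneousComponent.sub h1
  rw [transport_sub]
  convert h3 using 1
  ring

/-- Induction on the degree: a primitive of the lowest terms of the residual corrects them without
disturbing lower degrees. The space `P` is everything for ordinary amplitudes and the harmonic
polynomials for the last one. -/
lemma exists_transport_solution (P : Submodule 𝕜 (MvPolynomial (Fin 2) 𝕜)) (hP : ∀ a, C a ∈ P)
    (M N : ℕ) (hprim : ∀ j < N, HasPrimitives c s P j) {κ₀ : ℝ} (hκ₀ : 0 < κ₀) {B₀ : ℝ}
    (hB₀ : 0 ≤ B₀) :
    ∃ B : ℝ, 0 ≤ B ∧ ∀ (τ f : MvPolynomial (Fin 2) 𝕜) (κ c₀ : 𝕜), κ₀ ≤ ‖κ‖ →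
      τ.totalDegree ≤ M → Vanish 2 (τ - C κ * lin c s) → wnorm 1 τ ≤ B₀ → wnorm 1 f ≤ B₀ →
      ‖c₀‖ ≤ B₀ → ∃ a ∈ P, a.totalDegree ≤ N ∧ constantCoeff a = c₀ ∧
        Vanish N (transport τ a + f) ∧ wnorm 1 a ≤ B := by
  induction N with
  | zero =>
    refine ⟨B₀, hB₀, fun τ f κ c₀ _ _ _ _ _ hc₀ => ⟨C c₀, hP c₀, by simp, by simp,
      Vanish.of_zero _, by rwa [wnorm_C]⟩⟩
  | succ N ih =>
    obtain ⟨B, hB, hsol⟩ := ih fun j hj => hprim j (by omega)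
    obtain ⟨D, hD, hD'⟩ := hprim N (by omega)
    refine ⟨B + (2 * κ₀)⁻¹ * (D * ((4 * N * M + 2 * M * M) * B₀ * B + B₀)), by positivity, ?_⟩
    intro τ f κ c₀ hκ hτM hτ hτB hfB hc₀
    obtain ⟨a, haP, haN, hac, hav, haB⟩ := hsol τ f κ c₀ hκ hτM hτ hτB hfB hc₀
    obtain ⟨g, hgP, hg, hgD, hgB⟩ := hD' (homogeneousComponent N (transport τ a + f))
      (homogeneousComponent_isHomogeneous _ _)
    have hκ0 : κ ≠ 0 := norm_pos_iff.mp (hκ₀.trans_le hκ)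
    have hres : wnorm 1 (homogeneousComponent N (transport τ a + f)) ≤
        (4 * N * M + 2 * M * M) * B₀ * B + B₀ := by
      refine (wnorm_homogeneousComponent_le _ _).trans ((wnorm_add_le zero_le_one _ _).trans
        (add_le_add ((wnorm_one_transport_le hτM haN).trans ?_) hfB))
      have := wnorm_nonneg zero_le_one a
      gcongr
    refine ⟨a - C (2 * κ)⁻¹ * g, P.sub_mem haP ?_, ?_, ?_, ?_, ?_⟩
    · rw [← smul_eq_C_mul]
      exact P.smul_mem _ hgP
    · exact (totalDegree_sub _ _).trans (max_le (by omega) (hg.C_mul _).totalDegree_le)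
    · rw [map_sub, constantCoeff_eq_zero_of_vanish (vanish_of_isHomogeneous (hg.C_mul _)), sub_zero,
        hac]
    · simpa using vanish_transport_step hκ0 hτ hg hav (e := 0) (by rw [hgD, sub_zero])
    · refine (wnorm_sub_le zero_le_one _ _).trans (add_le_add haB ?_)
      rw [wnorm_C_mul, norm_inv, norm_mul, RCLike.norm_ofNat]
      have := wnorm_nonneg zero_le_one g
      gcongr
      exact hgB.trans (mul_le_mul_of_nonneg_left hres hD)

/-- Degrees 0 and 1 of the residual are removed by harmonic corrections. In degree 2 the obstruction
`e` survives, to be compensated elsewhere. -/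
lemma exists_harmonic_transport_solution (hcs : c * c + s * s = 1) (M : ℕ) {κ₀ : ℝ} (hκ₀ : 0 < κ₀)
    {B₀ : ℝ} (hB₀ : 0 ≤ B₀) :
    ∃ B : ℝ, 0 ≤ B ∧ ∀ (τ f : MvPolynomial (Fin 2) 𝕜) (κ c₀ : 𝕜), κ₀ ≤ ‖κ‖ →
      τ.totalDegree ≤ M → Vanish 2 (τ - C κ * lin c s) → wnorm 1 τ ≤ B₀ → wnorm 1 f ≤ B₀ →
      ‖c₀‖ ≤ B₀ → ∃ (a : MvPolynomial (Fin 2) 𝕜) (e : 𝕜), polyLap a = 0 ∧ a.totalDegree ≤ 3 ∧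
        constantCoeff a = c₀ ∧ Vanish 3 (transport τ a + f - C e * lin (-s) c ^ 2) ∧
        wnorm 1 a ≤ B ∧ ‖e‖ ≤ B := by
  obtain ⟨B, hB, hsol⟩ := exists_transport_solution (harmonic 𝕜) C_mem_harmonic M 2
    (fun j hj => by
      obtain rfl | rfl : j = 0 ∨ j = 1 := by omega
      exacts [hasPrimitives_harmonic_zero hcs, hasPrimitives_harmonic_one hcs]) hκ₀ hB₀
  obtain ⟨D, hD, hD'⟩ := exists_harmonic_primitive_two hcs
  set G : ℝ := (4 * (2 : ℕ) * M + 2 * M * M) * B₀ * B + B₀ with hG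
  have hG0 : 0 ≤ G := by positivity
  refine ⟨B + (2 * κ₀)⁻¹ * (D * G) + D * G, by positivity, ?_⟩
  intro τ f κ c₀ hκ hτM hτ hτB hfB hc₀
  obtain ⟨a, haP, haN, hac, hav, haB⟩ := hsol τ f κ c₀ hκ hτM hτ hτB hfB hc₀
  obtain ⟨g, hgP, e, hg, hgD, hgB, heB⟩ := hD' (homogeneousComponent 2 (transport τ a + f))
    (homogeneousComponent_isHomogeneous _ _)
  have hκ0 : κ ≠ 0 := norm_pos_iff.mp (hκ₀.trans_le hκ)
  have hres : wnorm 1 (homogeneousComponent 2 (transport τ a + f)) ≤ G := by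
    refine (wnorm_homogeneousComponent_le _ _).trans ((wnorm_add_le zero_le_one _ _).trans
      (add_le_add ((wnorm_one_transport_le hτM haN).trans ?_) hfB))
    have := wnorm_nonneg zero_le_one a
    gcongr
  refine ⟨a - C (2 * κ)⁻¹ * g, e, ?_, ?_, ?_, vanish_transport_step hκ0 hτ hg hav hgD, ?_, ?_⟩
  · rw [← mem_harmonic, ← smul_eq_C_mul]
    exact Submodule.sub_mem _ haP (Submodule.smul_mem _ _ hgP)
  · exact (totalDegree_sub _ _).trans (max_le (by omega) (hg.C_mul _).totalDegree_le)
  · rw [map_sub, constantCoeff_eq_zero_of_vanish (vanish_of_isHomogeneous (hg.C_mul _)), sub_zero,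
      hac]
  · have h1 : wnorm 1 (C (2 * κ)⁻¹ * g) ≤ (2 * κ₀)⁻¹ * (D * G) := by
      rw [wnorm_C_mul, norm_inv, norm_mul, RCLike.norm_ofNat]
      have := wnorm_nonneg zero_le_one g
      gcongr
      exact hgB.trans (mul_le_mul_of_nonneg_left hres hD)
    have h2 : 0 ≤ D * G := by positivity
    linarith [wnorm_sub_le zero_le_one a (C (2 * κ)⁻¹ * g)]
  · have h1 := heB.trans (mul_le_mul_of_nonneg_left hres hD)
    have h2 : 0 ≤ (2 * κ₀)⁻¹ * (D * G) := by positivity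
    linarith

end Transport

/-! ### The eikonal equation and the quartic correction -/

section Existence

variable {𝕜 : Type*} [RCLike 𝕜] {c s : 𝕜}

lemma totalDegree_C_mul_lin_le (κ c s : 𝕜) : (C κ * lin c s).totalDegree ≤ 1 :=
  ((isHomogeneous_lin c s).C_mul κ).totalDegree_le

/-- A homogeneous correction of degree N + 2 changes |∇τ|² to leading order by 2κ times its
directional derivative. Its square and its product with the nonlinear part of the phase only affect
higher degrees, so each step is a linear problem. -/
lemma exists_eikonal_solution (hcs : c * c + s * s = 1) (N : ℕ) {κ₀ : ℝ} (hκ₀ : 0 < κ₀) {B₀ : ℝ}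
    (hB₀ : 0 ≤ B₀) :
    ∃ B : ℝ, 0 ≤ B ∧ ∀ (T : MvPolynomial (Fin 2) 𝕜) (κ : 𝕜), κ₀ ≤ ‖κ‖ → ‖κ‖ ≤ B₀ →
      wnorm 1 T ≤ B₀ → constantCoeff T = κ * κ → ∃ τ : MvPolynomial (Fin 2) 𝕜,
        τ.totalDegree ≤ N + 1 ∧ Vanish 2 (τ - C κ * lin c s) ∧
        Vanish (N + 1) (gradDot τ τ - T) ∧ wnorm 1 τ ≤ B := by
  induction N with
  | zero =>
    refine ⟨B₀ * wnorm 1 (lin c s), mul_nonneg hB₀ (wnorm_nonneg zero_le_one _),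
      fun T κ _ hκ _ hT => ?_⟩
    refine ⟨C κ * lin c s, totalDegree_C_mul_lin_le κ c s, by rw [sub_self]; exact Vanish.zero _,
      ?_, ?_⟩
    · have h1 : gradDot (C κ * lin c s) (C κ * lin c s) = C (constantCoeff T) := by
        have h2 : gradDot (C κ * lin c s) (C κ * lin c s) =
            C κ * C κ * gradDot (lin c s) (lin c s) := by
          simp only [gradDot, Fin.sum_univ_two, pderiv_C_mul]
          ring
        rw [h2, gradDot_lin_self hcs, mul_one, ← C_mul, hT]
      rw [h1, ← neg_sub]
      exact (vanish_one_sub_C T).neg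
    · rw [wnorm_C_mul]
      exact mul_le_mul_of_nonneg_right hκ (wnorm_nonneg zero_le_one _)
  | succ N ih =>
    obtain ⟨B, hB, hsol⟩ := ih
    obtain ⟨D, hD, hD'⟩ := hasPrimitives_top hcs (N + 1)
    refine ⟨B + (2 * κ₀)⁻¹ * (D * (2 * (N + 1 : ℕ) * (N + 1 : ℕ) * B * B + B₀)), by positivity, ?_⟩
    intro T κ hκ hκB hTB hT
    obtain ⟨τ, hτN, hτ, hτv, hτB⟩ := hsol T κ hκ hκB hTB hT
    obtain ⟨g, -, hg, hgD, hgB⟩ := hD' (homogeneousComponent (N + 1) (gradDot τ τ - T))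
      (homogeneousComponent_isHomogeneous _ _)
    have hκ0 : κ ≠ 0 := norm_pos_iff.mp (hκ₀.trans_le hκ)
    have hres : wnorm 1 (homogeneousComponent (N + 1) (gradDot τ τ - T)) ≤
        2 * (N + 1 : ℕ) * (N + 1 : ℕ) * B * B + B₀ := by
      refine (wnorm_homogeneousComponent_le _ _).trans ((wnorm_sub_le zero_le_one _ _).trans
        (add_le_add ((wnorm_one_gradDot_le hτN hτN).trans ?_) hTB))
      have := wnorm_nonneg zero_le_one τ
      gcongr
    set g' := C (2 * κ)⁻¹ * g with hg'
    have hg'h : g'.IsHomogeneous (N + 1 + 1) := hg.C_mul _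
    have hg'v : Vanish (N + 1 + 1) g' := vanish_of_isHomogeneous hg'h
    refine ⟨τ - g', ?_, ?_, ?_, ?_⟩
    · exact (totalDegree_sub _ _).trans (max_le (by omega) hg'h.totalDegree_le)
    · rw [sub_right_comm]
      exact hτ.sub (hg'v.mono (by omega))
    · have h2 : C (2 * κ) * gradDot g' (lin c s) = homogeneousComponent (N + 1) (gradDot τ τ - T) := by
        rw [hg', gradDot_C_mul_left, ← mul_assoc, ← C_mul, mul_inv_cancel₀ (by simpa using hκ0), C_1,
          one_mul, hgD]
      have h3 : gradDot (τ - g') (τ - g') - T =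
          (gradDot τ τ - T - homogeneousComponent (N + 1) (gradDot τ τ - T)) -
            2 * gradDot g' (τ - C κ * lin c s) + gradDot g' g' := by
        rw [← h2]
        simp only [gradDot, Fin.sum_univ_two, map_sub, pderiv_C_mul, C_mul, map_ofNat]
        ring
      rw [h3]
      exact (hτv.sub_homogeneousComponent.sub (Vanish.mul_left 2 (hg'v.gradDot (j := 1) hτ))).add
        ((hg'v.gradDot hg'v).mono (by omega))
    · refine (wnorm_sub_le zero_le_one _ _).trans (add_le_add hτB ?_)
      rw [hg', wnorm_C_mul, norm_inv, norm_mul, RCLike.norm_ofNat]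
      have := wnorm_nonneg zero_le_one g
      gcongr
      exact hgB.trans (mul_le_mul_of_nonneg_left hres hD)

lemma gradDot_lin_orthogonal (c s : 𝕜) : gradDot (lin (-s) c) (lin c s) = 0 := by
  rw [gradDot_lin, pderiv_zero_lin, pderiv_one_lin, C_neg]
  ring

lemma gradDot_lin_pow_four (c s : 𝕜) : gradDot (lin (-s) c ^ 4) (lin c s) = 0 := by
  rw [gradDot_pow_left, gradDot_lin_orthogonal, mul_zero, mul_zero]

lemma polyLap_lin_pow_four (hcs : c * c + s * s = 1) :
    polyLap (lin (-s) c ^ 4) = C 12 * lin (-s) c ^ 2 := by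
  have h2 : ∀ i, pderiv i (4 : MvPolynomial (Fin 2) 𝕜) = 0 := fun i => by
    rw [← map_ofNat C 4, pderiv_C]
  have h3 := C_mul_self_add hcs
  rw [polyLap_eq, map_ofNat]
  simp only [pderiv_pow, pderiv_mul, pderiv_zero_lin, pderiv_one_lin, pderiv_C, Nat.cast_ofNat, h2,
    C_neg]
  simp only [Nat.reduceSub, map_neg, pderiv_C, Nat.cast_ofNat]
  linear_combination 12 * lin (-s) c ^ 2 * h3

lemma isHomogeneous_C_mul_lin_pow (t c s : 𝕜) (k : ℕ) : (C t * lin c s ^ k).IsHomogeneous k := by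
  simpa using ((isHomogeneous_lin c s).pow k).C_mul t

lemma polyLap_sub (p r : MvPolynomial (Fin 2) 𝕜) : polyLap (p - r) = polyLap p - polyLap r := by
  simp only [polyLap_eq, map_sub]
  ring

lemma polyLap_add (p r : MvPolynomial (Fin 2) 𝕜) : polyLap (p + r) = polyLap p + polyLap r := by
  simp only [polyLap_eq, map_add]
  ring

lemma polyLap_C_mul (a : 𝕜) (p : MvPolynomial (Fin 2) 𝕜) : polyLap (C a * p) = C a * polyLap p := by
  simp only [polyLap_eq, pderiv_C_mul]
  ring

/-- A quartic term in the phase changes the terms of second order in the transport equation. -/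
lemma vanish_transport_add_quartic (hcs : c * c + s * s = 1) (e : 𝕜) {τ a : MvPolynomial (Fin 2) 𝕜}
    (ha : constantCoeff a = 1) (hv : Vanish 3 (transport τ a - C e * lin (-s) c ^ 2)) :
    Vanish 3 (transport (τ + C (-(e / 12)) * lin (-s) c ^ 4) a) := by
  set Z := C (-(e / 12)) * lin (-s) c ^ 4 with hZ
  have hZv : Vanish 4 Z := vanish_of_isHomogeneous (isHomogeneous_C_mul_lin_pow _ _ _ 4)
  have h1 : polyLap Z = -(C e * lin (-s) c ^ 2) := by
    rw [hZ, polyLap_C_mul, polyLap_lin_pow_four hcs, ← mul_assoc, ← C_mul, ← neg_mul, ← C_neg]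
    congr 2
    ring
  have h2 : transport (τ + Z) a = (transport τ a - C e * lin (-s) c ^ 2) + 2 * gradDot a Z +
      (a - C (constantCoeff a)) * polyLap Z := by
    rw [transport, transport, polyLap_add, h1, ha, C_1]
    simp only [gradDot, Fin.sum_univ_two, map_add]
    ring
  rw [h2]
  refine (hv.add (Vanish.mul_left 2 (Vanish.sum fun k _ => ?_))).add
    ((vanish_one_sub_C a).mul (j := 2) ?_)
  · exact Vanish.mul_left _ (hZv.pderiv k)
  · exact Vanish.polyLap hZv

end Existence

/-! ### Amplitudes with harmonic last component -/

section Amplitude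

/-- The constant terms 1, 0, 0, … make the amplitude equal to 1 at the barycenter for every ω at
once, which keeps the components independent of ω. -/
lemma exists_hierarchy_solution {c s : ℂ} (hcs : c * c + s * s = 1) (M N S : ℕ) {κ₀ : ℝ}
    (hκ₀ : 0 < κ₀) {B₀ : ℝ} (hB₀ : 0 ≤ B₀) :
    ∃ B : ℝ, 0 ≤ B ∧ ∀ (τ : MvPolynomial (Fin 2) ℂ) (κ : ℂ), κ₀ ≤ ‖κ‖ → τ.totalDegree ≤ M →
      Vanish 2 (τ - C κ * lin c s) → wnorm 1 τ ≤ B₀ → ∃ a : ℕ → MvPolynomial (Fin 2) ℂ,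
        ∀ k ≤ S, (a k).totalDegree ≤ N - k ∧ constantCoeff (a k) = (if k = 0 then 1 else 0) ∧
          Vanish (N - k) (hierarchy τ a k) ∧ wnorm 1 (a k) ≤ B := by
  induction S with
  | zero =>
    obtain ⟨B, hB, hsol⟩ := exists_transport_solution (c := c) (s := s) ⊤ (fun _ => trivial) M N
      (fun j _ => hasPrimitives_top hcs j) hκ₀ (B₀ := max B₀ 1) (by positivity)
    refine ⟨B, hB, fun τ κ hκ hτM hτ hτB => ?_⟩
    obtain ⟨a, -, haN, hac, hav, haB⟩ := hsol τ 0 κ 1 hκ hτM hτ (hτB.trans (le_max_left _ _))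
      (by rw [wnorm_zero]; positivity) (by simp)
    refine ⟨fun _ => a, fun k hk => ?_⟩
    obtain rfl : k = 0 := by omega
    exact ⟨haN, by simpa using hac, by simpa [hierarchy] using hav, haB⟩
  | succ S ih =>
    obtain ⟨B, hB, hsol⟩ := ih
    obtain ⟨B', hB', hsol'⟩ := exists_transport_solution (c := c) (s := s) ⊤ (fun _ => trivial) M
      (N - (S + 1)) (fun j _ => hasPrimitives_top hcs j) hκ₀
      -- The second entry bounds the Laplacian of the preceding component, which is the source term
      -- of the new equation.
      (B₀ := max B₀ (2 * (N - S : ℕ) * (N - S : ℕ) * B)) (by positivity)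
    refine ⟨max B B', by positivity, fun τ κ hκ hτM hτ hτB => ?_⟩
    obtain ⟨a, ha⟩ := hsol τ κ hκ hτM hτ hτB
    have hlap : wnorm 1 (polyLap (a S)) ≤ 2 * (N - S : ℕ) * (N - S : ℕ) * B :=
      (wnorm_one_polyLap_le (ha S le_rfl).1).trans
        (mul_le_mul_of_nonneg_left (ha S le_rfl).2.2.2 (by positivity))
    obtain ⟨b, -, hbN, hbc, hbv, hbB⟩ := hsol' τ (polyLap (a S)) κ 0 hκ hτM hτ
      (hτB.trans (le_max_left _ _)) (hlap.trans (le_max_right _ _)) (by simp [hB₀])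
    have hup : ∀ k ≤ S, Function.update a (S + 1) b k = a k := fun k hk =>
      Function.update_of_ne (by omega) _ _
    refine ⟨Function.update a (S + 1) b, fun k hk => ?_⟩
    rcases Nat.lt_or_eq_of_le hk with hlt | rfl
    · have hkS : k ≤ S := by omega
      have hh : hierarchy τ (Function.update a (S + 1) b) k = hierarchy τ a k := by
        cases k with
        | zero => simp only [hierarchy, hup 0 hkS]
        | succ k => simp only [hierarchy, hup (k + 1) hkS, hup k (by omega)]
      rw [hup k hkS, hh]
      obtain ⟨h1, h2, h3, h4⟩ := ha k hkS
      exact ⟨h1, h2, h3, h4.trans (le_max_left _ _)⟩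
    · rw [Function.update_self]
      refine ⟨hbN, by simpa using hbc, ?_, hbB.trans (le_max_right _ _)⟩
      simpa only [hierarchy, Function.update_self, hup S le_rfl] using hbv

lemma isAmplitude_of_hierarchy {q : ℕ} (hq : 2 ≤ q) {τ : MvPolynomial (Fin 2) ℝ}
    {a : ℕ → MvPolynomial (Fin 2) ℂ} (hdeg : ∀ s ≤ q - 2, (a s).totalDegree ≤ q + 1 - s)
    (hconst : ∀ s ≤ q - 2, constantCoeff (a s) = if s = 0 then 1 else 0)
    (hv : ∀ s ≤ q - 2, Vanish (q + 1 - s) (hierarchy (toComplex τ) a s))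
    (hlast : polyLap (a (q - 2)) = 0) (ω : ℝ) : IsAmplitude q ω τ a where
  degree_le := hdeg
  transport_zero := hv 0 (by omega)
  transport_succ s hs := hv (s + 1) hs
  harmonic_last := hlast
  normalized := by
    rw [Finset.sum_eq_single 0]
    · simp [hconst 0 (by omega)]
    · intro s hs hs0
      have := Finset.mem_range.mp hs
      rw [hconst s (by omega), if_neg hs0, mul_zero]
    · intro h
      exact absurd (Finset.mem_range.mpr (by omega)) h

lemma Vanish.toComplex {j : ℕ} {p : MvPolynomial (Fin 2) ℝ} (hp : Vanish j p) :
    Vanish j (toComplex p) := fun m hm => by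
  rw [GOPW.toComplex, coeff_map, hp m hm, map_zero]

lemma toComplex_gradDot (p r : MvPolynomial (Fin 2) ℝ) :
    toComplex (gradDot p r) = gradDot (toComplex p) (toComplex r) := by
  simp [toComplex, gradDot, pderiv_map]

lemma toComplex_polyLap (p : MvPolynomial (Fin 2) ℝ) :
    toComplex (polyLap p) = polyLap (toComplex p) := by
  simp [toComplex, polyLap, pderiv_map]

lemma toComplex_transport (τ a : MvPolynomial (Fin 2) ℝ) :
    toComplex (transport τ a) = transport (toComplex τ) (toComplex a) := by
  rw [transport, transport, ← toComplex_gradDot, ← toComplex_polyLap]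
  simp [toComplex]

lemma toComplex_lin (c s : ℝ) : toComplex (lin c s) = lin (c : ℂ) (s : ℂ) := by
  simp [toComplex, lin]

lemma totalDegree_toComplex_le (p : MvPolynomial (Fin 2) ℝ) :
    (toComplex p).totalDegree ≤ p.totalDegree :=
  Finset.sup_mono (support_map_subset _ _)

/-- For `q = 2` the amplitude is a single harmonic polynomial; a quartic term in the phase makes the
transport equation solvable. -/
lemma exists_amplitude_two {c s : ℝ} (hcs : c * c + s * s = 1) {κ₀ : ℝ} (hκ₀ : 0 < κ₀) (B₀ : ℝ) :
    ∃ B : ℝ, 0 ≤ B ∧ ∀ (τ : MvPolynomial (Fin 2) ℝ) (κ : ℝ), κ₀ ≤ κ → τ.totalDegree ≤ 4 →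
      Vanish 2 (τ - C κ * lin c s) → wnorm 1 τ ≤ B₀ →
      ∃ (t : ℝ) (a : ℕ → MvPolynomial (Fin 2) ℂ), |t| ≤ B ∧
        (∀ ω : ℝ, IsAmplitude 2 ω (τ + C t * lin (-s) c ^ 4) a) ∧ ∀ k ≤ 2 - 2, wnorm 1 (a k) ≤ B := by
  obtain ⟨B, hB, hsol⟩ := exists_harmonic_transport_solution hcs 4 hκ₀ (B₀ := max B₀ 1)
    (by positivity)
  refine ⟨B, hB, fun τ κ hκ hτM hτ hτB => ?_⟩
  obtain ⟨a, e, hlap, hdeg, hac, hav, haB, heB⟩ := hsol τ 0 κ 1 (hκ.trans (le_abs_self κ)) hτM hτ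
    (hτB.trans (le_max_left _ _)) (by rw [wnorm_zero]; positivity) (by simp)
  rw [add_zero] at hav
  refine ⟨-(e / 12), fun _ => toComplex a, ?_, fun ω => ?_, fun k _ => by rwa [wnorm_map]⟩
  · rw [abs_neg, abs_div, abs_of_pos (show (0 : ℝ) < 12 by norm_num)]
    rw [Real.norm_eq_abs] at heB
    linarith [abs_nonneg e]
  · refine isAmplitude_of_hierarchy le_rfl (fun k hk => ?_) (fun k hk => ?_) (fun k hk => ?_) ?_ ω
    · have := totalDegree_toComplex_le a
      omega
    · obtain rfl : k = 0 := by omega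
      rw [toComplex, constantCoeff_map, hac]
      simp
    · obtain rfl : k = 0 := by omega
      have := (vanish_transport_add_quartic hcs e hac hav).toComplex
      rwa [toComplex_transport] at this
    · rw [← toComplex_polyLap, hlap, toComplex, map_zero]

/-- With q = j + 3 the last component has index j + 1 and leaves the defect e Y². Subtracting Z =
(e/12) Y⁴ from component j changes its Laplacian by exactly -e Y². The equation of component j holds
up to degree 3 only, and the transport of Z vanishes to order 4 since Y⁴ is constant in the
direction of the phase. -/
lemma exists_amplitude_of_two_lt {c s : ℝ} (hcs : c * c + s * s = 1) {q : ℕ} (hq : 2 < q) {κ₀ : ℝ}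
    (hκ₀ : 0 < κ₀) {B₀ : ℝ} (hB₀ : 0 ≤ B₀) :
    ∃ B : ℝ, 0 ≤ B ∧ ∀ (τ : MvPolynomial (Fin 2) ℝ) (κ : ℝ), κ₀ ≤ κ → τ.totalDegree ≤ q + 2 →
      Vanish 2 (τ - C κ * lin c s) → wnorm 1 τ ≤ B₀ →
      ∃ a : ℕ → MvPolynomial (Fin 2) ℂ, (∀ ω : ℝ, IsAmplitude q ω τ a) ∧
        ∀ k ≤ q - 2, wnorm 1 (a k) ≤ B := by
  obtain ⟨j, rfl⟩ := Nat.exists_eq_add_of_le' (show 3 ≤ q from hq)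
  have hcs' : (c : ℂ) * c + s * s = 1 := by exact_mod_cast hcs
  obtain ⟨B₁, hB₁, hsol₁⟩ := exists_hierarchy_solution hcs' (j + 3 + 2) (j + 4) j hκ₀ hB₀
  obtain ⟨B₂, hB₂, hsol₂⟩ := exists_harmonic_transport_solution hcs' (j + 3 + 2) hκ₀
    (B₀ := max B₀ (2 * (4 : ℕ) * (4 : ℕ) * B₁)) (by positivity)
  set Y : MvPolynomial (Fin 2) ℂ := lin (-(s : ℂ)) (c : ℂ) with hY
  have hwY := wnorm_nonneg zero_le_one (Y ^ 4)
  refine ⟨B₁ + B₂ + B₂ * wnorm 1 (Y ^ 4), by positivity, fun τ κ hκ hτM hτ hτB => ?_⟩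
  have hκ' : κ₀ ≤ ‖(κ : ℂ)‖ := by
    rw [Complex.norm_real]
    exact hκ.trans (le_abs_self κ)
  have hτ' : Vanish 2 (toComplex τ - C (κ : ℂ) * lin (c : ℂ) (s : ℂ)) := by
    have := hτ.toComplex
    rwa [show toComplex (τ - C κ * lin c s) = toComplex τ - C (κ : ℂ) * toComplex (lin c s) by
      simp [toComplex], toComplex_lin] at this
  have hτM' := (totalDegree_toComplex_le τ).trans hτM
  have hτB' : wnorm 1 (toComplex τ) ≤ B₀ := by rwa [wnorm_map]
  obtain ⟨a, ha⟩ := hsol₁ (toComplex τ) κ hκ' hτM' hτ' hτB'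
  have hj := (ha j le_rfl).1
  rw [Nat.add_sub_cancel_left] at hj
  obtain ⟨b, e, hblap, hbdeg, hbc, hbv, hbB, heB⟩ := hsol₂ (toComplex τ) (polyLap (a j)) κ 0 hκ'
    hτM' hτ' (hτB'.trans (le_max_left _ _)) (((wnorm_one_polyLap_le hj).trans
      (mul_le_mul_of_nonneg_left (ha j le_rfl).2.2.2 (by positivity))).trans (le_max_right _ _))
    (by simp [hB₀])
  -- a quartic correction of the last but one component
  set Z := C (e / 12) * Y ^ 4 with hZ
  have hZh : Z.IsHomogeneous 4 := isHomogeneous_C_mul_lin_pow _ _ _ 4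
  have hZv : Vanish 4 Z := vanish_of_isHomogeneous hZh
  have hZB : wnorm 1 Z ≤ B₂ * wnorm 1 (Y ^ 4) := by
    rw [hZ, wnorm_C_mul, norm_div, RCLike.norm_ofNat]
    gcongr
    linarith [norm_nonneg e]
  have hZlap : polyLap Z = C e * Y ^ 2 := by
    rw [hZ, polyLap_C_mul, polyLap_lin_pow_four hcs', ← mul_assoc, ← C_mul]
    congr 2
    ring
  have hZt : Vanish 4 (transport (toComplex τ) Z) := by
    have h1 := vanish_transport_sub (j := 3) hτ' hZv
    rwa [hZ, gradDot_C_mul_left, gradDot_lin_pow_four, mul_zero, mul_zero, sub_zero] at h1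
  set a' : ℕ → MvPolynomial (Fin 2) ℂ :=
    fun k => if k < j then a k else if k = j then a j - Z else b with ha'
  have ha'1 : ∀ k < j, a' k = a k := fun k hk => if_pos hk
  have ha'2 : a' j = a j - Z := by simp [ha']
  have ha'3 : a' (j + 1) = b := by simp [ha']
  have hcases : ∀ k ≤ j + 3 - 2, k < j ∨ k = j ∨ k = j + 1 := fun k hk => by omega
  refine ⟨a', fun ω => isAmplitude_of_hierarchy (by omega) (fun k hk => ?_) (fun k hk => ?_)
    (fun k hk => ?_) ?_ ω, fun k hk => ?_⟩
  · rcases hcases k hk with h | rfl | rfl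
    · rw [ha'1 k h]
      exact (ha k h.le).1
    · rw [ha'2, show k + 3 + 1 - k = 4 by omega]
      exact (totalDegree_sub _ _).trans (max_le hj hZh.totalDegree_le)
    · rw [ha'3, show j + 3 + 1 - (j + 1) = 3 by omega]
      exact hbdeg
  · rcases hcases k hk with h | rfl | rfl
    · rw [ha'1 k h]
      exact (ha k h.le).2.1
    · rw [ha'2, map_sub, constantCoeff_eq_zero_of_vanish hZv, sub_zero]
      exact (ha k le_rfl).2.1
    · rw [ha'3, hbc, if_neg (by omega)]
  · rcases hcases k hk with h | rfl | rfl
    · have hh : hierarchy (toComplex τ) a' k = hierarchy (toComplex τ) a k := by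
        cases k with
        | zero => simp only [hierarchy, ha'1 0 h]
        | succ k => simp only [hierarchy, ha'1 (k + 1) h, ha'1 k (by omega)]
      rw [hh]
      exact (ha k h.le).2.2.1
    · have hh : hierarchy (toComplex τ) a' k =
          hierarchy (toComplex τ) a k - transport (toComplex τ) Z := by
        cases k with
        | zero => simp only [hierarchy, ha'2, transport_sub]
        | succ k => simp only [hierarchy, ha'2, ha'1 k (by omega), transport_sub]; ring
      have h1 := (ha k le_rfl).2.2.1
      rw [Nat.add_sub_cancel_left] at h1
      rw [hh, show k + 3 + 1 - k = 4 by omega]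
      exact h1.sub hZt
    · rw [hierarchy, ha'3, ha'2, polyLap_sub, hZlap, ← add_sub_assoc,
        show j + 3 + 1 - (j + 1) = 3 by omega]
      exact hbv
  · rw [show j + 3 - 2 = j + 1 by omega, ha'3, hblap]
  · have h0 : 0 ≤ B₂ * wnorm 1 (Y ^ 4) := by positivity
    rcases hcases k hk with h | rfl | rfl
    · rw [ha'1 k h]
      linarith [(ha k h.le).2.2.2]
    · rw [ha'2]
      linarith [wnorm_sub_le zero_le_one (a k) Z, (ha k le_rfl).2.2.2]
    · rw [ha'3]
      linarith

end Amplitude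

/-! ### Uniformly bounded phases and amplitudes -/

section Construction

lemma coeff_tayP {K : Set Plane} {r₀ : Plane} {ξ : Plane → ℝ} {k : ℕ} {m : Fin 2 →₀ ℕ}
    (hm : m.degree < k) : coeff m (tayP K r₀ k ξ) = coeff m (tayH K r₀ m.degree ξ) := by
  rw [tayP, coeff_sum, Finset.sum_eq_single m.degree]
  · intro j _ hj
    exact (tayH_isHomogeneous j ξ).coeff_eq_zero hj.symm
  · intro hnm
    exact absurd (Finset.mem_range.mpr hm) hnm

lemma isPhase_of_vanish {K : Set Plane} (hu : UniqueDiffOn ℝ K) (hb : barycenter K ∈ K)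
    {ξ : Plane → ℝ} {q : ℕ} {θ : ℝ} (hξ : ContDiffOn ℝ ((q + 1 : ℕ) : WithTop ℕ∞) ξ K)
    {τ : MvPolynomial (Fin 2) ℝ} (hdeg : τ.totalDegree ≤ q + 2)
    (hlin : Vanish 2 (τ - C √(ξ (barycenter K)) * lin (Real.cos θ) (Real.sin θ)))
    (hv : Vanish (q + 2) (gradDot τ τ - tayP K (barycenter K) (q + 2) ξ)) :
    IsPhase K ξ q θ τ where
  degree_le := hdeg
  constant := by
    have := hlin 0 (by simp)
    rw [coeff_sub, sub_eq_zero] at this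
    rw [constantCoeff_eq, this]
    simp [lin]
  linear_x := by
    have := hlin (Finsupp.single 0 1) (by simp)
    rw [coeff_sub, sub_eq_zero] at this
    rw [this]
    simp [lin, coeff_X, Finsupp.single_left_inj]
  linear_y := by
    have := hlin (Finsupp.single 1 1) (by simp)
    rw [coeff_sub, sub_eq_zero] at this
    rw [this]
    simp [lin, coeff_X, Finsupp.single_left_inj]
  eikonal j hj v := by
    have h1 : homogeneousComponent j (gradDot τ τ) = tayH K (barycenter K) j ξ := by
      ext m
      rw [coeff_homogeneousComponent]
      split_ifs with h
      · have h2 := hv m (by omega)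
        rwa [coeff_sub, sub_eq_zero, coeff_tayP (by omega), h] at h2
      · exact ((tayH_isHomogeneous j ξ).coeff_eq_zero h).symm
    rw [h1]
    exact eval_tayH hu hb j (hξ.of_le (by exact_mod_cast hj)) v

lemma coeffBound_of_wnorm {q : ℕ} {B : ℝ} (hB : 1 ≤ B) {τ : MvPolynomial (Fin 2) ℝ}
    {a : ℕ → MvPolynomial (Fin 2) ℂ} (hτ : wnorm 1 τ ≤ B)
    (ha : ∀ s ≤ q - 2, wnorm 1 (a s) ≤ B) : CoeffBound q B τ a where
  phase m := ((norm_coeff_le_wnorm τ m).trans hτ).trans (le_self_pow₀ hB (Nat.succ_ne_zero _))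
  amplitude s hs m :=
    ((norm_coeff_le_wnorm (a s) m).trans (ha s hs)).trans (le_self_pow₀ hB (Nat.succ_ne_zero _))

/-- A quartic term in the direction orthogonal to the phase is admissible for `q = 2`. -/
lemma vanish_gradDot_add_quartic {c s t κ : ℝ} {τ T : MvPolynomial (Fin 2) ℝ}
    (hτ : Vanish 2 (τ - C κ * lin c s)) (hv : Vanish 4 (gradDot τ τ - T)) :
    Vanish 4 (gradDot (τ + C t * lin (-s) c ^ 4) (τ + C t * lin (-s) c ^ 4) - T) := by
  set Z := C t * lin (-s) c ^ 4 with hZ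
  have hZv : Vanish 4 Z := vanish_of_isHomogeneous (isHomogeneous_C_mul_lin_pow _ _ _ 4)
  have h0 : gradDot Z (lin c s) = 0 := by
    rw [hZ, gradDot_C_mul_left, gradDot_lin_pow_four, mul_zero]
  have h1 : gradDot (τ + Z) (τ + Z) - T =
      gradDot τ τ - T + 2 * gradDot Z (τ - C κ * lin c s) + gradDot Z Z +
        2 * (C κ * gradDot Z (lin c s)) := by
    simp only [gradDot, Fin.sum_univ_two, map_add, map_sub, pderiv_C_mul]
    ring
  rw [h1, h0, mul_zero, mul_zero, add_zero]
  exact (hv.add (Vanish.mul_left 2 (hZv.gradDot (i := 3) (j := 1) hτ))).add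
    ((hZv.gradDot (i := 3) (j := 3) hZv).mono (by omega))

lemma exists_phase (q : ℕ) (θ : ℝ) {ρ μ M : ℝ} (hρ : 0 < ρ) (hμ : 0 < μ) (hM : 0 ≤ M) :
    ∃ B : ℝ, 0 ≤ B ∧ ∀ (h : ℝ) (K : Set Plane) (ξ : Plane → ℝ), 0 < h → IsElement K h ρ →
      ContDiffOn ℝ ((q + 1 : ℕ) : WithTop ℕ∞) ξ K → (∀ x ∈ K, μ ≤ ξ x) →
      ckNorm K (q + 1) ξ ≤ ENNReal.ofReal M → ∃ τ : MvPolynomial (Fin 2) ℝ,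
        τ.totalDegree ≤ q + 2 ∧
        Vanish 2 (τ - C √(ξ (barycenter K)) * lin (Real.cos θ) (Real.sin θ)) ∧
        Vanish (q + 2) (gradDot τ τ - tayP K (barycenter K) (q + 2) ξ) ∧ wnorm 1 τ ≤ B := by
  have hcs : Real.cos θ * Real.cos θ + Real.sin θ * Real.sin θ = 1 := by
    rw [← sq, ← sq, Real.cos_sq_add_sin_sq]
  -- The root bounds κ = √ξ(r₀), the sum bounds the Taylor polynomial of ξ.
  set B₀ : ℝ := √M + ∑ j ∈ Finset.range (q + 2), 2 ^ j * M with hB₀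
  have hsum : 0 ≤ ∑ j ∈ Finset.range (q + 2), 2 ^ j * M :=
    Finset.sum_nonneg fun j _ => by positivity
  have hB₀0 : 0 ≤ B₀ := by positivity
  obtain ⟨B, hB, hsol⟩ := exists_eikonal_solution hcs (q + 1) (Real.sqrt_pos.mpr hμ) hB₀0
  refine ⟨B, hB, fun h K ξ hh hK hξ hξμ hξM => ?_⟩
  obtain ⟨c, -, htame⟩ := hK.exists_isTame hh hρ
  have hpart : ∀ j ≤ q + 1, PartialsLE K j M ξ := fun j hj =>
    partialsLE_of_ckNorm htame.unique hj hM hξ hξM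
  have hξ0 : 0 ≤ ξ (barycenter K) := hμ.le.trans (hξμ _ hK.barycenter_mem)
  refine hsol _ √(ξ (barycenter K)) ?_ ?_ ?_ ?_
  · rw [Real.norm_of_nonneg (Real.sqrt_nonneg _)]
    exact Real.sqrt_le_sqrt (hξμ _ hK.barycenter_mem)
  · rw [Real.norm_of_nonneg (Real.sqrt_nonneg _)]
    have h1 : ξ (barycenter K) ≤ M :=
      (le_abs_self _).trans (hpart 0 (by omega) _ hK.barycenter_mem)
    linarith [Real.sqrt_le_sqrt h1]
  · refine (wnorm_sum_le zero_le_one _ _).trans ((Finset.sum_le_sum fun j hj => ?_).trans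
      (le_add_of_nonneg_left (Real.sqrt_nonneg M)))
    have := Finset.mem_range.mp hj
    exact wnorm_tayH_le hK.barycenter_mem j (hpart j (by omega))
  · rw [Real.mul_self_sqrt hξ0, constantCoeff_eq, coeff_tayP (by simp)]
    simp [tayH]

/-- For q = 2 no earlier amplitude exists to carry the quartic correction, so the phase takes it.
This is allowed because the gradient of Y⁴ is orthogonal to the linear part of the phase, and the
eikonal equation is unaffected up to degree 3. -/
theorem exists_phase_amplitude (q : ℕ) (hq : 2 ≤ q) (θ : ℝ) {ρ μ M : ℝ} (hρ : 0 < ρ) (hμ : 0 < μ)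
    (hM : 0 ≤ M) :
    ∃ B : ℝ, 1 ≤ B ∧ ∀ (h : ℝ) (K : Set Plane) (ξ : Plane → ℝ), 0 < h → IsElement K h ρ →
      ContDiffOn ℝ ((q + 1 : ℕ) : WithTop ℕ∞) ξ K → (∀ x ∈ K, μ ≤ ξ x) →
      ckNorm K (q + 1) ξ ≤ ENNReal.ofReal M →
      ∃ (τ : MvPolynomial (Fin 2) ℝ) (a : ℕ → MvPolynomial (Fin 2) ℂ), IsPhase K ξ q θ τ ∧
        (∀ ω : ℝ, IsAmplitude q ω τ a) ∧ CoeffBound q B τ a := by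
  have hcs : Real.cos θ * Real.cos θ + Real.sin θ * Real.sin θ = 1 := by
    rw [← sq, ← sq, Real.cos_sq_add_sin_sq]
  have hκ₀ := Real.sqrt_pos.mpr hμ
  obtain ⟨B₁, hB₁, hsol⟩ := exists_phase q θ hρ hμ hM
  rcases Nat.lt_or_eq_of_le hq with hlt | rfl
  · obtain ⟨B₂, hB₂, hsol₂⟩ := exists_amplitude_of_two_lt hcs hlt hκ₀ hB₁
    refine ⟨1 + B₁ + B₂, by linarith, fun h K ξ hh hK hξ hξμ hξM => ?_⟩
    obtain ⟨c, -, htame⟩ := hK.exists_isTame hh hρ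
    obtain ⟨τ, hdeg, hlin, hv, hτB⟩ := hsol h K ξ hh hK hξ hξμ hξM
    obtain ⟨a, ha, haB⟩ := hsol₂ τ _ (Real.sqrt_le_sqrt (hξμ _ hK.barycenter_mem)) hdeg hlin hτB
    exact ⟨τ, a, isPhase_of_vanish htame.unique hK.barycenter_mem hξ hdeg hlin hv, ha,
      coeffBound_of_wnorm (by linarith) (by linarith) fun k hk => by linarith [haB k hk]⟩
  · obtain ⟨B₂, hB₂, hsol₂⟩ := exists_amplitude_two hcs hκ₀ B₁
    set Y : MvPolynomial (Fin 2) ℝ := lin (-Real.sin θ) (Real.cos θ) with hY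
    have hwY := wnorm_nonneg zero_le_one (Y ^ 4)
    have hBY : 0 ≤ B₂ * wnorm 1 (Y ^ 4) := by positivity
    refine ⟨1 + B₁ + B₂ + B₂ * wnorm 1 (Y ^ 4), by linarith, fun h K ξ hh hK hξ hξμ hξM => ?_⟩
    obtain ⟨c, -, htame⟩ := hK.exists_isTame hh hρ
    obtain ⟨τ, hdeg, hlin, hv, hτB⟩ := hsol h K ξ hh hK hξ hξμ hξM
    obtain ⟨t, a, htB, ha, haB⟩ := hsol₂ τ _ (Real.sqrt_le_sqrt (hξμ _ hK.barycenter_mem)) hdeg hlin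
      hτB
    have hZh : (C t * Y ^ 4).IsHomogeneous 4 := isHomogeneous_C_mul_lin_pow _ _ _ 4
    refine ⟨τ + C t * Y ^ 4, a, isPhase_of_vanish htame.unique hK.barycenter_mem hξ ?_ ?_
      (vanish_gradDot_add_quartic hlin hv), ha, coeffBound_of_wnorm (by linarith) ?_
      fun k hk => by linarith [haB k hk]⟩
    · exact (totalDegree_add _ _).trans (max_le hdeg hZh.totalDegree_le)
    · rw [add_sub_right_comm]
      exact hlin.add ((vanish_of_isHomogeneous hZh).mono (by omega))
    · have h1 : wnorm 1 (C t * Y ^ 4) ≤ B₂ * wnorm 1 (Y ^ 4) := by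
        rw [wnorm_C_mul, Real.norm_eq_abs]
        gcongr
      linarith [wnorm_add_le zero_le_one τ (C t * Y ^ 4)]

end Construction

end GOPW

end

theorem theorem2p1 (n : ℕ) (hn : 2 ≤ n) (θ : Fin (2 * n + 1) → ℝ)
    (hθ : Function.Injective fun l => (Real.cos (θ l), Real.sin (θ l)))
    (C₀ ρ μ M : ℝ) (hC₀ : 0 < C₀) (hρ : 0 < ρ) (hμ : 0 < μ) (hM : 0 < M) :
    -- phases and amplitudes exist, independent of `ω`, with uniformly bounded coefficients
    (∀ q : ℕ, 2 ≤ q → ∃ B : ℝ, 0 < B ∧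
      ∀ (h : ℝ) (K : Set GOPW.Plane) (ξ : GOPW.Plane → ℝ), 0 < h → GOPW.IsElement K h ρ →
        ContDiffOn ℝ ((q + 1 : ℕ) : WithTop ℕ∞) ξ K → (∀ x ∈ K, μ ≤ ξ x) →
        GOPW.ckNorm K (q + 1) ξ ≤ ENNReal.ofReal M →
        ∃ (τ : Fin (2 * n + 1) → MvPolynomial (Fin 2) ℝ)
          (a : Fin (2 * n + 1) → ℕ → MvPolynomial (Fin 2) ℂ), ∀ l,
          GOPW.IsPhase K ξ q (θ l) (τ l) ∧ (∀ ω : ℝ, 0 < ω → GOPW.IsAmplitude q ω (τ l) (a l)) ∧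
          GOPW.CoeffBound q B (τ l) (a l)) ∧
    -- every space spanned by such functions has the approximation property
    (∀ A B : ℝ, 0 < A → 0 < B → ∃ ω₀ C : ℝ, 1 < ω₀ ∧ 0 < C ∧
      ∀ (ω h : ℝ) (K : Set GOPW.Plane) (ξ : GOPW.Plane → ℝ) (q : ℕ)
        (τ : Fin (2 * n + 1) → MvPolynomial (Fin 2) ℝ)
        (a : Fin (2 * n + 1) → ℕ → MvPolynomial (Fin 2) ℂ),
        ω₀ ≤ ω → 0 < h → ω * h ≤ C₀ → q = GOPW.order n ω h → GOPW.IsElement K h ρ →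
        ContDiffOn ℝ ((q + 1 : ℕ) : WithTop ℕ∞) ξ K → (∀ x ∈ K, μ ≤ ξ x) →
        GOPW.ckNorm K (min (q + 1) n) ξ ≤ ENNReal.ofReal M →
        (∀ l, GOPW.IsPhase K ξ q (θ l) (τ l) ∧ GOPW.IsAmplitude q ω (τ l) (a l) ∧
          GOPW.CoeffBound q B (τ l) (a l)) →
        (∀ u : GOPW.Plane → ℂ, GOPW.IsStableSolution K ξ ω A (n + 1) u →
          ∃ u_p ∈ GOPW.space K q ω τ a,
            (∀ x ∈ K, ‖u x - u_p x‖ ≤ C * h ^ (n + 1) * ω ^ (n + 1)) ∧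
            ∀ k, 3 ≤ k → k ≤ n + 1 → ∀ l ≤ 1,
              GOPW.ckNorm K l (u - u_p) ≤ ENNReal.ofReal (C * h ^ (k - l) * ω ^ k)) ∧
        (∀ k, 3 ≤ k → k ≤ n + 1 → ∀ u : GOPW.Plane → ℂ, GOPW.IsStableSolution K ξ ω A k u →
          ∃ u_p ∈ GOPW.space K q ω τ a, ∀ l ≤ 1,
            GOPW.ckNorm K l (u - u_p) ≤ ENNReal.ofReal (C * h ^ (k - l) * ω ^ k))) := by
  refine ⟨fun q hq => ?_, fun A B hA hB =>
    GOPW.exists_ckNorm_approximation n hn θ hθ C₀ ρ μ M hC₀ hρ hμ hM A B hA hB⟩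
  choose B hB hsol using fun l => GOPW.exists_phase_amplitude q hq (θ l) hρ hμ hM.le
  -- One bound for all directions: the sum of the individual ones.
  have hle : ∀ l, B l ≤ ∑ i, B i := fun l =>
    Finset.single_le_sum (fun i _ => zero_le_one.trans (hB i)) (Finset.mem_univ l)
  refine ⟨∑ i, B i, zero_lt_one.trans_le ((hB 0).trans (hle 0)),
    fun h K ξ hh hK hξ hξμ hξM => ?_⟩
  choose τ a hτ ha hc using fun l => hsol l h K ξ hh hK hξ hξμ hξM
  exact ⟨τ, a, fun l => ⟨hτ l, fun ω _ => ha l ω,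
    (hc l).mono (zero_le_one.trans (hB l)) (hle l)⟩⟩
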